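/- Let $\mathcal H$ be a separable complex Hilbert space and let $H_0$, $A$ be operators on $\mathcal H$ such that $H_0$ is self-adjoint, $A$ is closed and symmetric with $D(H_0)\subset D(A)$, and $\sup_{\lambda\in\mathbb R}\|A(H_0-\lambda\pm i\varepsilon)^{-1}\|<1$ for some $\varepsilon>0$. Put $H=H_0+A$ on $D(H)=D(H_0)$, and let $M\in\mathbb R$. There are constants $\alpha,C>0$, depending only on $H_0$, $A$ and $M$ (in particular not on $T$), such that the following holds for every $T>0$, with $I=(0,T)$, every strongly continuous family $(B(t))_{t\in[0,T]}$ of bounded self-adjoint operators on $\mathcal H$ with $\sup_{t\in[0,T]}\|B(t)\|\le M$, every $u_0\in\mathcal H$ and every $f\in L^2(I,\mathcal H)$. Equip $H^1(I,\mathcal H)$ with the norm $\|v\|_{H^1(I,\mathcal H)}=\big(|v(0)|^2+T\|\partial_t v\|_{L^2(I,\mathcal H)}^2\big)^{1/2}$, where $v(0)$ is the value at $0$ of the continuous representative of $v$. For $v\in H^1(I,\mathcal H)$ let $$F(v)=|v(0)-u_0|^2+T\,\big\|\big(i\partial_t-e^{itH_0}(A+B(t))e^{-itH_0}\big)v-e^{itH_0}f\big\|_{L^2(I,\mathcal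 H)}^2 .$$ 1. $F$ is well defined on $H^1(I,\mathcal H)$: for every $v\in H^1(I,\mathcal H)$, $e^{-itH_0}v(t)\in D(A)$ for a.e. $t\in I$, and $t\mapsto e^{itH_0}(A+B(t))e^{-itH_0}v(t)$ belongs to $L^2(I,\mathcal H)$. Moreover $F$ is quadratic: $F(v)=b(v,v)-2\,\mathrm{Re}\,m(v)+c$ with a Hermitian sesquilinear form $b$, a linear form $m$ and a constant $c$. 2. There is exactly one weak solution $u^*\in L^2(I,\mathcal H)$ of $(i\partial_t-H-B(t))u^*=f$, $u^*(0)=u_0$, i.e. exactly one $u^*\in L^2(I,\mathcal H)$ that has a continuous representative on $[0,T]$ with value $u_0$ at $0$ and satisfies $$\int_I\langle u^*,(i\partial_t-H-B(t))\varphi\rangle\,dt=\int_I\langle f,\varphi\rangle\,dt\quad\text{for all }\varphi\in C^0_c(I,D(H))\cap C^1(I,\mathcal H),$$ where $D(H)$ carries the graph norm. 3. The function $v^*(t)=e^{itH_0}u^*(t)$ belongs to $H^1(I,\mathcal H)$ and, for every $v\in H^1(I,\mathcal H)$, $$\frac{\alpha}{(1+T)^\gamma}\,\|v-v^*\|_{H^1(I,\mathcal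 H)}\le\sqrt{F(v)}\le C(1+T)\,\|v-v^*\|_{H^1(I,\mathcal H)},$$ with $\gamma=1$ if $B=0$ on $[0,T]$ and $\gamma=2$ otherwise. In particular, $v^*$ is the unique minimizer of $F$ over $H^1(I,\mathcal H)$. -/

import Mathlib

open MeasureTheory Set Filter Topology
open scoped ENNReal ContDiff

noncomputable section

namespace SpaceTimeSchrodinger

section Operators

variable {E : Type*} [NormedAddCommGroup E] [InnerProductSpace ℂ E]

open Classical in
/-- Application of an unbounded operator to a vector of the whole space, with the value `0` at the
vectors that do not belong to its domain. -/
def applyExt (A : E →ₗ.[ℂ] E) (x : E) : E :=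
  if h : x ∈ A.domain then A ⟨x, h⟩ else 0

open Classical in
/-- `resolventApply H z y = (H - z)⁻¹ y`, i.e. the vector `x` of the domain of `H` with
`H x - z x = y` (unique when `H` is self-adjoint and `z` is not real; `0` if there is none). -/
def resolventApply (H : E →ₗ.[ℂ] E) (z : ℂ) (y : E) : E :=
  if h : ∃ x : H.domain, H x - z • (x : E) = y then (h.choose : E) else 0

/-- `U` is the strongly continuous one-parameter unitary group whose generator is exactly `i H`,
that is, `U t = e^{itH}`. -/
structure IsUnitaryGroupOf (H : E →ₗ.[ℂ] E) (U : ℝ → E →L[ℂ] E) : Prop where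
  map_zero : U 0 = 1
  map_add : ∀ s t : ℝ, U (s + t) = U s * U t
  norm_map : ∀ (t : ℝ) (x : E), ‖U t x‖ = ‖x‖
  continuous : ∀ x : E, Continuous fun t : ℝ => U t x
  generator : ∀ x y : E,
    HasDerivAt (fun t : ℝ => U t x) (Complex.I • y) 0 ↔ (x, y) ∈ H.graph

open Classical in
/-- The unitary group `e^{itH}` of a self-adjoint operator `H` (it exists and is unique by Stone's
theorem). -/
def expI (H : E →ₗ.[ℂ] E) : ℝ → E →L[ℂ] E :=
  if h : ∃ U : ℝ → E →L[ℂ] E, IsUnitaryGroupOf H U then h.choose else fun _ => 1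

/-- The assumptions on the pair `(H₀, A)`: `H₀` is self-adjoint, `A` is closed and symmetric with
`D(H₀) ⊆ D(A)`, and `sup_{λ ∈ ℝ} ‖A (H₀ - λ ± iε)⁻¹‖ < 1` for some `ε > 0`. -/
structure AssumptionA [CompleteSpace E] (H₀ A : E →ₗ.[ℂ] E) : Prop where
  selfAdjoint : IsSelfAdjoint H₀
  closed : A.IsClosed
  symmetric : ∀ x y : A.domain, inner ℂ (A x) (y : E) = inner ℂ (x : E) (A y)
  domain_le : H₀.domain ≤ A.domain
  resolvent_bound : ∃ ε : ℝ, 0 < ε ∧ ∃ c : ℝ, c < 1 ∧ ∀ (l : ℝ) (x : E),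
    ‖applyExt A (resolventApply H₀ (l - ε * Complex.I) x)‖ ≤ c * ‖x‖ ∧
    ‖applyExt A (resolventApply H₀ (l + ε * Complex.I) x)‖ ≤ c * ‖x‖

/-- `B` is a strongly continuous family of bounded self-adjoint operators on `[0, T]`. -/
structure IsAdmissibleFamily [CompleteSpace E] (T : ℝ) (B : ℝ → E →L[ℂ] E) : Prop where
  selfAdjoint : ∀ t ∈ Icc 0 T, IsSelfAdjoint (B t)
  continuous : ∀ x : E, ContinuousOn (fun t => B t x) (Icc 0 T)

open Classical in
/-- The exponent `γ`: it is `1` if `B = 0` on `[0, T]` and `2` otherwise. -/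
def gammaExp (T : ℝ) (B : ℝ → E →L[ℂ] E) : ℕ :=
  if ∀ t ∈ Icc 0 T, B t = 0 then 1 else 2

end Operators

section Bochner

variable (T : ℝ) (E : Type*) [NormedAddCommGroup E] [InnerProductSpace ℂ E]

/-- The Bochner space `L²(I, E)` with `I = (0, T)`. -/
abbrev L2 : Type _ := Lp E 2 (volume.restrict (Ioo (0 : ℝ) T))

variable {T E}

/-- `u(0) = x`, where `u` is identified with its continuous representative on `[0, T]`. -/
def HasInitialValue (u : L2 T E) (x : E) : Prop :=
  ∃ w : ℝ → E, ContinuousOn w (Icc 0 T) ∧ u =ᵐ[volume.restrict (Ioo (0 : ℝ) T)] w ∧ w 0 = x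

open Classical in
/-- The value `u(0)` of the continuous representative of `u`. -/
def initialValue (u : L2 T E) : E :=
  if h : ∃ x : E, HasInitialValue u x then h.choose else 0

/-- `g` is the weak derivative of `v` on `(0, T)`. -/
def IsWeakDeriv (v g : L2 T E) : Prop :=
  ∀ φ : ℝ → ℝ, ContDiff ℝ ∞ φ → HasCompactSupport φ → tsupport φ ⊆ Ioo 0 T →
    ∫ t in Ioo 0 T, deriv φ t • v t = -∫ t in Ioo 0 T, φ t • g t

lemma integrable_test (φ : ℝ → ℝ) (hφ : Continuous φ) (hc : HasCompactSupport φ) (v : L2 T E) :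
    Integrable (fun t => φ t • v t) (volume.restrict (Ioo (0 : ℝ) T)) :=
  (((Lp.memLp v).integrable one_le_two).locallyIntegrable).integrable_smul_left_of_hasCompactSupport
    hφ hc

lemma IsWeakDeriv.add {v w g h : L2 T E} (hv : IsWeakDeriv v g) (hw : IsWeakDeriv w h) :
    IsWeakDeriv (v + w) (g + h) := by
  intro φ hφ hc hs
  have hd : Continuous (deriv φ) := hφ.continuous_deriv (by simp)
  have e1 : ∫ t in Ioo 0 T, deriv φ t • (v + w : L2 T E) t =
      ∫ t in Ioo 0 T, (deriv φ t • v t + deriv φ t • w t) := by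
    refine integral_congr_ae ?_
    filter_upwards [Lp.coeFn_add v w] with t ht
    rw [ht, Pi.add_apply, smul_add]
  have e2 : ∫ t in Ioo 0 T, φ t • (g + h : L2 T E) t =
      ∫ t in Ioo 0 T, (φ t • g t + φ t • h t) := by
    refine integral_congr_ae ?_
    filter_upwards [Lp.coeFn_add g h] with t ht
    rw [ht, Pi.add_apply, smul_add]
  rw [e1, e2, integral_add (integrable_test _ hd hc.deriv v) (integrable_test _ hd hc.deriv w),
    integral_add (integrable_test _ hφ.continuous hc g) (integrable_test _ hφ.continuous hc h),
    hv φ hφ hc hs, hw φ hφ hc hs]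
  abel

lemma IsWeakDeriv.smul {v g : L2 T E} (c : ℂ) (hv : IsWeakDeriv v g) :
    IsWeakDeriv (c • v) (c • g) := by
  intro φ hφ hc hs
  have key : ∀ (ψ : ℝ → ℝ) (u : L2 T E), ∫ t in Ioo 0 T, ψ t • (c • u : L2 T E) t =
      c • ∫ t in Ioo 0 T, ψ t • u t := by
    intro ψ u
    rw [← integral_smul]
    refine integral_congr_ae ?_
    filter_upwards [Lp.coeFn_smul c u] with t ht
    rw [ht, Pi.smul_apply, smul_comm]
  rw [key, key, hv φ hφ hc hs, smul_neg]

variable (T E)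

/-- The Sobolev space `H¹(I, E)` with `I = (0, T)`. -/
def H1 : Submodule ℂ (L2 T E) where
  carrier := {v | ∃ g : L2 T E, IsWeakDeriv v g}
  add_mem' := fun ⟨g, hg⟩ ⟨h, hh⟩ => ⟨g + h, hg.add hh⟩
  zero_mem' := ⟨0, fun φ _ _ _ => by
    have e : ∀ ψ : ℝ → ℝ, ∫ t in Ioo 0 T, ψ t • (0 : L2 T E) t = 0 := fun ψ => by
      rw [integral_congr_ae (g := fun _ => (0 : E)), integral_zero]
      filter_upwards [Lp.coeFn_zero E 2 (volume.restrict (Ioo (0 : ℝ) T))] with t ht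
      rw [ht, Pi.zero_apply, smul_zero]
    rw [e, e, neg_zero]⟩
  smul_mem' := fun c _ ⟨g, hg⟩ => ⟨c • g, hg.smul c⟩

variable {T E}

/-- The weak derivative `∂ₜ v ∈ L²(I, E)` of `v ∈ H¹(I, E)`. -/
def weakDeriv (v : H1 T E) : L2 T E :=
  Classical.choose (show ∃ g : L2 T E, IsWeakDeriv (v : L2 T E) g from v.2)

/-- The (`T`-scaled) norm `(|v(0)|² + T ‖∂ₜ v‖²_{L²})^{1/2}` of `H¹(I, E)`, that is, the norm for
which `u ↦ e^{itH₀} u` is isometric from the space of solutions to `H¹(I, E)`. -/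
def h1Norm (v : H1 T E) : ℝ :=
  Real.sqrt (‖initialValue (v : L2 T E)‖ ^ 2 + T * ‖weakDeriv v‖ ^ 2)

end Bochner

section Equation

variable {T : ℝ} {E : Type*} [NormedAddCommGroup E] [InnerProductSpace ℂ E]

/-- `u ∈ L²(I, E)` is a weak solution of `(i ∂ₜ - H - B(t)) u = f` on `I = (0, T)`, `u(0) = u₀`.
Test functions are the elements of `C⁰_c(I, D(H)) ∩ C¹(I, E)`, where `D(H)` carries the graph
norm. -/
def IsWeakSolution (H : E →ₗ.[ℂ] E) (B : ℝ → E →L[ℂ] E) (u₀ : E) (f u : L2 T E) : Prop :=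
  (∀ φ : ℝ → H.domain,
    ContDiff ℝ 1 (fun t => (φ t : E)) → Continuous (fun t => H (φ t)) →
    HasCompactSupport (fun t => (φ t : E)) → tsupport (fun t => (φ t : E)) ⊆ Ioo 0 T →
    ∫ t in Ioo 0 T,
        inner ℂ (u t) (Complex.I • deriv (fun s => (φ s : E)) t - H (φ t) - B t (φ t : E)) =
      ∫ t in Ioo 0 T, inner ℂ (f t) (φ t : E)) ∧
  HasInitialValue u u₀

/-- The function `t ↦ e^{itH₀} (A + B(t)) e^{-itH₀} v(t)`. -/
def skewedPotential (H₀ A : E →ₗ.[ℂ] E) (B : ℝ → E →L[ℂ] E) (v : ℝ → E) (t : ℝ) : E :=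
  expI H₀ t (applyExt A (expI H₀ (-t) (v t)) + B t (expI H₀ (-t) (v t)))

/-- The function `(i ∂ₜ - e^{itH₀} (A + B(t)) e^{-itH₀}) v - e^{itH₀} f`. -/
def residual (H₀ A : E →ₗ.[ℂ] E) (B : ℝ → E →L[ℂ] E) (f : L2 T E) (v : H1 T E) (t : ℝ) : E :=
  Complex.I • weakDeriv v t - skewedPotential H₀ A B (v : L2 T E) t - expI H₀ t (f t)

/-- The least-squares functional
`F(v) = |v(0) - u₀|² + T ‖(i ∂ₜ - e^{itH₀} (A + B(t)) e^{-itH₀}) v - e^{itH₀} f‖²_{L²(I, E)}`. -/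
def functionalF (H₀ A : E →ₗ.[ℂ] E) (B : ℝ → E →L[ℂ] E) (u₀ : E) (f : L2 T E) (v : H1 T E) : ℝ :=
  ‖initialValue (v : L2 T E) - u₀‖ ^ 2 + T * ∫ t in Ioo 0 T, ‖residual H₀ A B f v t‖ ^ 2

/-- Every term in the definition of `F(v)` makes sense, for every `v ∈ H¹(I, E)`: the value `v(0)`
and the weak derivative are uniquely determined, `e^{-itH₀} v(t)` lies in the domain of `A` for
almost every `t`, and the functions whose `L²` norm is taken are in `L²(I, E)`. -/
def FunctionalWellDefined (H₀ A : E →ₗ.[ℂ] E) (B : ℝ → E →L[ℂ] E) (f : L2 T E) : Prop :=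
  ∀ v : H1 T E,
    (∃! x : E, HasInitialValue (v : L2 T E) x) ∧
    (∃! g : L2 T E, IsWeakDeriv (v : L2 T E) g) ∧
    (∀ᵐ t ∂(volume.restrict (Ioo (0 : ℝ) T)), expI H₀ (-t) ((v : L2 T E) t) ∈ A.domain) ∧
    MemLp (skewedPotential H₀ A B (v : L2 T E)) 2 (volume.restrict (Ioo (0 : ℝ) T)) ∧
    MemLp (fun t => expI H₀ t (f t)) 2 (volume.restrict (Ioo (0 : ℝ) T))

/-- `F(v) = b(v, v) - 2 Re m(v) + c` with a Hermitian sesquilinear form `b`, a linear form `m` and a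
constant `c`. -/
def IsQuadraticFunctional {V : Type*} [AddCommGroup V] [Module ℂ V] (F : V → ℝ) : Prop :=
  ∃ (b : V →ₗ⋆[ℂ] V →ₗ[ℂ] ℂ) (m : V →ₗ[ℂ] ℂ) (c : ℝ),
    (∀ v w : V, b w v = starRingEnd ℂ (b v w)) ∧
    ∀ v : V, F v = (b v v).re - 2 * (m v).re + c

end Equation

end SpaceTimeSchrodinger

end

open SpaceTimeSchrodinger

/-!
# Space-time least squares for the Schrödinger equation

In the rotating frame, `v(t) = e^{itH₀} u(t)`, the equation `(i ∂ₜ - H₀ - A - B(t)) u = f` becomes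
`i ∂ₜ v = V v + e^{itH₀} f` with the potential `V = e^{itH₀} (A + B(t)) e^{-itH₀}`, in which no
operator other than the perturbation is unbounded. The functional is the squared norm of
`v ↦ (v(0), (i ∂ₜ - V) v)` minus the data, so everything reduces to showing that this map is an
isomorphism from `H¹(I, E)` onto `E × L²(I, E)`, with bounds that grow at most linearly in `T`.

The unboundedness of `A` is overcome by Kato smoothing (`exists_smoothing`): by Plancherel's
theorem in time, the uniform bound on `A (H₀ - λ ± iε)⁻¹` gives
`∫ₐᵇ ‖A e^{-itH₀} x‖² dt ≤ κ ‖x‖²` over intervals of bounded length. Duhamel's formula and the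
closedness of `A` extend this to `w(t) = x + ∫₀ᵗ h` (`exists_smoothing_primitive`): `e^{-itH₀} w(t)`
lies in the domain of `A` for almost every `t`, and on an interval of length `τ` starting at `a`
the integral of `‖A e^{-itH₀} w(t)‖²` is at most `κ (‖w(a)‖² + τ ∫ ‖h‖²)`. The factor `τ` is what
makes the argument work for perturbations that are not small. Summation over slices of unit length
bounds `V` from `H¹` to `L²` (`exists_potential_bound`), hence the functional from above.

For the lower bound, `V` is symmetric, so that the energy estimate
(`norm_primitive_le_of_equation`) bounds `‖w(t)‖` uniformly by the data `x` and
`r = (i ∂ₜ - V) w`. With the values at the ends of the slices under control, slices with `κ τ`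
small allow `‖h‖²` to be absorbed, and summation over the `≈ T / τ` slices gives a bound that is
linear in `T` (`exists_apriori_bound`), whether or not `B` vanishes. The same bound holds for `σ V`
with `σ ∈ [0, 1]`, and the method of continuity (`isUnit_one_add_of_bounded_below`) yields a
solution for arbitrary data (`exists_solution`).

Elements of `H¹(I, E)` are identified with primitives `t ↦ x + ∫₀ᵗ h` of functions in `L²(I, E)`;
products of such functions are differentiated by Fubini's theorem (`bilin_primitive`). Integration
by parts turns the solution in the rotating frame into a weak solution
(`isWeakSolution_of_equation`). Conversely, a weak solution with zero data, tested with
`θ(t) e^{-itH₀} ψ`, satisfies `⟪v(t), ψ⟫ = i ∫₀ᵗ ⟪v, V ψ⟫`, so the smoothing estimate for `ψ` and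
Gronwall's lemma give `v = 0` (`eq_zero_of_isWeakSolution`). This uses neither the self-adjointness
of `H₀ + A` nor its unitary group.

Stone's theorem (`exists_isUnitaryGroupOf`), in the form of the existence of `e^{itH}`, is proved by
Yosida's regularization `exists_isRegularization`, which also serves to approximate `A` by bounded
operators in the smoothing estimate.
-/

set_option linter.unusedSectionVars false

namespace SpaceTimeSchrodinger

/-! ### Resolvents of self-adjoint operators -/

section Resolvent

variable {E : Type*} [NormedAddCommGroup E] [InnerProductSpace ℂ E]

/-- A self-adjoint operator is symmetric, expressed on its graph. -/
lemma inner_graph_symm [CompleteSpace E] {H : E →ₗ.[ℂ] E} (hH : IsSelfAdjoint H) {x y x' y' : E}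
    (h : (x, y) ∈ H.graph) (h' : (x', y') ∈ H.graph) : inner ℂ y x' = inner ℂ x y' := by
  have := h'
  rw [← LinearPMap.isSelfAdjoint_def.mp hH,
    LinearPMap.adjoint_graph_eq_graph_adjoint hH.dense_domain, Submodule.mem_adjoint_iff] at this
  exact sub_eq_zero.mp (this x y h)

/-- A self-adjoint operator has no proper symmetric extension, expressed on its graph. -/
lemma mem_graph_of_inner_eq [CompleteSpace E] {H : E →ₗ.[ℂ] E} (hH : IsSelfAdjoint H) {v w : E}
    (h : ∀ x y : E, (x, y) ∈ H.graph → inner ℂ y v = inner ℂ x w) : (v, w) ∈ H.graph := by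
  rw [← LinearPMap.isSelfAdjoint_def.mp hH,
    LinearPMap.adjoint_graph_eq_graph_adjoint hH.dense_domain, Submodule.mem_adjoint_iff]
  intro a b hab
  exact sub_eq_zero.mpr (h a b hab)

lemma im_mul_norm_le [CompleteSpace E] {H : E →ₗ.[ℂ] E} (hH : IsSelfAdjoint H) (z : ℂ) {x y : E}
    (h : (x, y) ∈ H.graph) : |z.im| * ‖x‖ ≤ ‖y - z • x‖ := by
  have hs := inner_graph_symm hH h h
  have him : (inner ℂ x y : ℂ).im = 0 := by
    have h1 : (starRingEnd ℂ) (inner ℂ x y) = inner ℂ x y := by rw [inner_conj_symm, hs]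
    exact Complex.conj_eq_iff_im.mp h1
  have h2 : (inner ℂ x (y - z • x) : ℂ).im = - (z.im * ‖x‖ ^ 2) := by
    rw [inner_sub_right, inner_smul_right, inner_self_eq_norm_sq_to_K, Complex.sub_im, him]
    have : ((‖x‖ : ℂ) ^ 2) = ((‖x‖ ^ 2 : ℝ) : ℂ) := by push_cast; rfl
    simp only [Complex.coe_algebraMap]
    rw [this, Complex.im_mul_ofReal]; ring
  have h3 : |z.im| * ‖x‖ ^ 2 ≤ ‖x‖ * ‖y - z • x‖ := by
    calc |z.im| * ‖x‖ ^ 2 = |(inner ℂ x (y - z • x) : ℂ).im| := by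
          rw [h2, abs_neg, abs_mul, abs_of_nonneg (sq_nonneg ‖x‖)]
      _ ≤ ‖(inner ℂ x (y - z • x) : ℂ)‖ := Complex.abs_im_le_norm _
      _ ≤ _ := norm_inner_le_norm _ _
  rcases (norm_nonneg x).eq_or_lt with h0 | h0
  · rw [← h0]; simp
  · refine le_of_mul_le_mul_left ?_ h0
    linarith [h3, sq ‖x‖, mul_comm ‖x‖ (|z.im| * ‖x‖), mul_assoc |z.im| ‖x‖ ‖x‖]

/-- `R` is the resolvent `(H - z)⁻¹`. -/
structure IsResolvent (H : E →ₗ.[ℂ] E) (z : ℂ) (R : E →L[ℂ] E) : Prop where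
  mem_graph : ∀ y, (R y, y + z • R y) ∈ H.graph
  apply_sub : ∀ {x y}, (x, y) ∈ H.graph → R (y - z • x) = x
  norm_le : ∀ y, |z.im| * ‖R y‖ ≤ ‖y‖

/-- Self-adjointness gives the resolvent at every non-real point: `H - z` is bounded below, so its
range is closed, and the range is dense since a vector orthogonal to it would be an eigenvector of
`H` for the eigenvalue `conj z`. -/
lemma exists_isResolvent [CompleteSpace E] {H : E →ₗ.[ℂ] E} (hH : IsSelfAdjoint H) {z : ℂ}
    (hz : z.im ≠ 0) : ∃ R : E →L[ℂ] E, IsResolvent H z R := by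
  have hz' : 0 < |z.im| := abs_pos.mpr hz
  have hclosed : IsClosed (H.graph : Set (E × E)) := hH.isClosed
  have : CompleteSpace H.graph := hclosed.completeSpace_coe
  let f : H.graph →L[ℂ] E :=
    (ContinuousLinearMap.snd ℂ E E - z • ContinuousLinearMap.fst ℂ E E) ∘L H.graph.subtypeL
  have hf : ∀ p : H.graph, f p = p.1.2 - z • p.1.1 := fun p => rfl
  have hb : ∀ p : H.graph, |z.im| * ‖p.1.1‖ ≤ ‖f p‖ := fun p => by
    rw [hf]; exact im_mul_norm_le hH z p.2
  have hb1 : ∀ p : H.graph, ‖p.1.1‖ ≤ |z.im|⁻¹ * ‖f p‖ := fun p => by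
    rw [inv_mul_eq_div, le_div_iff₀ hz', mul_comm]; exact hb p
  have hanti : AntilipschitzWith (Real.toNNReal (|z.im|⁻¹ + (1 + ‖z‖ * |z.im|⁻¹))) f := by
    refine ContinuousLinearMap.antilipschitz_of_bound f fun p => ?_
    rw [Real.coe_toNNReal _ (by positivity)]
    have h2 : ‖p.1.2‖ ≤ ‖f p‖ + ‖z‖ * (|z.im|⁻¹ * ‖f p‖) := by
      have : p.1.2 = f p + z • p.1.1 := by rw [hf]; abel
      calc ‖p.1.2‖ ≤ ‖f p‖ + ‖z • p.1.1‖ := by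
            conv_lhs => rw [this]
            exact norm_add_le _ _
        _ ≤ _ := by rw [norm_smul]; gcongr; exact hb1 p
    have h3 : 0 ≤ |z.im|⁻¹ * ‖f p‖ := by positivity
    calc ‖p‖ = max ‖p.1.1‖ ‖p.1.2‖ := rfl
      _ ≤ |z.im|⁻¹ * ‖f p‖ + (‖f p‖ + ‖z‖ * (|z.im|⁻¹ * ‖f p‖)) := by
          refine max_le ((hb1 p).trans ?_) (h2.trans ?_)
          · have : 0 ≤ ‖f p‖ + ‖z‖ * (|z.im|⁻¹ * ‖f p‖) := by positivity
            linarith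
          · linarith
      _ = _ := by ring
  have hrc : IsClosed (f.range : Set E) := hanti.isClosed_range f.uniformContinuous
  have hperp : f.rangeᗮ = ⊥ := by
    rw [Submodule.eq_bot_iff]
    intro v hv
    rw [Submodule.mem_orthogonal] at hv
    have hv' : ∀ x y : E, (x, y) ∈ H.graph → inner ℂ y v = inner ℂ x ((starRingEnd ℂ) z • v) := by
      intro x y hxy
      have := hv (f ⟨(x, y), hxy⟩) ⟨⟨(x, y), hxy⟩, rfl⟩
      rw [hf, inner_sub_left, inner_smul_left] at this
      rw [inner_smul_right]
      exact sub_eq_zero.mp this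
    have hm := mem_graph_of_inner_eq hH hv'
    have := im_mul_norm_le hH ((starRingEnd ℂ) z) hm
    rw [sub_self, norm_zero, Complex.conj_im, abs_neg] at this
    exact norm_le_zero_iff.mp (nonpos_of_mul_nonpos_right this hz')
  have htop : f.range = ⊤ := by
    have : CompleteSpace f.range := hrc.completeSpace_coe
    exact Submodule.orthogonal_eq_bot_iff.mp hperp
  let e : H.graph ≃ₗ[ℂ] E :=
    LinearEquiv.ofBijective f.toLinearMap ⟨hanti.injective, LinearMap.range_eq_top.mp htop⟩
  have he : ∀ y, f (e.symm y) = y := fun y => e.apply_symm_apply y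
  let R₀ : E →ₗ[ℂ] E := (LinearMap.fst ℂ E E ∘ₗ H.graph.subtype) ∘ₗ e.symm.toLinearMap
  have hR₀ : ∀ y, R₀ y = (e.symm y).1.1 := fun y => rfl
  have hbound : ∀ y, ‖R₀ y‖ ≤ |z.im|⁻¹ * ‖y‖ := fun y => by
    have := hb1 (e.symm y)
    rwa [he] at this
  refine ⟨R₀.mkContinuous _ hbound, ?_, ?_, ?_⟩
  · intro y
    have h1 : y + z • R₀ y = (e.symm y).1.2 := by
      have := he y
      rw [hf, sub_eq_iff_eq_add] at this
      rw [hR₀]; exact this.symm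
    rw [LinearMap.mkContinuous_apply, h1]
    exact (e.symm y).2
  · intro x y hxy
    rw [LinearMap.mkContinuous_apply, hR₀]
    have : e ⟨(x, y), hxy⟩ = y - z • x := hf _
    rw [← this, LinearEquiv.symm_apply_apply]
  · intro y
    have := hb (e.symm y)
    rwa [he] at this

namespace IsResolvent

variable {H : E →ₗ.[ℂ] E} {z w : ℂ} {R S : E →L[ℂ] E}

/-- The resolvent commutes with every operator that leaves the graph of `H` invariant. -/
lemma apply_comm (hR : IsResolvent H z R) {V : E →L[ℂ] E}
    (hV : ∀ x y, (x, y) ∈ H.graph → (V x, V y) ∈ H.graph) (y : E) : V (R y) = R (V y) := by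
  have h := hR.apply_sub (hV _ _ (hR.mem_graph y))
  rw [← h, map_add, map_smul, add_sub_cancel_right]

lemma map_graph (hR : IsResolvent H z R) {x y : E} (h : (x, y) ∈ H.graph) :
    (R x, R y) ∈ H.graph := by
  have h1 := hR.apply_sub h
  rw [map_sub, map_smul, sub_eq_iff_eq_add] at h1
  rw [h1]
  exact hR.mem_graph x

/-- The resolvent identity. -/
lemma sub_eq (hR : IsResolvent H z R) (hS : IsResolvent H w S) (y : E) :
    R y - S y = (z - w) • R (S y) := by
  have h := hR.apply_sub (hS.mem_graph y)
  have : y + w • S y - z • S y = y - (z - w) • S y := by module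
  rw [this, map_sub, map_smul] at h
  rw [sub_eq_iff_eq_add.mp h, add_sub_cancel_left]

lemma inner_left [CompleteSpace E] (hH : IsSelfAdjoint H) (hR : IsResolvent H z R)
    (hS : IsResolvent H ((starRingEnd ℂ) z) S) (x y : E) : inner ℂ (R x) y = inner ℂ x (S y) := by
  have h := inner_graph_symm hH (hR.mem_graph x) (hS.mem_graph y)
  rw [inner_add_left, inner_add_right, inner_smul_left, inner_smul_right] at h
  exact (add_right_cancel h).symm

end IsResolvent

end Resolvent

/-! ### Yosida regularization -/

section Yosida

variable {E : Type*} [NormedAddCommGroup E] [InnerProductSpace ℂ E]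

lemma exists_graph_near [CompleteSpace E] {H : E →ₗ.[ℂ] E} (hH : IsSelfAdjoint H) (x : E) {δ : ℝ}
    (hδ : 0 < δ) : ∃ x' y', (x', y') ∈ H.graph ∧ ‖x - x'‖ < δ := by
  obtain ⟨x', hx', hd⟩ := Metric.dense_iff.mp hH.dense_domain x δ hδ
  refine ⟨x', H ⟨x', hd⟩, H.mem_graph ⟨x', hd⟩, ?_⟩
  rwa [mem_ball_iff_norm'] at hx'

lemma mem_graph_unique {H : E →ₗ.[ℂ] E} {x y y' : E} (h : (x, y) ∈ H.graph)
    (h' : (x, y') ∈ H.graph) : y = y' := LinearPMap.mem_graph_snd_inj H h h' rfl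

/-- Nonexpansive maps that converge on the domain of `H` converge everywhere. -/
lemma tendsto_of_tendsto_on_graph [CompleteSpace E] {H : E →ₗ.[ℂ] E} (hH : IsSelfAdjoint H)
    {S : ℕ → E → E} {S' : E → E} (hS : ∀ n x y, ‖S n x - S n y‖ ≤ ‖x - y‖)
    (hS' : ∀ x y, ‖S' x - S' y‖ ≤ ‖x - y‖)
    (h : ∀ x y, (x, y) ∈ H.graph → Tendsto (fun n => S n x) atTop (𝓝 (S' x))) (x : E) :
    Tendsto (fun n => S n x) atTop (𝓝 (S' x)) := by
  rw [Metric.tendsto_atTop]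
  intro δ hδ
  obtain ⟨x', y', hG, hx'⟩ := exists_graph_near hH x (show 0 < δ / 3 by positivity)
  obtain ⟨N, hN⟩ := Metric.tendsto_atTop.mp (h x' y' hG) (δ / 3) (by positivity)
  refine ⟨N, fun n hn => ?_⟩
  have h1 := hN n hn
  rw [dist_eq_norm] at h1 ⊢
  have h2 := hS n x x'
  have h3 := hS' x x'
  rw [norm_sub_rev] at h3
  calc ‖S n x - S' x‖ = ‖(S n x - S n x') + (S n x' - S' x') + (S' x' - S' x)‖ := by
        congr 1; abel
    _ ≤ ‖S n x - S n x'‖ + ‖S n x' - S' x'‖ + ‖S' x' - S' x‖ := norm_add₃_le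
    _ < δ := by linarith

lemma cauchySeq_of_cauchySeq_on_graph [CompleteSpace E] {H : E →ₗ.[ℂ] E} (hH : IsSelfAdjoint H)
    {S : ℕ → E → E} (hS : ∀ n x y, ‖S n x - S n y‖ ≤ ‖x - y‖)
    (h : ∀ x y, (x, y) ∈ H.graph → CauchySeq fun n => S n x) (x : E) :
    CauchySeq fun n => S n x := by
  rw [Metric.cauchySeq_iff]
  intro δ hδ
  obtain ⟨x', y', hG, hx'⟩ := exists_graph_near hH x (show 0 < δ / 3 by positivity)
  obtain ⟨N, hN⟩ := Metric.cauchySeq_iff.mp (h x' y' hG) (δ / 3) (by positivity)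
  refine ⟨N, fun n hn m hm => ?_⟩
  have h1 := hN n hn m hm
  rw [dist_eq_norm] at h1 ⊢
  have h2 := hS n x x'
  have h3 := hS m x x'
  rw [norm_sub_rev] at h3
  calc ‖S n x - S m x‖ = ‖(S n x - S n x') + (S n x' - S m x') + (S m x' - S m x)‖ := by
        congr 1; abel
    _ ≤ ‖S n x - S n x'‖ + ‖S n x' - S m x'‖ + ‖S m x' - S m x‖ := norm_add₃_le
    _ < δ := by linarith

/-- A Yosida regularization of a self-adjoint operator `H`: contractions `L n` with values in the
domain of `H` that converge strongly to the identity, commute with everything that commutes with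
`H`, and for which `K n = H (L n)` is bounded and symmetric. -/
structure IsRegularization (H : E →ₗ.[ℂ] E) (L K : ℕ → E →L[ℂ] E) : Prop where
  mem_graph : ∀ n x, (L n x, K n x) ∈ H.graph
  norm_le : ∀ n x, ‖L n x‖ ≤ ‖x‖
  tendsto : ∀ x, Tendsto (fun n => L n x) atTop (𝓝 x)
  apply_graph : ∀ n {x y}, (x, y) ∈ H.graph → K n x = L n y
  symm : ∀ n x y, inner ℂ (K n x) y = inner ℂ x (K n y)
  comm : ∀ V : E →L[ℂ] E, (∀ x y, (x, y) ∈ H.graph → (V x, V y) ∈ H.graph) →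
    ∀ n x, V (L n x) = L n (V x)

/-- The regularization is `L = N² (H - i N)⁻¹ (H + i N)⁻¹ = N² (H² + N²)⁻¹` with `N = n + 1`. -/
lemma exists_isRegularization [CompleteSpace E] {H : E →ₗ.[ℂ] E} (hH : IsSelfAdjoint H) :
    ∃ L K : ℕ → E →L[ℂ] E, IsRegularization H L K := by
  let z : ℕ → ℂ := fun n => ((n + 1 : ℝ) : ℂ) * Complex.I
  have hz : ∀ n, (z n).im = n + 1 := fun n => by simp [z]
  have hz1 : ∀ n : ℕ, (0 : ℝ) < n + 1 := fun n => by positivity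
  have hconj : ∀ n, (starRingEnd ℂ) (z n) = - z n := fun n => by
    simp only [z, map_mul, Complex.conj_ofReal, Complex.conj_I, mul_neg]
  have hP : ∀ n, ∃ R, IsResolvent H (z n) R := fun n =>
    exists_isResolvent hH (by rw [hz]; exact (hz1 n).ne')
  have hQ : ∀ n, ∃ R, IsResolvent H (- z n) R := fun n =>
    exists_isResolvent hH (by rw [Complex.neg_im, hz]; exact (neg_neg_of_pos (hz1 n)).ne)
  choose P hP using hP
  choose Q hQ using hQ
  have hPn : ∀ (n : ℕ) y, (n + 1 : ℝ) * ‖P n y‖ ≤ ‖y‖ := fun n y => by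
    have := (hP n).norm_le y
    rwa [hz, abs_of_pos (hz1 n)] at this
  have hQn : ∀ (n : ℕ) y, (n + 1 : ℝ) * ‖Q n y‖ ≤ ‖y‖ := fun n y => by
    have := (hQ n).norm_le y
    rwa [Complex.neg_im, hz, abs_neg, abs_of_pos (hz1 n)] at this
  have hzn : ∀ n, ‖z n‖ = n + 1 := fun n => by
    simp only [z, norm_mul, Complex.norm_real, Complex.norm_I, mul_one, Real.norm_eq_abs,
      abs_of_pos (hz1 n)]
  have hzz : ∀ n, ‖-(z n * z n)‖ = (n + 1) * (n + 1) := fun n => by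
    rw [norm_neg, norm_mul, hzn]
  let L : ℕ → E →L[ℂ] E := fun n => (-(z n * z n)) • (P n ∘L Q n)
  let K : ℕ → E →L[ℂ] E := fun n => (-(z n * z n)) • (Q n + z n • (P n ∘L Q n))
  have hL : ∀ n x, L n x = (-(z n * z n)) • P n (Q n x) := fun n x => rfl
  have hK : ∀ n x, K n x = (-(z n * z n)) • (Q n x + z n • P n (Q n x)) := fun n x => rfl
  have hmem : ∀ n x, (L n x, K n x) ∈ H.graph := fun n x => by
    rw [hL, hK]
    exact H.graph.smul_mem _ ((hP n).mem_graph (Q n x))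
  have hnorm : ∀ n x, ‖L n x‖ ≤ ‖x‖ := fun n x => by
    rw [hL, norm_smul, hzz, mul_assoc]
    calc (n + 1 : ℝ) * ((n + 1) * ‖P n (Q n x)‖) ≤ (n + 1) * ‖Q n x‖ :=
          mul_le_mul_of_nonneg_left (hPn n _) (hz1 n).le
      _ ≤ ‖x‖ := hQn n x
  have hcomm : ∀ V : E →L[ℂ] E, (∀ x y, (x, y) ∈ H.graph → (V x, V y) ∈ H.graph) →
      ∀ n x, V (L n x) = L n (V x) := fun V hV n x => by
    rw [hL, hL, map_smul, (hP n).apply_comm hV, (hQ n).apply_comm hV]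
  refine ⟨L, K, hmem, hnorm, ?_, ?_, ?_, hcomm⟩
  · refine tendsto_of_tendsto_on_graph hH (S' := fun x => x)
      (fun n x y => by rw [← map_sub]; exact hnorm n _) (fun x y => le_rfl) ?_
    intro x y hxy
    have key : ∀ n, L n x - x = z n • P n (Q n y) - P n y := fun n => by
      have h1 := (hP n).apply_sub hxy
      have h2 := (hQ n).apply_sub hxy
      rw [map_sub, map_smul] at h1 h2
      have h3 : z n • Q n x = x - Q n y := by
        rw [eq_sub_iff_add_eq', ← sub_neg_eq_add, ← neg_smul]; exact h2
      have h4 : z n • P n x = P n y - x := by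
        rw [eq_sub_iff_add_eq, ← eq_sub_iff_add_eq', h1]
      calc L n x - x = -(z n • P n (z n • Q n x)) - x := by rw [hL, map_smul]; module
        _ = -(z n • P n x) + z n • P n (Q n y) - x := by rw [h3, map_sub]; module
        _ = _ := by rw [h4]; abel
    have hb : ∀ n, ‖L n x - x‖ ≤ 2 * ‖y‖ * (1 / ((n : ℝ) + 1)) := fun n => by
      rw [key]
      have h1 : ‖P n y‖ ≤ ‖y‖ / (n + 1) := by
        rw [le_div_iff₀ (hz1 n), mul_comm]; exact hPn n y
      have h2 : ‖Q n y‖ ≤ ‖y‖ / (n + 1) := by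
        rw [le_div_iff₀ (hz1 n), mul_comm]; exact hQn n y
      calc ‖z n • P n (Q n y) - P n y‖ ≤ ‖z n • P n (Q n y)‖ + ‖P n y‖ := norm_sub_le _ _
        _ ≤ ‖Q n y‖ + ‖P n y‖ := by
            gcongr; rw [norm_smul, hzn]; exact hPn n _
        _ ≤ ‖y‖ / (n + 1) + ‖y‖ / (n + 1) := add_le_add h2 h1
        _ = _ := by ring
    rw [tendsto_iff_norm_sub_tendsto_zero]
    refine squeeze_zero (fun n => norm_nonneg _) hb ?_
    simpa using (tendsto_one_div_add_atTop_nhds_zero_nat (𝕜 := ℝ)).const_mul (2 * ‖y‖)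
  · intro n x y hxy
    have hpres : ∀ x y, (x, y) ∈ H.graph → (L n x, L n y) ∈ H.graph := fun x y h => by
      rw [hL, hL]
      exact H.graph.smul_mem _ ((hP n).map_graph ((hQ n).map_graph h))
    exact mem_graph_unique (hmem n x) (hpres x y hxy)
  · intro n x y
    have hPQ : ∀ x y, inner ℂ (P n x) y = inner ℂ x (Q n y) := fun x y =>
      (hP n).inner_left hH (by rw [hconj]; exact hQ n) x y
    have hQP : ∀ x y, inner ℂ (Q n x) y = inner ℂ x (P n y) := fun x y =>
      (hQ n).inner_left hH (by rw [map_neg, hconj, neg_neg]; exact hP n) x y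
    -- `P* = Q`, and the resolvent identity turns `P` into `Q + 2 z P Q`.
    have hid := (hP n).sub_eq (hQ n) y
    rw [hK, hK, inner_smul_left, inner_smul_right, inner_add_left, inner_add_right,
      inner_smul_left, inner_smul_right, hPQ, hQP, hQP, map_neg, map_mul, hconj]
    have : inner ℂ x (P n y) = inner ℂ x (Q n y) + 2 * z n * inner ℂ x (P n (Q n y)) := by
      rw [sub_neg_eq_add, ← two_mul] at hid
      rw [← inner_smul_right, ← inner_add_right, ← sub_eq_iff_eq_add'.mp hid]
    rw [this]; ring

end Yosida

/-! ### Stone's theorem -/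

section Stone

variable {E : Type*} [NormedAddCommGroup E] [InnerProductSpace ℂ E]

lemma inner_map_map_of_norm_map {V : E →L[ℂ] E} (hV : ∀ x, ‖V x‖ = ‖x‖) (x y : E) :
    inner ℂ (V x) (V y) = inner ℂ x y :=
  LinearIsometry.inner_map_map (⟨V.toLinearMap, hV⟩ : E →ₗᵢ[ℂ] E) x y

variable [CompleteSpace E]

/-- The unitary group `e^{itK}` of a bounded symmetric operator `K`. -/
noncomputable def expGroup (K : E →L[ℂ] E) (t : ℝ) : E →L[ℂ] E :=
  NormedSpace.exp (t • (Complex.I • K))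

lemma expGroup_zero (K : E →L[ℂ] E) : expGroup K 0 = 1 := by
  rw [expGroup, zero_smul, NormedSpace.exp_zero]

lemma expGroup_add (K : E →L[ℂ] E) (s t : ℝ) :
    expGroup K (s + t) = expGroup K s * expGroup K t := by
  let : NormedAlgebra ℚ (E →L[ℂ] E) := NormedAlgebra.restrictScalars ℚ ℂ (E →L[ℂ] E)
  rw [expGroup, add_smul]
  exact NormedSpace.exp_add_of_commute (((Commute.refl _).smul_left s).smul_right t)

lemma hasDerivAt_expGroup (K : E →L[ℂ] E) (x : E) (t : ℝ) :
    HasDerivAt (fun s => expGroup K s x) (expGroup K t (Complex.I • K x)) t :=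
  ((ContinuousLinearMap.apply ℂ E x).restrictScalars ℝ).hasFDerivAt.comp_hasDerivAt t
    (hasDerivAt_exp_smul_const (𝕂 := ℝ) (Complex.I • K) t)

lemma norm_expGroup_apply {K : E →L[ℂ] E} (hK : ∀ x y, inner ℂ (K x) y = inner ℂ x (K y))
    (t : ℝ) (x : E) : ‖expGroup K t x‖ = ‖x‖ := by
  have hsa : IsSelfAdjoint K := ContinuousLinearMap.isSelfAdjoint_iff_isSymmetric.mpr hK
  have h : expGroup K t =
      (selfAdjoint.expUnitary (t • ⟨K, hsa⟩ : selfAdjoint (E →L[ℂ] E)) : E →L[ℂ] E) := by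
    rw [selfAdjoint.expUnitary_coe, expGroup, smul_comm]
    rfl
  rw [h]
  exact ContinuousLinearMap.norm_map_of_mem_unitary (Subtype.property _) x

lemma norm_expGroup_sub_self_le {K : E →L[ℂ] E} (hK : ∀ x y, inner ℂ (K x) y = inner ℂ x (K y))
    (t : ℝ) (x : E) : ‖expGroup K t x - x‖ ≤ ‖K x‖ * |t| := by
  have := convex_univ.norm_image_sub_le_of_norm_hasDerivWithin_le (𝕜 := ℝ)
    (f := fun s => expGroup K s x) (f' := fun s => expGroup K s (Complex.I • K x)) (C := ‖K x‖)
    (x := 0) (y := t) (fun s _ => (hasDerivAt_expGroup K x s).hasDerivWithinAt)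
    (fun s _ => by rw [norm_expGroup_apply hK, norm_smul, Complex.norm_I, one_mul])
    (mem_univ _) (mem_univ _)
  simpa [expGroup_zero] using this

lemma norm_expGroup_sub_expGroup_le {K K' : E →L[ℂ] E}
    (hK : ∀ x y, inner ℂ (K x) y = inner ℂ x (K y))
    (hK' : ∀ x y, inner ℂ (K' x) y = inner ℂ x (K' y)) (hc : Commute K K') (t : ℝ) (x : E) :
    ‖expGroup K t x - expGroup K' t x‖ ≤ ‖K x - K' x‖ * |t| := by
  have h1 : expGroup K t = expGroup K' t * expGroup (K - K') t := by
    let : NormedAlgebra ℚ (E →L[ℂ] E) := NormedAlgebra.restrictScalars ℚ ℂ (E →L[ℂ] E)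
    rw [expGroup, expGroup, expGroup, ← NormedSpace.exp_add_of_commute, ← smul_add, ← smul_add,
      add_sub_cancel]
    exact (((hc.symm.sub_right (Commute.refl _)).smul_left _).smul_right _).smul_left _
      |>.smul_right _
  have h2 := norm_expGroup_sub_self_le (K := K - K') (fun x y => by
    simp only [sub_apply, inner_sub_left, inner_sub_right, hK, hK']) t x
  rw [h1, mul_apply_eq_comp, ← map_sub, norm_expGroup_apply hK']
  exact h2

/-- Stone's theorem: a self-adjoint operator generates a strongly continuous unitary group, the
strong limit of the groups of its Yosida regularizations. -/
theorem exists_isUnitaryGroupOf {H : E →ₗ.[ℂ] E} (hH : IsSelfAdjoint H) :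
    ∃ U : ℝ → E →L[ℂ] E, IsUnitaryGroupOf H U := by
  obtain ⟨L, K, hR⟩ := exists_isRegularization hH
  have hcomm : ∀ n m, Commute (K n) (K m) := fun n m => by
    ext x
    have hpres : ∀ x y, (x, y) ∈ H.graph → (K m x, K m y) ∈ H.graph := fun x y h => by
      rw [hR.apply_graph m h]; exact hR.mem_graph m y
    have h1 := hpres _ _ (hR.mem_graph n x)
    rw [hR.comm (K m) hpres] at h1
    exact mem_graph_unique (hR.mem_graph n (K m x)) h1
  have hKt : ∀ {x y}, (x, y) ∈ H.graph → Tendsto (fun n => K n x) atTop (𝓝 y) := fun h => by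
    simp_rw [hR.apply_graph _ h]; exact hR.tendsto _
  have hiso : ∀ n (t : ℝ) x y, ‖expGroup (K n) t x - expGroup (K n) t y‖ = ‖x - y‖ :=
    fun n t x y => by rw [← map_sub, norm_expGroup_apply (hR.symm n)]
  have hcauchy : ∀ (t : ℝ) x, CauchySeq fun n => expGroup (K n) t x := fun t => by
    refine cauchySeq_of_cauchySeq_on_graph hH (fun n x y => (hiso n t x y).le) ?_
    intro x y hxy
    have hc := (hKt hxy).cauchySeq
    rw [Metric.cauchySeq_iff] at hc ⊢
    intro δ hδ
    obtain ⟨N, hN⟩ := hc (δ / (|t| + 1)) (by positivity)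
    refine ⟨N, fun n hn m hm => ?_⟩
    have h1 := hN n hn m hm
    rw [dist_eq_norm, lt_div_iff₀ (by positivity)] at h1
    rw [dist_eq_norm]
    calc _ ≤ ‖K n x - K m x‖ * |t| :=
          norm_expGroup_sub_expGroup_le (hR.symm n) (hR.symm m) (hcomm n m) t x
      _ ≤ ‖K n x - K m x‖ * (|t| + 1) := by gcongr; linarith
      _ < δ := h1
  choose W hW using fun (t : ℝ) x => cauchySeq_tendsto_of_complete (hcauchy t x)
  have hWn : ∀ t x, ‖W t x‖ = ‖x‖ := fun t x =>
    tendsto_nhds_unique (hW t x).norm (by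
      simp_rw [norm_expGroup_apply (hR.symm _)]; exact tendsto_const_nhds)
  let U : ℝ → E →L[ℂ] E := fun t => LinearMap.mkContinuous
    { toFun := W t
      map_add' := fun x y => tendsto_nhds_unique (hW t (x + y)) (by
        simp_rw [map_add]; exact (hW t x).add (hW t y))
      map_smul' := fun c x => tendsto_nhds_unique (hW t (c • x)) (by
        simp_rw [map_smul]; exact (hW t x).const_smul c) } 1
    (fun x => by rw [one_mul]; exact (hWn t x).le)
  have hU : ∀ t x, Tendsto (fun n => expGroup (K n) t x) atTop (𝓝 (U t x)) := hW
  have hUn : ∀ t x, ‖U t x‖ = ‖x‖ := hWn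
  have hU0 : U 0 = 1 := by
    ext x
    refine tendsto_nhds_unique (hU 0 x) ?_
    simp_rw [expGroup_zero]; exact tendsto_const_nhds
  have hUadd : ∀ s t, U (s + t) = U s * U t := fun s t => by
    ext x
    refine tendsto_nhds_unique (hU (s + t) x) ?_
    simp_rw [expGroup_add, mul_apply_eq_comp]
    have h1 : Tendsto (fun n => expGroup (K n) s (expGroup (K n) t x)
        - expGroup (K n) s (U t x)) atTop (𝓝 0) := by
      rw [tendsto_zero_iff_norm_tendsto_zero]
      simp_rw [hiso]
      exact tendsto_iff_norm_sub_tendsto_zero.mp (hU t x)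
    simpa using h1.add (hU s (U t x))
  have hlip : ∀ {x y}, (x, y) ∈ H.graph → ∀ t, ‖U t x - x‖ ≤ ‖y‖ * |t| := fun {x y} hxy t => by
    refine le_of_tendsto_of_tendsto ((hU t x).sub_const x).norm
      ((hKt hxy).norm.mul_const |t|) (Eventually.of_forall fun n => ?_)
    exact norm_expGroup_sub_self_le (hR.symm n) t x
  have hcont0 : ∀ x, Tendsto (fun t => U t x) (𝓝 0) (𝓝 x) := fun x => by
    rw [Metric.tendsto_nhds]
    intro δ hδ
    obtain ⟨x', y', hG, hx'⟩ := exists_graph_near hH x (show 0 < δ / 3 by positivity)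
    have h1 : Tendsto (fun t : ℝ => ‖y'‖ * |t|) (𝓝 0) (𝓝 0) := by
      have : Continuous fun t : ℝ => ‖y'‖ * |t| := by fun_prop
      simpa using this.tendsto 0
    filter_upwards [h1.eventually (gt_mem_nhds (show 0 < δ / 3 by positivity))] with t ht
    rw [dist_eq_norm]
    have h2 := hlip hG t
    have h3 : ‖U t x - U t x'‖ = ‖x - x'‖ := by rw [← map_sub, hUn]
    have h4 := norm_sub_rev x x'
    calc ‖U t x - x‖ = ‖(U t x - U t x') + (U t x' - x') + (x' - x)‖ := by congr 1; abel
      _ ≤ ‖U t x - U t x'‖ + ‖U t x' - x'‖ + ‖x' - x‖ := norm_add₃_le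
      _ < δ := by linarith
  have hcont : ∀ x, Continuous fun t => U t x := fun x => by
    rw [continuous_iff_continuousAt]
    intro s
    have h1 : Tendsto (fun t => U (t - s) x) (𝓝 s) (𝓝 x) :=
      (hcont0 x).comp (by
        have : Continuous fun t : ℝ => t - s := by fun_prop
        simpa using this.tendsto s)
    have h2 := ((U s).continuous.tendsto x).comp h1
    refine h2.congr fun t => ?_
    simp only [Function.comp_apply]
    rw [← mul_apply_eq_comp, ← hUadd, add_sub_cancel]
  have hgen : ∀ {x y}, (x, y) ∈ H.graph → HasDerivAt (fun t => U t x) (Complex.I • y) 0 := by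
    intro x y hxy
    -- Pass to the limit in `e^{itK} x = x + ∫₀ᵗ e^{isK} (i K x) ds`.
    have hint : ∀ t : ℝ, U t x = x + ∫ s in (0 : ℝ)..t, U s (Complex.I • y) := fun t => by
      have hn : ∀ n, expGroup (K n) t x
          = x + ∫ s in (0 : ℝ)..t, expGroup (K n) s (Complex.I • K n x) := fun n => by
        have hc : Continuous fun s => expGroup (K n) s (Complex.I • K n x) :=
          continuous_iff_continuousAt.mpr fun s =>
            (hasDerivAt_expGroup (K n) (Complex.I • K n x) s).continuousAt
        have := intervalIntegral.integral_eq_sub_of_hasDerivAt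
          (fun s _ => hasDerivAt_expGroup (K n) x s) (hc.intervalIntegrable 0 t)
        rw [this, expGroup_zero]; simp
      refine tendsto_nhds_unique (hU t x) ?_
      simp_rw [hn]
      refine tendsto_const_nhds.add ?_
      refine intervalIntegral.tendsto_integral_filter_of_dominated_convergence (fun _ => ‖y‖)
        (Eventually.of_forall fun n => ?_) (Eventually.of_forall fun n => ?_)
        intervalIntegrable_const (Eventually.of_forall fun s _ => ?_)
      · exact (continuous_iff_continuousAt.mpr fun s =>
          (hasDerivAt_expGroup (K n) (Complex.I • K n x) s).continuousAt).aestronglyMeasurable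
      · refine Eventually.of_forall fun s _ => ?_
        rw [norm_expGroup_apply (hR.symm n), norm_smul, Complex.norm_I, one_mul,
          hR.apply_graph n hxy]
        exact hR.norm_le n y
      · have h1 : Tendsto (fun n => expGroup (K n) s (Complex.I • K n x)
            - expGroup (K n) s (Complex.I • y)) atTop (𝓝 0) := by
          rw [tendsto_zero_iff_norm_tendsto_zero]
          simp_rw [hiso, ← smul_sub, norm_smul, Complex.norm_I, one_mul]
          exact tendsto_iff_norm_sub_tendsto_zero.mp (hKt hxy)
        simpa using h1.add (hU s (Complex.I • y))
    have h1 := intervalIntegral.integral_hasDerivAt_right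
      ((hcont (Complex.I • y)).intervalIntegrable 0 0)
      ((hcont (Complex.I • y)).stronglyMeasurableAtFilter _ _)
      (hcont (Complex.I • y)).continuousAt
    rw [hU0] at h1
    have h2 := h1.const_add x
    exact h2.congr_of_eventuallyEq (Eventually.of_forall hint)
  refine ⟨U, hU0, hUadd, hUn, hcont, fun x y => ⟨fun h => ?_, hgen⟩⟩
  refine mem_graph_of_inner_eq hH fun x' y' hG => ?_
  have h1 := (hgen hG).inner ℂ h
  have h2 : (fun t => inner ℂ (U t x') (U t x)) = fun _ : ℝ => (inner ℂ x' x : ℂ) := by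
    ext t
    exact inner_map_map_of_norm_map (hUn t) x' x
  rw [h2] at h1
  have h3 := h1.unique (hasDerivAt_const (0 : ℝ) (inner ℂ x' x : ℂ))
  rw [hU0, inner_smul_left, inner_smul_right, Complex.conj_I] at h3
  simp only [one_apply_eq_self] at h3
  have h4 : Complex.I * (inner ℂ x' y - inner ℂ y' x) = 0 := by linear_combination h3
  rcases mul_eq_zero.mp h4 with h5 | h5
  · exact absurd h5 Complex.I_ne_zero
  · exact (sub_eq_zero.mp h5).symm

lemma isUnitaryGroupOf_expI {H : E →ₗ.[ℂ] E} (hH : IsSelfAdjoint H) :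
    IsUnitaryGroupOf H (expI H) := by
  have h := exists_isUnitaryGroupOf hH
  rw [expI, dif_pos h]
  exact h.choose_spec

end Stone

/-! ### Unitary groups and relatively bounded operators -/

section Group

variable {E : Type*} [NormedAddCommGroup E] [InnerProductSpace ℂ E]
  {H : E →ₗ.[ℂ] E} {U : ℝ → E →L[ℂ] E}

namespace IsUnitaryGroupOf

lemma apply_apply (hU : IsUnitaryGroupOf H U) (s t : ℝ) (x : E) : U s (U t x) = U (s + t) x := by
  rw [hU.map_add, mul_apply_eq_comp]

lemma apply_neg (hU : IsUnitaryGroupOf H U) (t : ℝ) (x : E) : U t (U (-t) x) = x := by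
  rw [hU.apply_apply, add_neg_cancel, hU.map_zero, one_apply_eq_self]

lemma inner_map (hU : IsUnitaryGroupOf H U) (t : ℝ) (x y : E) :
    inner ℂ (U t x) (U t y) = inner ℂ x y := inner_map_map_of_norm_map (hU.norm_map t) x y

lemma inner_map_left (hU : IsUnitaryGroupOf H U) (t : ℝ) (x y : E) :
    inner ℂ (U t x) y = inner ℂ x (U (-t) y) := by
  rw [← hU.inner_map t x, hU.apply_neg]

lemma inner_map_right (hU : IsUnitaryGroupOf H U) (t : ℝ) (x y : E) :
    inner ℂ x (U t y) = inner ℂ (U (-t) x) y := by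
  rw [← hU.inner_map t _ y, hU.apply_neg]

lemma continuous_uncurry (hU : IsUnitaryGroupOf H U) :
    Continuous fun p : ℝ × E => U p.1 p.2 := by
  rw [continuous_iff_continuousAt]
  rintro ⟨s, x⟩
  rw [ContinuousAt, tendsto_iff_norm_sub_tendsto_zero]
  have h1 : Continuous fun p : ℝ × E => ‖p.2 - x‖ + ‖U p.1 x - U s x‖ :=
    (continuous_snd.sub continuous_const).norm.add
      (((hU.continuous x).comp continuous_fst).sub continuous_const).norm
  have h2 := h1.tendsto (s, x)
  simp only [sub_self, norm_zero, add_zero] at h2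
  refine squeeze_zero (fun p => norm_nonneg _) (fun p => ?_) h2
  calc ‖U p.1 p.2 - U s x‖ = ‖U p.1 (p.2 - x) + (U p.1 x - U s x)‖ := by
        rw [map_sub]; congr 1; abel
    _ ≤ ‖U p.1 (p.2 - x)‖ + ‖U p.1 x - U s x‖ := norm_add_le _ _
    _ = _ := by rw [hU.norm_map]

lemma continuous_neg_uncurry (hU : IsUnitaryGroupOf H U) :
    Continuous fun p : ℝ × E => U (-p.1) p.2 :=
  hU.continuous_uncurry.comp ((continuous_fst.neg).prodMk continuous_snd)

lemma continuous_neg (hU : IsUnitaryGroupOf H U) (x : E) : Continuous fun t => U (-t) x :=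
  (hU.continuous x).comp (by fun_prop)

lemma hasDerivAt (hU : IsUnitaryGroupOf H U) {x y : E} (h : (x, y) ∈ H.graph) (t : ℝ) :
    HasDerivAt (fun s => U s x) (U t (Complex.I • y)) t := by
  have h1 := (hU.generator x y).mpr h
  have h2 := ((U t).restrictScalars ℝ).hasFDerivAt.comp_hasDerivAt 0 h1
  rw [← sub_self t] at h2
  have h3 := h2.comp_sub_const t t
  refine h3.congr_of_eventuallyEq (Eventually.of_forall fun s => ?_)
  simp only [Function.comp_apply, ContinuousLinearMap.coe_restrictScalars']
  rw [hU.apply_apply, add_sub_cancel]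

lemma hasDerivAt_neg (hU : IsUnitaryGroupOf H U) {x y : E} (h : (x, y) ∈ H.graph) (t : ℝ) :
    HasDerivAt (fun s => U (-s) x) (-(U (-t) (Complex.I • y))) t := by
  have := (hU.hasDerivAt h (-t)).scomp t (_root_.hasDerivAt_neg t)
  simpa [Function.comp_def] using this

/-- The group commutes with its generator. -/
lemma map_graph (hU : IsUnitaryGroupOf H U) (t : ℝ) {x y : E} (h : (x, y) ∈ H.graph) :
    (U t x, U t y) ∈ H.graph := by
  rw [← hU.generator]
  have h2 := ((U t).restrictScalars ℝ).hasFDerivAt.comp_hasDerivAt 0 ((hU.generator x y).mpr h)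
  rw [ContinuousLinearMap.coe_restrictScalars', map_smul] at h2
  refine h2.congr_of_eventuallyEq (Eventually.of_forall fun s => ?_)
  simp only [Function.comp_apply]
  rw [hU.apply_apply, hU.apply_apply, add_comm]

end IsUnitaryGroupOf

end Group

section RelBound

variable {E : Type*} [NormedAddCommGroup E] [InnerProductSpace ℂ E]

lemma applyExt_of_mem {A : E →ₗ.[ℂ] E} {x : E} (h : x ∈ A.domain) :
    applyExt A x = A ⟨x, h⟩ := dif_pos h

lemma mem_graph_applyExt {A : E →ₗ.[ℂ] E} {x : E} (h : x ∈ A.domain) :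
    (x, applyExt A x) ∈ A.graph := by
  rw [applyExt_of_mem h]; exact A.mem_graph ⟨x, h⟩

lemma mem_domain_of_graph {A : E →ₗ.[ℂ] E} {x y : E} (h : (x, y) ∈ A.graph) : x ∈ A.domain :=
  LinearPMap.mem_domain_of_mem_graph h

lemma applyExt_of_graph {A : E →ₗ.[ℂ] E} {x y : E} (h : (x, y) ∈ A.graph) : applyExt A x = y :=
  mem_graph_unique (mem_graph_applyExt (mem_domain_of_graph h)) h

lemma applyExt_add {A : E →ₗ.[ℂ] E} {x y : E} (hx : x ∈ A.domain) (hy : y ∈ A.domain) :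
    applyExt A (x + y) = applyExt A x + applyExt A y :=
  applyExt_of_graph (A.graph.add_mem (mem_graph_applyExt hx) (mem_graph_applyExt hy))

lemma applyExt_smul {A : E →ₗ.[ℂ] E} (c : ℂ) {x : E} (hx : x ∈ A.domain) :
    applyExt A (c • x) = c • applyExt A x :=
  applyExt_of_graph (A.graph.smul_mem c (mem_graph_applyExt hx))

/-- The resolvent bound on `A` relative to `H`, expressed on the graph of `H`. -/
structure RelBound (H A : E →ₗ.[ℂ] E) (ε c : ℝ) : Prop where
  eps_pos : 0 < ε
  c_nonneg : 0 ≤ c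
  c_lt_one : c < 1
  mem : ∀ {x y}, (x, y) ∈ H.graph → x ∈ A.domain
  bound : ∀ (l : ℝ) {x y}, (x, y) ∈ H.graph →
    ‖applyExt A x‖ ≤ c * ‖y - (l + ε * Complex.I) • x‖

lemma AssumptionA.exists_relBound [CompleteSpace E] {H₀ A : E →ₗ.[ℂ] E} (hA : AssumptionA H₀ A) :
    ∃ ε c : ℝ, RelBound H₀ A ε c := by
  obtain ⟨ε, hε, c, hc, hb⟩ := hA.resolvent_bound
  refine ⟨ε, max c 0, hε, le_max_right _ _, max_lt hc one_pos,
    fun h => hA.domain_le (mem_domain_of_graph h), fun l x y h => ?_⟩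
  set z : ℂ := l + ε * Complex.I with hz
  have hzim : z.im = ε := by simp [hz]
  have hx := mem_domain_of_graph h
  have hyx : H₀ ⟨x, hx⟩ = y := mem_graph_unique (H₀.mem_graph ⟨x, hx⟩) h
  have hex : ∃ x' : H₀.domain, H₀ x' - z • (x' : E) = y - z • x :=
    ⟨⟨x, hx⟩, by rw [hyx]⟩
  have hr : resolventApply H₀ z (y - z • x) = x := by
    rw [resolventApply, dif_pos hex]
    have h1 := hex.choose_spec
    set x' := hex.choose
    have h2 := im_mul_norm_le hA.selfAdjoint z (H₀.graph.sub_mem (H₀.mem_graph x') h)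
    have h3 : H₀ x' - y - z • ((x' : E) - x) = 0 := by
      rw [smul_sub, sub_sub_sub_comm, h1, sub_self]
    have h2' : |z.im| * ‖(x' : E) - x‖ ≤ ‖H₀ x' - y - z • ((x' : E) - x)‖ := h2
    rw [h3, norm_zero, hzim] at h2'
    exact sub_eq_zero.mp (norm_le_zero_iff.mp
      (nonpos_of_mul_nonpos_right h2' (abs_pos.mpr hε.ne')))
  have := (hb l (y - z • x)).2
  rw [← hz, hr] at this
  exact this.trans (by gcongr; exact le_max_left _ _)

/-- `A Q` is bounded as soon as `Q` maps boundedly into the domain of `H` with the graph norm. -/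
lemma RelBound.exists_clm {H A : E →ₗ.[ℂ] E} {ε c : ℝ} (hA : RelBound H A ε c) {Q K : E →L[ℂ] E}
    (h : ∀ x, (Q x, K x) ∈ H.graph) : ∃ S : E →L[ℂ] E, ∀ x, S x = applyExt A (Q x) := by
  have hm := fun x => hA.mem (h x)
  refine ⟨LinearMap.mkContinuous
    { toFun := fun x => applyExt A (Q x)
      map_add' := fun x y => by rw [map_add, applyExt_add (hm x) (hm y)]
      map_smul' := fun a x => by rw [map_smul, applyExt_smul a (hm x)]; rfl }
    (c * ‖K - (((0 : ℝ) : ℂ) + ε * Complex.I) • Q‖) (fun x => ?_), fun x => rfl⟩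
  rw [mul_assoc]
  exact (hA.bound 0 (h x)).trans (mul_le_mul_of_nonneg_left
    ((K - (((0 : ℝ) : ℂ) + ε * Complex.I) • Q).le_opNorm x) hA.c_nonneg)

/-- Closedness of `A` in terms of sequences. -/
lemma mem_graph_of_tendsto {A : E →ₗ.[ℂ] E} (hA : A.IsClosed) {x : ℕ → E} {x' y' : E}
    (hx : ∀ n, x n ∈ A.domain) (h : Tendsto x atTop (𝓝 x'))
    (h' : Tendsto (fun n => applyExt A (x n)) atTop (𝓝 y')) : (x', y') ∈ A.graph :=
  IsClosed.mem_of_tendsto (s := (A.graph : Set (E × E))) hA (h.prodMk_nhds h')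
    (Eventually.of_forall fun n => mem_graph_applyExt (hx n))

lemma inner_applyExt_left {A : E →ₗ.[ℂ] E}
    (hA : ∀ x y : A.domain, inner ℂ (A x) (y : E) = inner ℂ (x : E) (A y)) {x y : E}
    (hx : x ∈ A.domain) (hy : y ∈ A.domain) :
    inner ℂ (applyExt A x) y = inner ℂ x (applyExt A y) := by
  rw [applyExt_of_mem hx, applyExt_of_mem hy]
  exact hA ⟨x, hx⟩ ⟨y, hy⟩

end RelBound

/-! ### Parseval's identity for vector-valued functions -/

section Parseval

variable {E : Type*} [NormedAddCommGroup E] [InnerProductSpace ℂ E]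

lemma tsum_enorm_inner_sq {ι : Type*} (b : HilbertBasis ι ℂ E) (x : E) :
    ∑' i, ‖(inner ℂ (b i) x : ℂ)‖ₑ ^ 2 = ‖x‖ₑ ^ 2 := by
  have h := b.hasSum_inner_mul_inner x x
  have h1 : HasSum (fun i => ‖(inner ℂ (b i) x : ℂ)‖ ^ 2) (‖x‖ ^ 2) := by
    have := Complex.hasSum_re h
    convert this using 1
    · ext i
      rw [← inner_conj_symm x (b i), ← Complex.normSq_eq_conj_mul_self, Complex.ofReal_re,
        Complex.normSq_eq_norm_sq]
    · exact (inner_self_eq_norm_sq (𝕜 := ℂ) x).symm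
  rw [← ofReal_norm, ← ENNReal.ofReal_pow (norm_nonneg _), ← h1.tsum_eq,
    ENNReal.ofReal_tsum_of_nonneg (fun i => sq_nonneg _) h1.summable]
  congr 1
  ext i
  rw [ENNReal.ofReal_pow (norm_nonneg _), ofReal_norm]

variable [CompleteSpace E]

lemma exists_countable_hilbertBasis [TopologicalSpace.SeparableSpace E] :
    ∃ (w : Set E) (_ : HilbertBasis w ℂ E), w.Countable := by
  obtain ⟨w, b, hb⟩ := exists_hilbertBasis ℂ E
  refine ⟨w, b, ?_⟩
  refine Set.PairwiseDisjoint.countable_of_isOpen (s := fun x => Metric.ball x (1 / 2)) ?_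
    (fun _ _ => Metric.isOpen_ball) (fun x _ => ⟨x, Metric.mem_ball_self (by norm_num)⟩)
  intro x hx y hy hxy
  refine Metric.ball_disjoint_ball ?_
  have ho := b.orthonormal
  have hne : (⟨x, hx⟩ : w) ≠ ⟨y, hy⟩ := fun h => hxy (congrArg Subtype.val h)
  have h0 : inner ℂ x y = 0 := by
    have := ho.2 hne
    simpa [hb] using this
  have hx1 : ‖x‖ = 1 := by simpa [hb] using ho.1 ⟨x, hx⟩
  have hy1 : ‖y‖ = 1 := by simpa [hb] using ho.1 ⟨y, hy⟩
  have h2 : ‖x - y‖ * ‖x - y‖ = 2 := by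
    rw [norm_sub_mul_self (𝕜 := ℂ), h0, hx1, hy1]; simp; norm_num
  rw [dist_eq_norm]
  nlinarith [norm_nonneg (x - y)]

lemma tsum_enorm_fourierCoeffOn_sq_complex {p q : ℝ} (hpq : p < q) {f : ℝ → ℂ}
    (hf : Continuous f) :
    ∑' n, ‖fourierCoeffOn hpq f n‖ₑ ^ 2 =
      ENNReal.ofReal (q - p)⁻¹ * ∫⁻ t in Ioc p q, ‖f t‖ₑ ^ 2 := by
  have hmem : MemLp f 2 (volume.restrict (Ioc p q)) := by
    refine (memLp_two_iff_integrable_sq_norm hf.aestronglyMeasurable).mpr ?_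
    exact (hf.norm.pow 2).integrableOn_Ioc
  have hint : IntegrableOn (fun t => ‖f t‖ ^ 2) (Ioc p q) := (hf.norm.pow 2).integrableOn_Ioc
  have h1 := hasSum_sq_fourierCoeffOn hpq hmem
  calc ∑' n, ‖fourierCoeffOn hpq f n‖ₑ ^ 2
      = ∑' n, ENNReal.ofReal (‖fourierCoeffOn hpq f n‖ ^ 2) := by
        congr 1; ext n; rw [ENNReal.ofReal_pow (norm_nonneg _), ofReal_norm]
    _ = ENNReal.ofReal ((q - p)⁻¹ • ∫ x in p..q, ‖f x‖ ^ 2) := by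
        rw [← h1.tsum_eq, ENNReal.ofReal_tsum_of_nonneg (fun i => sq_nonneg _) h1.summable]
    _ = _ := by
        rw [smul_eq_mul, ENNReal.ofReal_mul (inv_nonneg.mpr (sub_pos.mpr hpq).le),
          intervalIntegral.integral_of_le hpq.le, ofReal_integral_eq_lintegral_ofReal
            hint (Eventually.of_forall fun _ => sq_nonneg _)]
        congr 2; ext t; rw [ENNReal.ofReal_pow (norm_nonneg _), ofReal_norm]

lemma clm_fourierCoeffOn {F : Type*} [NormedAddCommGroup F] [NormedSpace ℂ F] [CompleteSpace F]
    {p q : ℝ} (hpq : p < q) (S : E →L[ℂ] F) {f : ℝ → E} (hf : Continuous f) (n : ℤ) :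
    S (fourierCoeffOn hpq f n) = fourierCoeffOn hpq (fun t => S (f t)) n := by
  have hc : Continuous fun t : ℝ => fourier (-n) (t : AddCircle (q - p)) • f t :=
    ((map_continuous (fourier (-n))).comp (AddCircle.continuous_mk' _)).smul hf
  rw [fourierCoeffOn_eq_integral, fourierCoeffOn_eq_integral]
  rw [← Complex.coe_smul, ← Complex.coe_smul, map_smul,
    ← ContinuousLinearMap.intervalIntegral_comp_comm S (hc.intervalIntegrable _ _)]
  simp_rw [map_smul]

/-- Parseval's identity, reduced to the scalar one by expanding in a countable Hilbert basis. -/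
lemma tsum_enorm_fourierCoeffOn_sq [TopologicalSpace.SeparableSpace E] {p q : ℝ} (hpq : p < q)
    {f : ℝ → E} (hf : Continuous f) :
    ∑' n, ‖fourierCoeffOn hpq f n‖ₑ ^ 2 =
      ENNReal.ofReal (q - p)⁻¹ * ∫⁻ t in Ioc p q, ‖f t‖ₑ ^ 2 := by
  obtain ⟨w, b, hw⟩ := exists_countable_hilbertBasis (E := E)
  have : Countable w := hw.to_subtype
  have hcont : ∀ i, Continuous fun t => (inner ℂ (b i) (f t) : ℂ) := fun i =>
    continuous_const.inner hf
  calc ∑' n, ‖fourierCoeffOn hpq f n‖ₑ ^ 2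
      = ∑' n, ∑' i, ‖fourierCoeffOn hpq (fun t => (inner ℂ (b i) (f t) : ℂ)) n‖ₑ ^ 2 := by
        congr 1; ext n
        rw [← tsum_enorm_inner_sq b]
        congr 1; ext i
        rw [← innerSL_apply_apply ℂ, clm_fourierCoeffOn hpq _ hf]
        rfl
    _ = ∑' i, ENNReal.ofReal (q - p)⁻¹ * ∫⁻ t in Ioc p q, ‖(inner ℂ (b i) (f t) : ℂ)‖ₑ ^ 2 := by
        rw [ENNReal.tsum_comm]
        congr 1; ext i
        exact tsum_enorm_fourierCoeffOn_sq_complex hpq (hcont i)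
    _ = _ := by
        rw [ENNReal.tsum_mul_left, ← lintegral_tsum fun i =>
          ((hcont i).measurable.enorm.pow_const 2).aemeasurable]
        simp_rw [tsum_enorm_inner_sq b]

/-- Integration by parts for the Fourier coefficients of a function vanishing at the end points. -/
lemma fourierCoeffOn_deriv {p q : ℝ} (hpq : p < q) {f f' : ℝ → E}
    (hf : ∀ t, HasDerivAt f (f' t) t) (hf' : Continuous f') (hp : f p = 0) (hq : f q = 0)
    (n : ℤ) : fourierCoeffOn hpq (fun t => Complex.I • f' t) n =
      ((-(2 * Real.pi * n / (q - p)) : ℝ) : ℂ) • fourierCoeffOn hpq f n := by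
  have hfc : Continuous f := continuous_iff_continuousAt.mpr fun t => (hf t).continuousAt
  set e : ℝ → ℂ := fun t => fourier (-n) (t : AddCircle (q - p)) with he
  have hec : Continuous e := (map_continuous (fourier (-n))).comp (AddCircle.continuous_mk' _)
  set k : ℂ := -2 * Real.pi * Complex.I * n / ((q - p : ℝ) : ℂ) with hk
  have hed : ∀ t, HasDerivAt e (k * e t) t := fun t => by
    have := hasDerivAt_fourier_neg (q - p) n t
    simpa [he, hk] using this
  have hprod : ∀ t, HasDerivAt (fun t => e t • f t) (e t • f' t + (k * e t) • f t) t :=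
    fun t => (hed t).smul (hf t)
  have hc1 : Continuous fun t => e t • f' t := hec.smul hf'
  have hc2 : Continuous fun t => (k * e t) • f t := (continuous_const.mul hec).smul hfc
  have hint := intervalIntegral.integral_eq_sub_of_hasDerivAt (fun t _ => hprod t)
    ((hc1.add hc2).intervalIntegrable p q)
  rw [hp, hq, smul_zero, smul_zero, sub_zero, intervalIntegral.integral_add
    (hc1.intervalIntegrable p q) (hc2.intervalIntegrable p q)] at hint
  simp_rw [mul_smul, intervalIntegral.integral_smul] at hint
  rw [fourierCoeffOn_eq_integral, fourierCoeffOn_eq_integral]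
  change (1 / (q - p)) • ∫ t in p..q, e t • (Complex.I • f' t) =
    _ • ((1 / (q - p)) • ∫ t in p..q, e t • f t)
  simp_rw [smul_comm (e _) Complex.I, intervalIntegral.integral_smul]
  rw [eq_neg_of_add_eq_zero_left hint, smul_comm _ (1 / (q - p)), smul_neg, ← neg_smul, smul_smul]
  congr 2
  rw [hk]
  push_cast
  linear_combination (2 * Real.pi * n / (q - p) : ℂ) * Complex.I_mul_I

end Parseval

/-! ### Local smoothing -/

section Smoothing

variable {E : Type*} [NormedAddCommGroup E] [InnerProductSpace ℂ E] [CompleteSpace E]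

/-- Local smoothing: a uniform resolvent bound on `A` makes `t ↦ A e^{-itH} x` locally square
integrable with a bound in terms of `‖x‖` alone. The function `F(t) = (t - p)(q - t) e^{-itH} x`
vanishes at `p` and `q`, and `(i ∂ₜ - H + iε) F` contains no `H`; the resolvent bound applies to
each Fourier coefficient of `F` on `[p, q]`, and Parseval's identity sums up. -/
theorem exists_smoothing [TopologicalSpace.SeparableSpace E] {H A : E →ₗ.[ℂ] E} {ε c : ℝ}
    (hH : IsSelfAdjoint H) (hA : RelBound H A ε c) {U : ℝ → E →L[ℂ] E}
    (hU : IsUnitaryGroupOf H U) (ℓ : ℝ) (hℓ : 0 ≤ ℓ) :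
    ∃ κ : ℝ, 0 ≤ κ ∧ ∀ a b : ℝ, b ≤ a + ℓ → ∀ x y : E, (x, y) ∈ H.graph →
      ∫⁻ t in Ioc a b, ‖applyExt A (U (-t) x)‖ₑ ^ 2 ≤ ENNReal.ofReal κ * ‖x‖ₑ ^ 2 := by
  have hε := hA.eps_pos
  set D : ℝ := ℓ + 2 with hD
  have hD0 : 0 < D := by positivity
  refine ⟨c ^ 2 * ((D + ε * D ^ 2) ^ 2 * D), by positivity, fun a b hab x y hxy => ?_⟩
  set p : ℝ := a - 1 with hp
  set q : ℝ := p + D with hq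
  have hpq : p < q := by linarith
  obtain ⟨R, hR⟩ := exists_isResolvent hH (z := ((0 : ℝ) : ℂ) + ε * Complex.I)
    (by simpa using hε.ne')
  obtain ⟨S, hS⟩ := hA.exists_clm (Q := R)
    (K := 1 + (((0 : ℝ) : ℂ) + ε * Complex.I) • R) hR.mem_graph
  set z : ℂ := ((0 : ℝ) : ℂ) + ε * Complex.I with hz
  have hzε : z = ε * Complex.I := by simp [hz]
  set χ : ℝ → ℝ := fun t => (t - p) * (q - t) with hχ
  set χ' : ℝ → ℝ := fun t => 1 * (q - t) + (t - p) * (-1) with hχ'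
  have hχd : ∀ t, HasDerivAt χ (χ' t) t := fun t =>
    ((hasDerivAt_id t).sub_const p).mul ((hasDerivAt_id t).const_sub q)
  have hχc : Continuous χ := by fun_prop
  have hχ'c : Continuous χ' := by fun_prop
  have hcoe : Continuous fun r : ℝ => (r : ℂ) := Complex.continuous_ofReal
  set F : ℝ → E := fun t => (χ t : ℂ) • U (-t) x with hF
  set F' : ℝ → E := fun t => (χ t : ℂ) • (-(U (-t) (Complex.I • y))) + (χ' t : ℂ) • U (-t) x
    with hF'
  set Y : ℝ → E := fun t => (χ t : ℂ) • U (-t) (y - z • x) with hY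
  set g : ℝ → E := fun t => (Complex.I * (χ' t + ε * χ t)) • U (-t) x with hg
  have hFd : ∀ t, HasDerivAt F (F' t) t := fun t =>
    ((hχd t).ofReal_comp).smul (hU.hasDerivAt_neg hxy t)
  have hFc : Continuous F := (hcoe.comp hχc).smul (hU.continuous_neg x)
  have hF'c : Continuous F' := ((hcoe.comp hχc).smul (hU.continuous_neg _).neg).add
    ((hcoe.comp hχ'c).smul (hU.continuous_neg x))
  have hYc : Continuous Y := (hcoe.comp hχc).smul (hU.continuous_neg _)
  have hgc : Continuous g := (continuous_const.mul ((hcoe.comp hχ'c).add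
    (continuous_const.mul (hcoe.comp hχc)))).smul (hU.continuous_neg x)
  have hYg : ∀ t, Y t = Complex.I • F' t - g t := fun t => by
    simp only [hY, hF', hg, hzε, map_sub, map_smul]
    rw [smul_add, smul_neg, smul_neg, smul_smul, smul_smul, smul_smul, smul_sub, smul_smul]
    have : Complex.I * χ t * Complex.I = -(χ t : ℂ) := by
      linear_combination (χ t : ℂ) * Complex.I_mul_I
    rw [this]
    module
  have hRY : ∀ t, R (Y t) = F t := fun t => by
    simp only [hY, hF, map_smul]
    congr 1
    have := hR.apply_sub (hU.map_graph (-t) hxy)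
    rwa [← map_smul, ← map_sub] at this
  have hSY : ∀ t, S (Y t) = applyExt A (F t) := fun t => by rw [hS, hRY]
  have hcoef : ∀ n, ‖S (fourierCoeffOn hpq Y n)‖ₑ ≤
      ENNReal.ofReal c * ‖fourierCoeffOn hpq g n‖ₑ := fun n => by
    have h1 : R (fourierCoeffOn hpq Y n) = fourierCoeffOn hpq F n := by
      rw [clm_fourierCoeffOn hpq R hYc]; simp_rw [hRY]
    have h2 := fourierCoeffOn_deriv hpq hFd hF'c (by simp [hF, hχ]) (by simp [hF, hχ]) n
    have h3 : fourierCoeffOn hpq Y n =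
        fourierCoeffOn hpq (fun t => Complex.I • F' t) n - fourierCoeffOn hpq g n := by
      have hc : ∀ {f : ℝ → E}, Continuous f → IntervalIntegrable
          (fun t : ℝ => fourier (-n) (t : AddCircle (q - p)) • f t) volume p q := fun hf =>
        (((map_continuous (fourier (-n))).comp (AddCircle.continuous_mk' _)).smul
          hf).intervalIntegrable _ _
      rw [fourierCoeffOn_eq_integral, fourierCoeffOn_eq_integral, fourierCoeffOn_eq_integral,
        ← smul_sub, ← intervalIntegral.integral_sub
          (hc (f := fun t => Complex.I • F' t) (hF'c.const_smul Complex.I)) (hc hgc)]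
      simp_rw [hYg, smul_sub]
    have h4 := hA.bound (-(2 * Real.pi * n / (q - p))) (hR.mem_graph (fourierCoeffOn hpq Y n))
    rw [← hS] at h4
    have h5 : fourierCoeffOn hpq Y n + z • R (fourierCoeffOn hpq Y n) -
        (((-(2 * Real.pi * n / (q - p)) : ℝ) : ℂ) + ε * Complex.I) • R (fourierCoeffOn hpq Y n) =
        -fourierCoeffOn hpq g n := by
      rw [h1, h3, h2, hzε]; module
    rw [h5, norm_neg] at h4
    rw [← ofReal_norm, ← ofReal_norm, ← ENNReal.ofReal_mul hA.c_nonneg]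
    exact ENNReal.ofReal_le_ofReal h4
  have hpars : ∫⁻ t in Ioc p q, ‖S (Y t)‖ₑ ^ 2 ≤
      ENNReal.ofReal (c ^ 2) * ∫⁻ t in Ioc p q, ‖g t‖ₑ ^ 2 := by
    have hk0 : ENNReal.ofReal (q - p)⁻¹ ≠ 0 := by
      rw [Ne, ENNReal.ofReal_eq_zero, not_le]; exact inv_pos.mpr (sub_pos.mpr hpq)
    rw [← ENNReal.mul_le_mul_iff_right hk0 ENNReal.ofReal_ne_top, mul_left_comm,
      ← tsum_enorm_fourierCoeffOn_sq hpq (f := fun t => S (Y t)) (S.continuous.comp hYc),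
      ← tsum_enorm_fourierCoeffOn_sq hpq hgc, ← ENNReal.tsum_mul_left]
    refine ENNReal.tsum_le_tsum fun n => ?_
    have := hcoef n
    rw [clm_fourierCoeffOn hpq S hYc] at this
    calc _ ≤ (ENNReal.ofReal c * ‖fourierCoeffOn hpq g n‖ₑ) ^ 2 := pow_le_pow_left' this 2
      _ = _ := by rw [mul_pow, ENNReal.ofReal_pow hA.c_nonneg]
  have hgb : ∀ t ∈ Ioc p q, ‖g t‖ₑ ^ 2 ≤ ENNReal.ofReal ((D + ε * D ^ 2) ^ 2) * ‖x‖ₑ ^ 2 := by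
    intro t ht
    have h1 : |χ' t| ≤ D := by
      rw [abs_le]; constructor <;> simp only [hχ'] <;> linarith [ht.1, ht.2]
    have h2 : |χ t| ≤ D ^ 2 := by
      rw [abs_of_nonneg (mul_nonneg (by linarith [ht.1]) (by linarith [ht.2])), sq]
      exact mul_le_mul (by linarith [ht.2]) (by linarith [ht.1]) (by linarith [ht.2]) hD0.le
    have h3 : ‖g t‖ ≤ (D + ε * D ^ 2) * ‖x‖ := by
      simp only [hg]
      rw [norm_smul, hU.norm_map, norm_mul, Complex.norm_I, one_mul]
      have : ((χ' t : ℂ) + ε * χ t) = ((χ' t + ε * χ t : ℝ) : ℂ) := by push_cast; rfl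
      rw [this, Complex.norm_real, Real.norm_eq_abs]
      gcongr
      refine (abs_add_le _ _).trans (add_le_add h1 ?_)
      rw [abs_mul, abs_of_pos hε]
      gcongr
    rw [← ofReal_norm, ← ofReal_norm, ← ENNReal.ofReal_pow (norm_nonneg _),
      ← ENNReal.ofReal_pow (norm_nonneg _), ← ENNReal.ofReal_mul (sq_nonneg _), ← mul_pow]
    exact ENNReal.ofReal_le_ofReal (pow_le_pow_left₀ (norm_nonneg _) h3 2)
  have hsub : Ioc a b ⊆ Ioc p q := Ioc_subset_Ioc (by linarith) (by linarith)
  -- On `[a, b]`, at distance at least `1` from `p` and from `q`, the cut-off is at least `1`.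
  have hmono : ∀ t ∈ Ioc a b, ‖applyExt A (U (-t) x)‖ₑ ^ 2 ≤ ‖S (Y t)‖ₑ ^ 2 := by
    intro t ht
    have h1 : 1 ≤ χ t := by
      have e1 : 1 ≤ t - p := by linarith [ht.1]
      have e2 : 1 ≤ q - t := by linarith [ht.2]
      exact one_le_mul_of_one_le_of_one_le e1 e2
    have h2 : S (Y t) = (χ t : ℂ) • applyExt A (U (-t) x) := by
      rw [hSY]
      exact applyExt_smul _ (hA.mem (hU.map_graph (-t) hxy))
    rw [h2, enorm_smul]
    refine pow_le_pow_left' (le_mul_of_one_le_left zero_le ?_) 2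
    rw [← ofReal_norm, Complex.norm_real, ← ENNReal.ofReal_one]
    exact ENNReal.ofReal_le_ofReal (h1.trans (le_abs_self _))
  calc ∫⁻ t in Ioc a b, ‖applyExt A (U (-t) x)‖ₑ ^ 2
      ≤ ∫⁻ t in Ioc a b, ‖S (Y t)‖ₑ ^ 2 := setLIntegral_mono' measurableSet_Ioc hmono
    _ ≤ ∫⁻ t in Ioc p q, ‖S (Y t)‖ₑ ^ 2 := lintegral_mono_set hsub
    _ ≤ ENNReal.ofReal (c ^ 2) * ∫⁻ t in Ioc p q, ‖g t‖ₑ ^ 2 := hpars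
    _ ≤ ENNReal.ofReal (c ^ 2) * (ENNReal.ofReal ((D + ε * D ^ 2) ^ 2) * ‖x‖ₑ ^ 2 *
          volume (Ioc p q)) := by
        gcongr
        rw [← setLIntegral_const]
        exact setLIntegral_mono' measurableSet_Ioc hgb
    _ = _ := by
        have : q - p = D := by rw [hq]; ring
        rw [Real.volume_Ioc, this, ENNReal.ofReal_mul (sq_nonneg c),
          ENNReal.ofReal_mul (sq_nonneg _)]
        ring

end Smoothing

/-! ### Calculus of primitives -/

section Primitive

variable {E F G : Type*} [NormedAddCommGroup E] [NormedSpace ℝ E] [CompleteSpace E]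
  [NormedAddCommGroup F] [NormedSpace ℝ F] [CompleteSpace F]
  [NormedAddCommGroup G] [NormedSpace ℝ G] [CompleteSpace G]

/-- The product rule for primitives of integrable functions: Fubini's theorem on the square, split
along the diagonal. -/
lemma bilin_integral_integral (B : E →L[ℝ] F →L[ℝ] G) {p : ℝ → E} {q : ℝ → F} {a b : ℝ}
    (hab : a ≤ b) (hp : IntegrableOn p (Ioc a b)) (hq : IntegrableOn q (Ioc a b)) :
    B (∫ s in a..b, p s) (∫ s in a..b, q s) =
      (∫ s in a..b, B (p s) (∫ r in a..s, q r)) + ∫ s in a..b, B (∫ r in a..s, p r) (q s) := by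
  set μ : Measure ℝ := volume.restrict (Ioc a b) with hμ
  set f : ℝ × ℝ → G := fun z => B (p z.1) (q z.2) with hf
  have hfi : Integrable f (μ.prod μ) :=
    Integrable.op_fst_snd (op := fun x y => B x y) (by fun_prop) ⟨‖B‖, B.le_opNorm₂⟩ hp hq
  set S : Set (ℝ × ℝ) := {z | z.2 ≤ z.1} with hS
  have hSm : MeasurableSet S := measurableSet_le measurable_snd measurable_fst
  have h1 : B (∫ s in a..b, p s) (∫ s in a..b, q s) = ∫ z, f z ∂(μ.prod μ) := by
    rw [intervalIntegral.integral_of_le hab, intervalIntegral.integral_of_le hab]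
    exact (integral_prod_bilin B hp hq).symm
  have h2 : ∫ z, f z ∂(μ.prod μ) =
      (∫ z, S.indicator f z ∂(μ.prod μ)) + ∫ z, Sᶜ.indicator f z ∂(μ.prod μ) := by
    rw [integral_indicator hSm, integral_indicator hSm.compl]
    exact (integral_add_compl hSm hfi).symm
  have h3 : ∫ z, S.indicator f z ∂(μ.prod μ) = ∫ s in a..b, B (p s) (∫ r in a..s, q r) := by
    rw [integral_prod _ (hfi.indicator hSm), intervalIntegral.integral_of_le hab]
    refine setIntegral_congr_fun measurableSet_Ioc fun s hs => ?_
    have e1 : (fun r => S.indicator f (s, r)) = (Iic s).indicator fun r => B (p s) (q r) := by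
      ext r; simp only [indicator, hS, hf, mem_Iic]; rfl
    have e2 : Ioc a b ∩ Iic s = Ioc a s := by
      ext r; simp only [mem_inter_iff, mem_Ioc, mem_Iic]
      exact ⟨fun h => ⟨h.1.1, h.2⟩, fun h => ⟨⟨h.1, h.2.trans hs.2⟩, h.2⟩⟩
    simp only [e1]
    rw [hμ, setIntegral_indicator measurableSet_Iic, e2, intervalIntegral.integral_of_le hs.1.le]
    exact ContinuousLinearMap.integral_comp_comm (B (p s))
      (hq.mono_set (Ioc_subset_Ioc_right hs.2))
  have h4 : ∫ z, Sᶜ.indicator f z ∂(μ.prod μ) = ∫ s in a..b, B (∫ r in a..s, p r) (q s) := by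
    rw [integral_prod_symm _ (hfi.indicator hSm.compl), intervalIntegral.integral_of_le hab]
    refine setIntegral_congr_fun measurableSet_Ioc fun s hs => ?_
    have e1 : (fun r => Sᶜ.indicator f (r, s)) =
        (Iio s).indicator fun r => B.flip (q s) (p r) := by
      ext r
      by_cases h : r < s
      · rw [indicator_of_mem (show r ∈ Iio s from h),
          indicator_of_mem (show (r, s) ∈ Sᶜ from not_le.mpr h)]
        rfl
      · rw [indicator_of_notMem (show r ∉ Iio s from h),
          indicator_of_notMem (show (r, s) ∉ Sᶜ from fun h' => h (not_le.mp h'))]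
    have e2 : Ioc a b ∩ Iio s = Ioo a s := by
      ext r; simp only [mem_inter_iff, mem_Ioc, mem_Iio, mem_Ioo]
      exact ⟨fun h => ⟨h.1.1, h.2⟩, fun h => ⟨⟨h.1, h.2.le.trans hs.2⟩, h.2⟩⟩
    simp only [e1]
    rw [hμ, setIntegral_indicator measurableSet_Iio, e2, ← integral_Ioc_eq_integral_Ioo,
      intervalIntegral.integral_of_le hs.1.le]
    exact ContinuousLinearMap.integral_comp_comm (B.flip (q s))
      (hp.mono_set (Ioc_subset_Ioc_right hs.2))
  rw [h1, h2, h3, h4]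

/-- The product rule in integrated form, for `P(t) = x + ∫ₐᵗ p` and `Q(t) = y + ∫ₐᵗ q`. -/
lemma bilin_primitive (B : E →L[ℝ] F →L[ℝ] G) {p : ℝ → E} {q : ℝ → F} {a b : ℝ}
    (hab : a ≤ b) (hp : IntegrableOn p (Ioc a b)) (hq : IntegrableOn q (Ioc a b)) (x : E) (y : F) :
    B (x + ∫ s in a..b, p s) (y + ∫ s in a..b, q s) = B x y +
      ((∫ s in a..b, B (p s) (y + ∫ r in a..s, q r)) +
        ∫ s in a..b, B (x + ∫ r in a..s, p r) (q s)) := by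
  have hpi : IntervalIntegrable p volume a b := (intervalIntegrable_iff_integrableOn_Ioc_of_le
    hab).mpr hp
  have hqi : IntervalIntegrable q volume a b := (intervalIntegrable_iff_integrableOn_Ioc_of_le
    hab).mpr hq
  have hPc : ContinuousOn (fun s => ∫ r in a..s, p r) (uIcc a b) :=
    intervalIntegral.continuousOn_primitive_interval' hpi left_mem_uIcc
  have hQc : ContinuousOn (fun s => ∫ r in a..s, q r) (uIcc a b) :=
    intervalIntegral.continuousOn_primitive_interval' hqi left_mem_uIcc
  have i1 : IntervalIntegrable (fun s => B (p s) (∫ r in a..s, q r)) volume a b := by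
    obtain ⟨C, hC⟩ := isCompact_uIcc.exists_bound_of_continuousOn hQc
    rw [intervalIntegrable_iff_integrableOn_Ioc_of_le hab]
    refine Integrable.mono' (g := fun s => ‖B‖ * ‖p s‖ * C) ((hp.norm.const_mul _).mul_const _)
      ?_ ?_
    · have := (hQc.mono (Ioc_subset_Icc_self.trans Icc_subset_uIcc)).aestronglyMeasurable
        (μ := volume) measurableSet_Ioc
      exact B.aestronglyMeasurable_comp₂ hp.1 this
    · refine (ae_restrict_mem measurableSet_Ioc).mono fun s hs => ?_
      refine (B.le_opNorm₂ _ _).trans ?_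
      gcongr
      exact hC s (Icc_subset_uIcc (Ioc_subset_Icc_self hs))
  have i2 : IntervalIntegrable (fun s => B (∫ r in a..s, p r) (q s)) volume a b := by
    obtain ⟨C, hC⟩ := isCompact_uIcc.exists_bound_of_continuousOn hPc
    rw [intervalIntegrable_iff_integrableOn_Ioc_of_le hab]
    refine Integrable.mono' (g := fun s => ‖B‖ * C * ‖q s‖) (hq.norm.const_mul _) ?_ ?_
    · have := (hPc.mono (Ioc_subset_Icc_self.trans Icc_subset_uIcc)).aestronglyMeasurable
        (μ := volume) measurableSet_Ioc
      exact B.aestronglyMeasurable_comp₂ this hq.1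
    · refine (ae_restrict_mem measurableSet_Ioc).mono fun s hs => ?_
      refine (B.le_opNorm₂ _ _).trans ?_
      gcongr
      exact hC s (Icc_subset_uIcc (Ioc_subset_Icc_self hs))
  have i3 : IntervalIntegrable (fun s => B (p s) y) volume a b :=
    ((B.flip y).integrable_comp hpi.1 : _) |> fun h =>
      (intervalIntegrable_iff_integrableOn_Ioc_of_le hab).mpr h
  have i4 : IntervalIntegrable (fun s => B x (q s)) volume a b :=
    ((B x).integrable_comp hqi.1 : _) |> fun h =>
      (intervalIntegrable_iff_integrableOn_Ioc_of_le hab).mpr h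
  have e3 : ∫ s in a..b, B (p s) y = B (∫ s in a..b, p s) y :=
    (B.flip y).intervalIntegral_comp_comm hpi
  have e4 : ∫ s in a..b, B x (q s) = B x (∫ s in a..b, q s) :=
    (B x).intervalIntegral_comp_comm hqi
  simp only [map_add, add_apply]
  rw [intervalIntegral.integral_add i3 i1, intervalIntegral.integral_add i4 i2,
    bilin_integral_integral B hab hp hq, e3, e4]
  abel

end Primitive

/-! ### The Sobolev space on an interval -/

section Sobolev

variable {T : ℝ} {E : Type*} [NormedAddCommGroup E] [InnerProductSpace ℂ E]

/-- The function `t ↦ x + ∫₀ᵗ h` for `h ∈ L²(0, T)`. The representative of `h` is replaced by `0`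
outside `(0, T)`, so that the function is defined and continuous on the whole line. -/
noncomputable def primitive (x : E) (h : L2 T E) (t : ℝ) : E :=
  x + ∫ s in (0 : ℝ)..t, (Ioo 0 T).indicator h s

lemma integrable_indicator_L2 (h : L2 T E) : Integrable ((Ioo 0 T).indicator h) :=
  IntegrableOn.integrable_indicator ((Lp.memLp h).integrable one_le_two) measurableSet_Ioo

lemma continuous_primitive (x : E) (h : L2 T E) : Continuous (primitive x h) :=
  continuous_const.add (intervalIntegral.continuous_primitive
    (fun _ _ => (integrable_indicator_L2 h).intervalIntegrable) 0)

lemma primitive_zero (x : E) (h : L2 T E) : primitive x h 0 = x := by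
  rw [primitive, intervalIntegral.integral_same, add_zero]

lemma primitive_eq_add (x : E) (h : L2 T E) (a t : ℝ) :
    primitive x h t = primitive x h a + ∫ s in a..t, (Ioo 0 T).indicator h s := by
  rw [primitive, primitive, add_assoc, intervalIntegral.integral_add_adjacent_intervals
    (integrable_indicator_L2 h).intervalIntegrable (integrable_indicator_L2 h).intervalIntegrable]

lemma norm_primitive_le (x : E) (h : L2 T E) (t : ℝ) :
    ‖primitive x h t‖ ≤ ‖x‖ + ∫ s, ‖(Ioo 0 T).indicator h s‖ := by
  refine (norm_add_le _ _).trans (add_le_add_right ?_ _)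
  refine (intervalIntegral.norm_integral_le_integral_norm_uIoc).trans ?_
  exact setIntegral_le_integral (integrable_indicator_L2 h).norm
    (Eventually.of_forall fun _ => norm_nonneg _)

lemma memLp_primitive (x : E) (h : L2 T E) :
    MemLp (primitive x h) 2 (volume.restrict (Ioo (0 : ℝ) T)) :=
  MemLp.of_bound (continuous_primitive x h).aestronglyMeasurable _
    (Eventually.of_forall (norm_primitive_le x h))

lemma continuous_test {φ : ℝ → ℝ} (hφ : ContDiff ℝ ∞ φ) : Continuous (deriv φ) :=
  hφ.continuous_deriv (by simp)

variable [CompleteSpace E]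

lemma isWeakDeriv_of_ae_eq_primitive (hT : 0 < T) {x : E} {v h : L2 T E}
    (hv : v =ᵐ[volume.restrict (Ioo (0 : ℝ) T)] primitive x h) : IsWeakDeriv v h := by
  intro φ hφ hc hs
  have hφ0 : ∀ t, t ∉ Ioo 0 T → φ t = 0 := fun t ht =>
    image_eq_zero_of_notMem_tsupport fun h => ht (hs h)
  have hd : Continuous (deriv φ) := continuous_test hφ
  have hint : ∀ t, ∫ s in (0 : ℝ)..t, deriv φ s = φ t := fun t => by
    rw [intervalIntegral.integral_deriv_eq_sub'
      φ rfl (fun s _ => (hφ.differentiable (by simp)).differentiableAt) hd.continuousOn,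
      hφ0 0 (by simp), sub_zero]
  have key := bilin_primitive (ContinuousLinearMap.lsmul ℝ ℝ : ℝ →L[ℝ] E →L[ℝ] E) hT.le
    (hd.integrableOn_Ioc) ((integrable_indicator_L2 h).integrableOn) 0 x
  simp only [zero_add, hint, ContinuousLinearMap.lsmul_apply] at key
  rw [hφ0 T (by simp), zero_smul, zero_smul, zero_add] at key
  change 0 = (∫ s in (0 : ℝ)..T, deriv φ s • primitive x h s) +
    ∫ s in (0 : ℝ)..T, φ s • (Ioo 0 T).indicator h s at key
  rw [intervalIntegral.integral_of_le hT.le, intervalIntegral.integral_of_le hT.le,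
    integral_Ioc_eq_integral_Ioo, integral_Ioc_eq_integral_Ioo] at key
  have e1 : ∫ t in Ioo 0 T, deriv φ t • v t = ∫ t in Ioo 0 T, deriv φ t • primitive x h t := by
    refine integral_congr_ae ?_
    filter_upwards [hv] with t ht
    rw [ht]
  have e2 : ∫ t in Ioo 0 T, φ t • (Ioo 0 T).indicator h t = ∫ t in Ioo 0 T, φ t • h t := by
    refine setIntegral_congr_fun measurableSet_Ioo fun t ht => ?_
    simp only [indicator_of_mem ht]
  rw [e1, ← e2]
  exact eq_neg_of_add_eq_zero_left key.symm

lemma L2_locallyIntegrableOn (v : L2 T E) : LocallyIntegrableOn v (Ioo 0 T) :=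
  IntegrableOn.locallyIntegrableOn ((Lp.memLp v).integrable one_le_two)

lemma setIntegral_smul_eq_integral {φ : ℝ → ℝ} (hs : tsupport φ ⊆ Ioo 0 T) (f : ℝ → E) :
    ∫ t in Ioo 0 T, φ t • f t = ∫ t, φ t • f t := by
  refine setIntegral_eq_integral_of_forall_compl_eq_zero fun t ht => ?_
  rw [image_eq_zero_of_notMem_tsupport fun h => ht (hs h), zero_smul]

lemma IsWeakDeriv.unique {v g g' : L2 T E} (h : IsWeakDeriv v g) (h' : IsWeakDeriv v g') :
    g = g' := by
  have h0 : ∀ᵐ t, t ∈ Ioo 0 T → (g - g' : L2 T E) t = 0 := by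
    refine isOpen_Ioo.ae_eq_zero_of_integral_contDiff_smul_eq_zero (L2_locallyIntegrableOn _) ?_
    intro φ hφ hc hs
    have e1 : ∫ t in Ioo 0 T, φ t • (g - g' : L2 T E) t =
        ∫ t in Ioo 0 T, (φ t • g t - φ t • g' t) := by
      refine integral_congr_ae ?_
      filter_upwards [Lp.coeFn_sub g g'] with t ht
      rw [ht, Pi.sub_apply, smul_sub]
    rw [← setIntegral_smul_eq_integral hs, e1,
      integral_sub (integrable_test _ hφ.continuous hc g) (integrable_test _ hφ.continuous hc g'),
      ← neg_inj, neg_sub, neg_zero, sub_eq_zero]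
    have := (h φ hφ hc hs).symm.trans (h' φ hφ hc hs)
    exact (neg_injective this).symm
  rw [← sub_eq_zero]
  refine Lp.ext ?_
  filter_upwards [(ae_restrict_iff' measurableSet_Ioo).mpr h0,
    Lp.coeFn_zero E 2 (volume.restrict (Ioo (0 : ℝ) T))] with t ht h0t
  rw [ht, h0t]; rfl

/-- A smooth function of integral zero, compactly supported in `(0, T)`, is the derivative of such a
function. -/
lemma exists_deriv_eq_of_integral_eq_zero {ψ : ℝ → ℝ} (hψ : ContDiff ℝ ∞ ψ)
    (hc : HasCompactSupport ψ) (hs : tsupport ψ ⊆ Ioo 0 T) (h0 : ∫ t, ψ t = 0) :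
    ∃ θ : ℝ → ℝ, ContDiff ℝ ∞ θ ∧ HasCompactSupport θ ∧ tsupport θ ⊆ Ioo 0 T ∧ deriv θ = ψ := by
  rcases (tsupport ψ).eq_empty_or_nonempty with hemp | hne
  · have : ψ = 0 := by
      ext t; exact image_eq_zero_of_notMem_tsupport (by rw [hemp]; exact notMem_empty t)
    refine ⟨0, contDiff_const, HasCompactSupport.zero, by simp [tsupport], ?_⟩
    rw [this]; exact deriv_zero
  obtain ⟨a, ha⟩ := hc.isCompact.exists_isLeast hne
  obtain ⟨b, hb⟩ := hc.isCompact.exists_isGreatest hne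
  have hout : ∀ t, t ∉ Icc a b → ψ t = 0 := fun t ht =>
    image_eq_zero_of_notMem_tsupport fun h => ht ⟨ha.2 h, hb.2 h⟩
  have hd : ∀ t, HasDerivAt (fun t => ∫ s in a..t, ψ s) (ψ t) t := fun t =>
    (hψ.continuous.integral_hasStrictDerivAt a t).hasDerivAt
  have hderiv : deriv (fun t => ∫ s in a..t, ψ s) = ψ := by
    ext t; exact (hd t).deriv
  have hsupp : Function.support (fun t => ∫ s in a..t, ψ s) ⊆ Icc a b := by
    intro t ht
    by_contra hcon
    refine ht ?_
    rw [mem_Icc, not_and_or, not_le, not_le] at hcon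
    rcases hcon with h | h
    · refine intervalIntegral.integral_zero_ae ?_
      have hne : ∀ᵐ s : ℝ, s ≠ a := by simp [ae_iff]
      filter_upwards [hne] with s hsa hs'
      rw [uIoc_of_ge h.le] at hs'
      exact hout s fun hh => hsa (le_antisymm hs'.2 hh.1)
    · have hab : a ≤ b := ha.2 hb.1
      change ∫ s in a..t, ψ s = 0
      rw [intervalIntegral.integral_of_le (hab.trans h.le)]
      have e : ∫ s in Ioc a t, ψ s = ∫ s in Icc a t, ψ s := integral_Icc_eq_integral_Ioc.symm
      rw [e, setIntegral_eq_integral_of_forall_compl_eq_zero, h0]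
      intro s hs'
      exact hout s fun hh => hs' ⟨hh.1, hh.2.trans h.le⟩
  refine ⟨fun t => ∫ s in a..t, ψ s, ?_,
    HasCompactSupport.of_support_subset_isCompact isCompact_Icc hsupp,
    (closure_minimal hsupp isClosed_Icc).trans fun t ht =>
      ⟨(hs ha.1).1.trans_le ht.1, ht.2.trans_lt (hs hb.1).2⟩, hderiv⟩
  rw [contDiff_infty_iff_deriv, hderiv]
  exact ⟨fun t => (hd t).differentiableAt, hψ⟩

/-- The lemma of du Bois-Reymond. -/
lemma IsWeakDeriv.exists_ae_eq_const (hT : 0 < T) {z : L2 T E} (h : IsWeakDeriv z 0) :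
    ∃ x : E, z =ᵐ[volume.restrict (Ioo (0 : ℝ) T)] fun _ => x := by
  let ρ : ContDiffBump (T / 2 : ℝ) := ⟨T / 8, T / 4, by positivity, by linarith⟩
  set r : ℝ → ℝ := ρ.normed volume with hr
  have hr1 : ∫ t, r t = 1 := ρ.integral_normed
  have hrs : tsupport r ⊆ Ioo 0 T := by
    rw [hr, ρ.tsupport_normed_eq, Real.closedBall_eq_Icc]
    intro t ht
    have h1 : T / 2 - T / 4 ≤ t := ht.1
    have h2 : t ≤ T / 2 + T / 4 := ht.2
    exact ⟨by linarith, by linarith⟩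
  have hrd : ContDiff ℝ ∞ r := ρ.contDiff_normed
  have hrc : HasCompactSupport r := ρ.hasCompactSupport_normed
  refine ⟨∫ t in Ioo 0 T, r t • z t, ?_⟩
  set x := ∫ t in Ioo 0 T, r t • z t with hx
  have h0 : ∀ᵐ t, t ∈ Ioo 0 T → z t - x = 0 := by
    refine isOpen_Ioo.ae_eq_zero_of_integral_contDiff_smul_eq_zero
      ((L2_locallyIntegrableOn z).sub (continuousOn_const.locallyIntegrableOn measurableSet_Ioo)) ?_
    intro φ hφ hc hs
    set k : ℝ := ∫ t, φ t with hk
    have hφi : Integrable φ := hφ.continuous.integrable_of_hasCompactSupport hc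
    have hri : Integrable r := hrd.continuous.integrable_of_hasCompactSupport hrc
    have hψs : tsupport (fun t => φ t - k * r t) ⊆ tsupport φ ∪ tsupport r := by
      refine closure_minimal (fun t ht => ?_)
        ((isClosed_tsupport _).union (isClosed_tsupport _))
      by_contra hcon
      rw [mem_union, not_or] at hcon
      refine ht ?_
      simp [image_eq_zero_of_notMem_tsupport hcon.1, image_eq_zero_of_notMem_tsupport hcon.2]
    obtain ⟨θ, hθ, hθc, hθs, hθd⟩ := exists_deriv_eq_of_integral_eq_zero (T := T)
      (ψ := fun t => φ t - k * r t) (hφ.sub (contDiff_const.mul hrd))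
      (HasCompactSupport.of_support_subset_isCompact (hc.isCompact.union hrc.isCompact)
        ((subset_tsupport _).trans hψs)) (hψs.trans (union_subset hs hrs))
      (by rw [integral_sub hφi (hri.const_mul k), integral_const_mul, hr1, mul_one, sub_self])
    have h1 := h θ hθ hθc hθs
    have e0 : ∫ t in Ioo 0 T, θ t • (0 : L2 T E) t = 0 := by
      rw [integral_congr_ae (g := fun _ => (0 : E)), integral_zero]
      filter_upwards [Lp.coeFn_zero E 2 (volume.restrict (Ioo (0 : ℝ) T))] with t ht
      rw [ht, Pi.zero_apply, smul_zero]
    rw [e0, neg_zero, hθd] at h1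
    simp_rw [sub_smul, mul_smul] at h1
    have hrz : Integrable (fun t => k • r t • z t) (volume.restrict (Ioo 0 T)) :=
      (integrable_test r hrd.continuous hrc z).smul k
    rw [integral_sub (integrable_test φ hφ.continuous hc z) hrz, integral_smul, ← hx,
      sub_eq_zero] at h1
    simp_rw [← setIntegral_smul_eq_integral hs, smul_sub]
    have hφi' : Integrable φ (volume.restrict (Ioo 0 T)) := hφi.integrableOn
    rw [integral_sub (integrable_test φ hφ.continuous hc z) (hφi'.smul_const x), h1,
      integral_smul_const, sub_eq_zero]
    congr 1
    refine (setIntegral_eq_integral_of_forall_compl_eq_zero fun t ht => ?_).symm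
    exact image_eq_zero_of_notMem_tsupport fun h => ht (hs h)
  filter_upwards [(ae_restrict_iff' measurableSet_Ioo).mpr h0] with t ht
  exact sub_eq_zero.mp ht

lemma IsWeakDeriv.exists_ae_eq_primitive (hT : 0 < T) {v g : L2 T E} (h : IsWeakDeriv v g) :
    ∃ x : E, v =ᵐ[volume.restrict (Ioo (0 : ℝ) T)] primitive x g := by
  set p : L2 T E := (memLp_primitive (0 : E) g).toLp with hp
  have hpe : p =ᵐ[volume.restrict (Ioo (0 : ℝ) T)] primitive 0 g := MemLp.coeFn_toLp _
  have hd : IsWeakDeriv (v + (-1 : ℂ) • p) (g + (-1 : ℂ) • g) :=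
    h.add ((isWeakDeriv_of_ae_eq_primitive hT hpe).smul (-1))
  have e : g + (-1 : ℂ) • g = 0 := by rw [neg_smul, one_smul, add_neg_cancel]
  rw [e] at hd
  obtain ⟨x, hx⟩ := hd.exists_ae_eq_const hT
  refine ⟨x, ?_⟩
  have e' : v + (-1 : ℂ) • p = v - p := by rw [neg_smul, one_smul, sub_eq_add_neg]
  rw [e'] at hx
  filter_upwards [hx, hpe, Lp.coeFn_sub v p] with t h1 h2 h3
  rw [h3, Pi.sub_apply, h2, sub_eq_iff_eq_add] at h1
  rw [h1]
  simp only [primitive, zero_add]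

lemma HasInitialValue.unique (hT : 0 < T) {v : L2 T E} {x y : E} (hx : HasInitialValue v x)
    (hy : HasInitialValue v y) : x = y := by
  obtain ⟨w, hw, hvw, rfl⟩ := hx
  obtain ⟨w', hw', hvw', rfl⟩ := hy
  refine Measure.eqOn_Icc_of_ae_eq volume hT.ne ?_ hw hw' ⟨le_rfl, hT.le⟩
  rw [← restrict_Ioo_eq_restrict_Icc]
  exact hvw.symm.trans hvw'

lemma HasInitialValue.initialValue_eq (hT : 0 < T) {v : L2 T E} {x : E}
    (hx : HasInitialValue v x) : initialValue v = x := by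
  have h : ∃ x : E, HasInitialValue v x := ⟨x, hx⟩
  rw [initialValue, dif_pos h]
  exact h.choose_spec.unique hT hx

lemma hasInitialValue_of_ae_eq_primitive {v h : L2 T E} {x : E}
    (hv : v =ᵐ[volume.restrict (Ioo (0 : ℝ) T)] primitive x h) : HasInitialValue v x :=
  ⟨primitive x h, (continuous_primitive x h).continuousOn, hv, primitive_zero x h⟩

lemma isWeakDeriv_weakDeriv (v : H1 T E) : IsWeakDeriv (v : L2 T E) (weakDeriv v) :=
  Classical.choose_spec (show ∃ g : L2 T E, IsWeakDeriv (v : L2 T E) g from v.2)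

lemma H1.ae_eq_primitive (hT : 0 < T) (v : H1 T E) :
    (v : L2 T E) =ᵐ[volume.restrict (Ioo (0 : ℝ) T)]
      primitive (initialValue (v : L2 T E)) (weakDeriv v) := by
  obtain ⟨x, hx⟩ := (isWeakDeriv_weakDeriv v).exists_ae_eq_primitive hT
  rwa [(hasInitialValue_of_ae_eq_primitive hx).initialValue_eq hT]

lemma H1.hasInitialValue (hT : 0 < T) (v : H1 T E) :
    HasInitialValue (v : L2 T E) (initialValue (v : L2 T E)) :=
  hasInitialValue_of_ae_eq_primitive (H1.ae_eq_primitive hT v)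

lemma H1.ext_of (hT : 0 < T) {v w : H1 T E}
    (h0 : initialValue (v : L2 T E) = initialValue (w : L2 T E))
    (h : weakDeriv v = weakDeriv w) : v = w := by
  refine Subtype.ext (Lp.ext ?_)
  have hv := H1.ae_eq_primitive hT v
  rw [h0, h] at hv
  exact hv.trans (H1.ae_eq_primitive hT w).symm

/-- Evaluation at `0` as a linear map on `H¹(I, E)`. -/
noncomputable def initialValueₗ (hT : 0 < T) : H1 T E →ₗ[ℂ] E where
  toFun v := initialValue (v : L2 T E)
  map_add' v w := by
    obtain ⟨p, hp, hvp, hp0⟩ := H1.hasInitialValue hT v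
    obtain ⟨q, hq, hwq, hq0⟩ := H1.hasInitialValue hT w
    refine HasInitialValue.initialValue_eq hT ⟨p + q, hp.add hq, ?_, by simp [hp0, hq0]⟩
    exact (Lp.coeFn_add _ _).trans (hvp.add hwq)
  map_smul' c v := by
    obtain ⟨p, hp, hvp, hp0⟩ := H1.hasInitialValue hT v
    refine HasInitialValue.initialValue_eq hT ⟨c • p, hp.const_smul c, ?_, by simp [hp0]⟩
    exact (Lp.coeFn_smul _ _).trans (hvp.const_smul c)

/-- The weak derivative as a linear map on `H¹(I, E)`. -/
noncomputable def weakDerivₗ : H1 T E →ₗ[ℂ] L2 T E where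
  toFun := weakDeriv
  map_add' v w := (isWeakDeriv_weakDeriv (v + w)).unique
    ((isWeakDeriv_weakDeriv v).add (isWeakDeriv_weakDeriv w))
  map_smul' c v := (isWeakDeriv_weakDeriv (c • v)).unique ((isWeakDeriv_weakDeriv v).smul c)

/-- The element `t ↦ x + ∫₀ᵗ h` of `H¹(I, E)`. -/
noncomputable def primitiveH1 (hT : 0 < T) (x : E) (h : L2 T E) : H1 T E :=
  ⟨(memLp_primitive x h).toLp, h, isWeakDeriv_of_ae_eq_primitive hT (MemLp.coeFn_toLp _)⟩

lemma primitiveH1_ae_eq (hT : 0 < T) (x : E) (h : L2 T E) :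
    (primitiveH1 hT x h : L2 T E) =ᵐ[volume.restrict (Ioo (0 : ℝ) T)] primitive x h :=
  MemLp.coeFn_toLp (memLp_primitive x h)

lemma initialValue_primitiveH1 (hT : 0 < T) (x : E) (h : L2 T E) :
    initialValue (primitiveH1 hT x h : L2 T E) = x :=
  (hasInitialValue_of_ae_eq_primitive (primitiveH1_ae_eq hT x h)).initialValue_eq hT

lemma weakDeriv_primitiveH1 (hT : 0 < T) (x : E) (h : L2 T E) :
    weakDeriv (primitiveH1 hT x h) = h :=
  (isWeakDeriv_weakDeriv _).unique (isWeakDeriv_of_ae_eq_primitive hT (primitiveH1_ae_eq hT x h))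

end Sobolev

/-! ### Smoothing estimate for functions with square integrable derivative -/

section Lintegral

variable {α E : Type*} [MeasurableSpace α] {μ : Measure α} [NormedAddCommGroup E]

lemma ENNReal_add_sq_le (a b : ℝ≥0∞) : (a + b) ^ 2 ≤ 2 * (a ^ 2 + b ^ 2) := by
  have := ENNReal.rpow_add_le_mul_rpow_add_rpow a b (p := 2) one_le_two
  norm_num at this
  exact this

lemma sq_lintegral_le {f : α → ℝ≥0∞} (hf : AEMeasurable f μ) :
    (∫⁻ x, f x ∂μ) ^ 2 ≤ μ univ * ∫⁻ x, f x ^ 2 ∂μ := by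
  have h := ENNReal.lintegral_mul_le_Lp_mul_Lq μ (Real.HolderConjugate.two_two) hf
    (aemeasurable_const (b := (1 : ℝ≥0∞)))
  simp only [Pi.mul_apply, mul_one, ENNReal.one_rpow, lintegral_const, one_mul] at h
  have h2 := pow_le_pow_left' h 2
  rw [mul_pow, ← ENNReal.rpow_natCast, ← ENNReal.rpow_natCast, ← ENNReal.rpow_mul,
    ← ENNReal.rpow_natCast, ← ENNReal.rpow_mul] at h2
  norm_num at h2
  rwa [mul_comm] at h2

lemma eLpNorm_two_sq (f : α → E) : eLpNorm f 2 μ ^ 2 = ∫⁻ x, ‖f x‖ₑ ^ 2 ∂μ := by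
  rw [eLpNorm_eq_lintegral_rpow_enorm_toReal (by norm_num) (by norm_num), ← ENNReal.rpow_natCast,
    ← ENNReal.rpow_mul]
  norm_num

lemma memLp_two_iff_lintegral {f : α → E} (hf : AEStronglyMeasurable f μ) :
    MemLp f 2 μ ↔ ∫⁻ x, ‖f x‖ₑ ^ 2 ∂μ < ⊤ := by
  rw [← eLpNorm_two_sq, ENNReal.pow_lt_top_iff]
  simp [MemLp, hf]

end Lintegral

section Estimate

variable {E : Type*} [NormedAddCommGroup E] [InnerProductSpace ℂ E] [CompleteSpace E]

/-- The standing assumptions on `H` and `A`, together with the group `U t = e^{itH}`. -/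
structure SmoothPerturbation (H A : E →ₗ.[ℂ] E) (U : ℝ → E →L[ℂ] E) (ε c : ℝ) : Prop where
  selfAdjoint : IsSelfAdjoint H
  closed : A.IsClosed
  symm : ∀ x y : A.domain, inner ℂ (A x) (y : E) = inner ℂ (x : E) (A y)
  rel : RelBound H A ε c
  group : IsUnitaryGroupOf H U

variable {H A : E →ₗ.[ℂ] E} {U : ℝ → E →L[ℂ] E} {ε c : ℝ}

/-- The bound for a regularized version `S = A Q` of `A`: Duhamel's formula in the form
`S e^{-itH} (x + ∫ₐᵗ h) = S e^{-itH} x + ∫ₐᵗ S e^{-itH} h(s) ds` with the smoothing estimate for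
each `h(s)`. -/
lemma lintegral_regularized_le (hP : SmoothPerturbation H A U ε c) {Q K S : E →L[ℂ] E}
    (hQ : ∀ x, (Q x, K x) ∈ H.graph) (hQU : ∀ t x, U t (Q x) = Q (U t x))
    (hS : ∀ x, S x = applyExt A (Q x)) {κ : ℝ} {a b : ℝ}
    (hκ : ∀ x y : E, (x, y) ∈ H.graph →
      ∫⁻ t in Ioc a b, ‖applyExt A (U (-t) x)‖ₑ ^ 2 ≤ ENNReal.ofReal κ * ‖x‖ₑ ^ 2)
    (x : E) {h : ℝ → E} (hh : MemLp h 2 (volume.restrict (Ioc a b))) :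
    ∫⁻ t in Ioc a b, ‖S (U (-t) (x + ∫ s in a..t, h s))‖ₑ ^ 2 ≤
      2 * ENNReal.ofReal κ * (‖Q x‖ₑ ^ 2 +
        ENNReal.ofReal (b - a) * ∫⁻ s in Ioc a b, ‖Q (h s)‖ₑ ^ 2) := by
  set μ : Measure ℝ := volume.restrict (Ioc a b) with hμ
  have hU := hP.group
  have hhi : Integrable h μ := hh.integrable one_le_two
  have hb : ∀ x, ∫⁻ t, ‖S (U (-t) x)‖ₑ ^ 2 ∂μ ≤ ENNReal.ofReal κ * ‖Q x‖ₑ ^ 2 := fun x => by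
    have := hκ _ _ (hQ x)
    simpa only [hQU, ← hS] using this
  have hSc : Continuous fun p : ℝ × E => S (U (-p.1) p.2) :=
    S.continuous.comp hU.continuous_neg_uncurry
  have hmeas2 : AEStronglyMeasurable (fun p : ℝ × ℝ => S (U (-p.1) (h p.2))) (μ.prod μ) :=
    hSc.comp_aestronglyMeasurable (aestronglyMeasurable_id.fst.prodMk hh.1.comp_snd)
  have hmeas1 : ∀ t, AEStronglyMeasurable (fun s => S (U (-t) (h s))) μ := fun t =>
    (S ∘L U (-t)).continuous.comp_aestronglyMeasurable hh.1
  have hpt : ∀ t ∈ Ioc a b, ‖S (U (-t) (x + ∫ s in a..t, h s))‖ₑ ^ 2 ≤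
      2 * (‖S (U (-t) x)‖ₑ ^ 2 +
        ENNReal.ofReal (b - a) * ∫⁻ s, ‖S (U (-t) (h s))‖ₑ ^ 2 ∂μ) := by
    intro t ht
    have hti : IntegrableOn h (Ioc a t) := hhi.mono_measure
      (Measure.restrict_mono (Ioc_subset_Ioc_right ht.2) le_rfl)
    have e1 : S (U (-t) (x + ∫ s in a..t, h s)) =
        S (U (-t) x) + ∫ s in Ioc a t, S (U (-t) (h s)) := by
      rw [map_add, map_add, intervalIntegral.integral_of_le ht.1.le]
      congr 1
      exact ((S ∘L U (-t)).integral_comp_comm hti).symm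
    rw [e1]
    calc _ ≤ (‖S (U (-t) x)‖ₑ + ∫⁻ s, ‖S (U (-t) (h s))‖ₑ ∂μ) ^ 2 := by
          refine pow_le_pow_left' ((enorm_add_le _ _).trans (add_le_add_right ?_ _)) 2
          exact (enorm_integral_le_lintegral_enorm _).trans
            (lintegral_mono_set (Ioc_subset_Ioc_right ht.2))
      _ ≤ 2 * (‖S (U (-t) x)‖ₑ ^ 2 + (∫⁻ s, ‖S (U (-t) (h s))‖ₑ ∂μ) ^ 2) :=
          ENNReal_add_sq_le _ _
      _ ≤ _ := by
          gcongr
          refine (sq_lintegral_le (hmeas1 t).enorm).trans (le_of_eq ?_)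
          rw [hμ, Measure.restrict_apply_univ, Real.volume_Ioc]
  calc ∫⁻ t, ‖S (U (-t) (x + ∫ s in a..t, h s))‖ₑ ^ 2 ∂μ
      ≤ ∫⁻ t, 2 * (‖S (U (-t) x)‖ₑ ^ 2 +
        ENNReal.ofReal (b - a) * ∫⁻ s, ‖S (U (-t) (h s))‖ₑ ^ 2 ∂μ) ∂μ :=
        setLIntegral_mono' measurableSet_Ioc hpt
    _ = 2 * (∫⁻ t, ‖S (U (-t) x)‖ₑ ^ 2 ∂μ + ENNReal.ofReal (b - a) *
          ∫⁻ s, ∫⁻ t, ‖S (U (-t) (h s))‖ₑ ^ 2 ∂μ ∂μ) := by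
        rw [lintegral_const_mul' _ _ (by norm_num), lintegral_add_left,
          lintegral_const_mul' _ _ ENNReal.ofReal_ne_top,
          lintegral_lintegral_swap (hmeas2.enorm.pow_const 2)]
        exact ((S.continuous.comp (hU.continuous_neg x)).enorm.measurable.pow_const 2)
    _ ≤ 2 * (ENNReal.ofReal κ * ‖Q x‖ₑ ^ 2 + ENNReal.ofReal (b - a) *
          ∫⁻ s, ENNReal.ofReal κ * ‖Q (h s)‖ₑ ^ 2 ∂μ) := by
        gcongr with s
        · exact hb x
        · exact hb (h s)
    _ = _ := by
        rw [lintegral_const_mul' _ _ ENNReal.ofReal_ne_top]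
        ring

/-- The smoothing estimate for `w(t) = x + ∫ₐᵗ h`: the vectors `e^{-itH} w(t)` lie in the domain of
`A` for almost every `t`, and `A e^{-itH} w(t)` is square integrable. It is the `L²`-limit of the
functions `A Lₙ e^{-itH} w(t)` for a regularization `Lₙ`, and `A` is closed. -/
theorem exists_smoothing_primitive [TopologicalSpace.SeparableSpace E]
    (hP : SmoothPerturbation H A U ε c) (ℓ : ℝ) (hℓ : 0 ≤ ℓ) :
    ∃ κ : ℝ, 0 ≤ κ ∧ ∀ a b : ℝ, b ≤ a + ℓ → ∀ (x : E) (h : ℝ → E),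
      MemLp h 2 (volume.restrict (Ioc a b)) →
      (∀ᵐ t ∂(volume.restrict (Ioc a b)), U (-t) (x + ∫ s in a..t, h s) ∈ A.domain) ∧
      AEStronglyMeasurable (fun t => applyExt A (U (-t) (x + ∫ s in a..t, h s)))
        (volume.restrict (Ioc a b)) ∧
      ∫⁻ t in Ioc a b, ‖applyExt A (U (-t) (x + ∫ s in a..t, h s))‖ₑ ^ 2 ≤
        ENNReal.ofReal κ * (‖x‖ₑ ^ 2 + ENNReal.ofReal (b - a) * ∫⁻ s in Ioc a b, ‖h s‖ₑ ^ 2) := by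
  obtain ⟨κ, hκ0, hκ⟩ := exists_smoothing hP.selfAdjoint hP.rel hP.group ℓ hℓ
  refine ⟨2 * κ, by positivity, fun a b hab x h hh => ?_⟩
  have hU := hP.group
  obtain ⟨L, K, hR⟩ := exists_isRegularization hP.selfAdjoint
  choose S hS using fun n => hP.rel.exists_clm (hR.mem_graph n)
  set μ : Measure ℝ := volume.restrict (Ioc a b) with hμ
  have hhi : Integrable h μ := hh.integrable one_le_two
  have hLU : ∀ n t x, U t (L n x) = L n (U t x) := fun n t x =>
    hR.comm (U t) (fun x y hxy => hU.map_graph t hxy) n x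
  set w : ℝ → E := fun t => x + ∫ s in a..t, h s with hw
  have hwm : AEStronglyMeasurable w μ := by
    rcases le_total a b with h' | h'
    · have hc : ContinuousOn w (Ioc a b) := continuousOn_const.add
        ((intervalIntegral.continuousOn_primitive_interval'
          ((intervalIntegrable_iff_integrableOn_Ioc_of_le h').mpr hhi) left_mem_uIcc).mono
            (Ioc_subset_Icc_self.trans Icc_subset_uIcc))
      exact hc.aestronglyMeasurable measurableSet_Ioc
    · rw [hμ, Ioc_eq_empty (not_lt.mpr h'), Measure.restrict_empty]
      exact aestronglyMeasurable_zero_measure _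
  set G : ℕ → ℝ → E := fun n t => S n (U (-t) (w t)) with hG
  have hGm : ∀ n, AEStronglyMeasurable (G n) μ := fun n =>
    ((S n).continuous.comp hU.continuous_neg_uncurry).comp_aestronglyMeasurable
      (aestronglyMeasurable_id.prodMk hwm)
  have hLe : ∀ n x, ‖L n x‖ₑ ≤ ‖x‖ₑ := fun n x => by
    rw [← ofReal_norm, ← ofReal_norm]; exact ENNReal.ofReal_le_ofReal (hR.norm_le n x)
  have hhfin : ∫⁻ s, ‖h s‖ₑ ^ 2 ∂μ < ⊤ := (memLp_two_iff_lintegral hh.1).mp hh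
  set M : ℝ≥0∞ := 2 * ENNReal.ofReal κ * (‖x‖ₑ ^ 2 +
    ENNReal.ofReal (b - a) * ∫⁻ s, ‖h s‖ₑ ^ 2 ∂μ) with hM
  have hMfin : M < ⊤ := by
    refine ENNReal.mul_lt_top (ENNReal.mul_lt_top (by norm_num) ENNReal.ofReal_lt_top)
      (ENNReal.add_lt_top.mpr ⟨ENNReal.pow_lt_top enorm_lt_top,
        ENNReal.mul_lt_top ENNReal.ofReal_lt_top hhfin⟩)
  have hGb : ∀ n, ∫⁻ t, ‖G n t‖ₑ ^ 2 ∂μ ≤ M := fun n => by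
    refine (lintegral_regularized_le hP (hR.mem_graph n) (hLU n) (hS n) (hκ a b hab) x hh).trans ?_
    simp only [hM]
    gcongr
    · exact hLe n x
    · exact hLe n _
  have hGL : ∀ n, MemLp (G n) 2 μ := fun n =>
    (memLp_two_iff_lintegral (hGm n)).mpr ((hGb n).trans_lt hMfin)
  -- `δ n` controls the distance of the regularization from the identity along `x` and `h`.
  set δ : ℕ → ℝ≥0∞ := fun n => ‖L n x - x‖ₑ ^ 2 +
    ENNReal.ofReal (b - a) * ∫⁻ s, ‖L n (h s) - h s‖ₑ ^ 2 ∂μ with hδ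
  have hLtend : ∀ x, Tendsto (fun n => ‖L n x - x‖ₑ ^ 2) atTop (𝓝 0) := fun x => by
    have h1 : Tendsto (fun n => L n x - x) atTop (𝓝 0) := by
      simpa using (hR.tendsto x).sub_const x
    have h2 := ((ENNReal.continuous_pow 2).tendsto _).comp h1.enorm
    simpa [Function.comp_def] using h2
  have hδ0 : Tendsto δ atTop (𝓝 0) := by
    have h1 : Tendsto (fun n => ∫⁻ s, ‖L n (h s) - h s‖ₑ ^ 2 ∂μ) atTop (𝓝 (∫⁻ _, 0 ∂μ)) := by
      refine tendsto_lintegral_of_dominated_convergence' (fun s => 4 * ‖h s‖ₑ ^ 2)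
        (fun n => ?_) (fun n => Eventually.of_forall fun s => ?_) ?_
        (Eventually.of_forall fun s => hLtend (h s))
      · exact (((L n).continuous.comp_aestronglyMeasurable hh.1).sub hh.1).enorm.pow_const 2
      · calc ‖L n (h s) - h s‖ₑ ^ 2 ≤ (‖h s‖ₑ + ‖h s‖ₑ) ^ 2 := by
              refine pow_le_pow_left' (enorm_sub_le.trans (add_le_add_left (hLe n _) _)) 2
          _ = 4 * ‖h s‖ₑ ^ 2 := by rw [← two_mul, mul_pow]; norm_num
      · rw [lintegral_const_mul' _ _ (by norm_num)]
        exact (ENNReal.mul_lt_top (by norm_num) hhfin).ne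
    rw [lintegral_zero] at h1
    have h2 := (hLtend x).add
      (ENNReal.Tendsto.const_mul h1 (Or.inr (ENNReal.ofReal_ne_top (r := b - a))))
    simpa using h2
  have hdiff : ∀ n m, ∫⁻ t, ‖G n t - G m t‖ₑ ^ 2 ∂μ ≤
      4 * ENNReal.ofReal κ * (δ n + δ m) := fun n m => by
    have hm : ∀ x, ((L n - L m) x, (K n - K m) x) ∈ H.graph := fun x =>
      H.graph.sub_mem (hR.mem_graph n x) (hR.mem_graph m x)
    have h1 := lintegral_regularized_le hP (Q := L n - L m) (K := K n - K m) (S := S n - S m) hm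
      (fun t x => by simp only [sub_apply, map_sub, hLU])
      (fun x => by
        rw [sub_apply, sub_apply, hS, hS, sub_eq_add_neg (L n x), ← neg_one_smul ℂ,
          applyExt_add (hP.rel.mem (hR.mem_graph n x))
            (A.domain.smul_mem _ (hP.rel.mem (hR.mem_graph m x))),
          applyExt_smul _ (hP.rel.mem (hR.mem_graph m x)), neg_one_smul, sub_eq_add_neg])
      (hκ a b hab) x hh
    have h2 : ∀ y, ‖(L n - L m) y‖ₑ ^ 2 ≤ 2 * (‖L n y - y‖ₑ ^ 2 + ‖L m y - y‖ₑ ^ 2) := fun y => by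
      have e : (L n - L m) y = (L n y - y) - (L m y - y) := by
        rw [sub_apply]; abel
      rw [e]
      exact (pow_le_pow_left' enorm_sub_le 2).trans (ENNReal_add_sq_le _ _)
    have h3 : ∫⁻ s, ‖(L n - L m) (h s)‖ₑ ^ 2 ∂μ ≤ 2 * (∫⁻ s, ‖L n (h s) - h s‖ₑ ^ 2 ∂μ +
        ∫⁻ s, ‖L m (h s) - h s‖ₑ ^ 2 ∂μ) := by
      rw [← lintegral_add_left' , ← lintegral_const_mul' _ _ (by norm_num)]
      · exact lintegral_mono fun s => h2 (h s)
      · exact (((L n).continuous.comp_aestronglyMeasurable hh.1).sub hh.1).enorm.pow_const 2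
    calc ∫⁻ t, ‖G n t - G m t‖ₑ ^ 2 ∂μ
        ≤ 2 * ENNReal.ofReal κ * (‖(L n - L m) x‖ₑ ^ 2 + ENNReal.ofReal (b - a) *
            ∫⁻ s, ‖(L n - L m) (h s)‖ₑ ^ 2 ∂μ) := h1
      _ ≤ 2 * ENNReal.ofReal κ * (2 * (‖L n x - x‖ₑ ^ 2 + ‖L m x - x‖ₑ ^ 2) +
            ENNReal.ofReal (b - a) * (2 * (∫⁻ s, ‖L n (h s) - h s‖ₑ ^ 2 ∂μ +
            ∫⁻ s, ‖L m (h s) - h s‖ₑ ^ 2 ∂μ))) := by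
          gcongr
          exact h2 x
      _ = _ := by simp only [hδ]; ring
  have hcauchy : CauchySeq fun n => (hGL n).toLp (G n) := by
    rw [EMetric.cauchySeq_iff]
    intro η hη
    have h1 : Tendsto (fun n => 4 * ENNReal.ofReal κ * δ n) atTop (𝓝 0) := by
      have := ENNReal.Tendsto.const_mul hδ0
        (Or.inr (ENNReal.mul_ne_top (by norm_num : (4 : ℝ≥0∞) ≠ ⊤)
          (ENNReal.ofReal_ne_top (r := κ))))
      simpa using this
    have hη2 : 0 < η ^ 2 / 2 := ENNReal.half_pos (ENNReal.pow_pos hη 2).ne'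
    obtain ⟨N, hN⟩ := eventually_atTop.mp (h1.eventually (gt_mem_nhds hη2))
    refine ⟨N, fun n hn m hm => ?_⟩
    rw [Lp.edist_toLp_toLp]
    by_contra hcon
    have h2 := pow_le_pow_left' (not_lt.mp hcon) 2
    rw [eLpNorm_two_sq] at h2
    have h3 := h2.trans (hdiff n m)
    rw [mul_add] at h3
    have h4 := ENNReal.add_lt_add (hN n hn) (hN m hm)
    rw [ENNReal.add_halves] at h4
    exact absurd h3 (not_le.mpr h4)
  obtain ⟨g, hg⟩ := cauchySeq_tendsto_of_complete hcauchy
  obtain ⟨φ, hφm, hφ⟩ := (tendstoInMeasure_of_tendsto_Lp hg).exists_seq_tendsto_ae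
  have hcoe : ∀ᵐ t ∂μ, ∀ n, (hGL n).toLp (G n) t = G n t :=
    ae_all_iff.mpr fun n => MemLp.coeFn_toLp _
  have hlim : ∀ᵐ t ∂μ, Tendsto (fun k => G (φ k) t) atTop (𝓝 (g t)) := by
    filter_upwards [hφ, hcoe] with t ht1 ht2
    simpa only [ht2] using ht1
  have hgraph : ∀ᵐ t ∂μ, (U (-t) (w t), g t) ∈ A.graph := by
    filter_upwards [hlim] with t ht
    refine mem_graph_of_tendsto hP.closed (x := fun k => L (φ k) (U (-t) (w t)))
      (fun k => hP.rel.mem (hR.mem_graph _ _)) ((hR.tendsto _).comp hφm.tendsto_atTop) ?_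
    simpa only [hG, hS] using ht
  have happ : (fun t => applyExt A (U (-t) (w t))) =ᵐ[μ] g := by
    filter_upwards [hgraph] with t ht
    exact applyExt_of_graph ht
  refine ⟨hgraph.mono fun t ht => mem_domain_of_graph ht,
    (Lp.aestronglyMeasurable g).congr happ.symm, ?_⟩
  calc ∫⁻ t, ‖applyExt A (U (-t) (w t))‖ₑ ^ 2 ∂μ = ∫⁻ t, ‖g t‖ₑ ^ 2 ∂μ := by
        refine lintegral_congr_ae ?_
        filter_upwards [happ] with t ht
        rw [ht]
    _ = ∫⁻ t, liminf (fun k => ‖G (φ k) t‖ₑ ^ 2) atTop ∂μ := by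
        refine lintegral_congr_ae ?_
        filter_upwards [hlim] with t ht
        exact (((ENNReal.continuous_pow 2).tendsto _).comp ht.enorm).liminf_eq.symm
    _ ≤ liminf (fun k => ∫⁻ t, ‖G (φ k) t‖ₑ ^ 2 ∂μ) atTop :=
        lintegral_liminf_le' fun k => (hGm _).enorm.pow_const 2
    _ ≤ M := by
        refine (liminf_le_liminf (Eventually.of_forall fun k => hGb (φ k))).trans ?_
        rw [liminf_const]
    _ = _ := by
        rw [ENNReal.ofReal_mul (by norm_num), ENNReal.ofReal_ofNat]

end Estimate

/-! ### The potential in the rotating frame -/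

section Potential

variable {E : Type*} [NormedAddCommGroup E] [InnerProductSpace ℂ E] [CompleteSpace E]
  {H A : E →ₗ.[ℂ] E} {ε c T M : ℝ} {B : ℝ → E →L[ℂ] E}

lemma integral_norm_sq_eq_toReal {α : Type*} [MeasurableSpace α] {μ : Measure α} {f : α → E}
    (hf : AEStronglyMeasurable f μ) : ∫ t, ‖f t‖ ^ 2 ∂μ = (∫⁻ t, ‖f t‖ₑ ^ 2 ∂μ).toReal := by
  rw [integral_eq_lintegral_of_nonneg_ae (Eventually.of_forall fun _ => sq_nonneg _)
    (hf.norm.pow 2)]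
  congr 2; ext t
  rw [ENNReal.ofReal_pow (norm_nonneg _), ofReal_norm]

lemma memLp_indicator_L2 (h : L2 T E) (μ : Measure ℝ) (hμ : μ ≤ volume) :
    MemLp ((Ioo 0 T).indicator h) 2 μ :=
  ((memLp_indicator_iff_restrict measurableSet_Ioo).mpr (Lp.memLp h)).mono_measure hμ

lemma integrable_norm_sq_indicator (h : L2 T E) :
    Integrable (fun t => ‖(Ioo 0 T).indicator h t‖ ^ 2) :=
  (memLp_indicator_L2 h volume le_rfl).integrable_norm_pow (by norm_num)

lemma norm_sq_L2 (h : L2 T E) : ‖h‖ ^ 2 = ∫ t in Ioo 0 T, ‖h t‖ ^ 2 := by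
  rw [integral_norm_sq_eq_toReal (Lp.aestronglyMeasurable h), ← eLpNorm_two_sq, Lp.norm_def,
    ENNReal.toReal_pow]

lemma norm_sq_L2_eq_intervalIntegral (hT : 0 ≤ T) (h : L2 T E) :
    ‖h‖ ^ 2 = ∫ t in (0 : ℝ)..T, ‖(Ioo 0 T).indicator h t‖ ^ 2 := by
  rw [norm_sq_L2, intervalIntegral.integral_of_le hT, integral_Ioc_eq_integral_Ioo]
  refine setIntegral_congr_fun measurableSet_Ioo fun t ht => ?_
  simp only [indicator_of_mem ht]

/-- The smoothing estimate for elements of `H¹(I, E)`, on subintervals. -/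
lemma exists_smoothing_H1 [TopologicalSpace.SeparableSpace E]
    (hP : SmoothPerturbation H A (expI H) ε c) (ℓ : ℝ) (hℓ : 0 ≤ ℓ) :
    ∃ κ : ℝ, 0 ≤ κ ∧ ∀ (T a b : ℝ), a ≤ b → b ≤ a + ℓ → ∀ (x : E) (h : L2 T E),
      (∀ᵐ t ∂(volume.restrict (Ioc a b)), expI H (-t) (primitive x h t) ∈ A.domain) ∧
      MemLp (fun t => applyExt A (expI H (-t) (primitive x h t))) 2 (volume.restrict (Ioc a b)) ∧
      ∫ t in a..b, ‖applyExt A (expI H (-t) (primitive x h t))‖ ^ 2 ≤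
        κ * (‖primitive x h a‖ ^ 2 + (b - a) * ∫ t in a..b, ‖(Ioo 0 T).indicator h t‖ ^ 2) := by
  obtain ⟨κ, hκ0, hκ⟩ := exists_smoothing_primitive hP ℓ hℓ
  refine ⟨κ, hκ0, fun T a b hab hb x h => ?_⟩
  have hm := memLp_indicator_L2 h (volume.restrict (Ioc a b)) Measure.restrict_le_self
  obtain ⟨h1, h2, h3⟩ := hκ a b hb (primitive x h a) _ hm
  simp_rw [← primitive_eq_add x h a] at h1 h2 h3
  have hfin : ∫⁻ s in Ioc a b, ‖(Ioo 0 T).indicator h s‖ₑ ^ 2 < ⊤ :=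
    (memLp_two_iff_lintegral hm.1).mp hm
  have hfin' : ENNReal.ofReal κ * (‖primitive x h a‖ₑ ^ 2 +
      ENNReal.ofReal (b - a) * ∫⁻ s in Ioc a b, ‖(Ioo 0 T).indicator h s‖ₑ ^ 2) < ⊤ :=
    ENNReal.mul_lt_top ENNReal.ofReal_lt_top
      (ENNReal.add_lt_top.mpr ⟨ENNReal.pow_lt_top enorm_lt_top,
        ENNReal.mul_lt_top ENNReal.ofReal_lt_top hfin⟩)
  refine ⟨h1, (memLp_two_iff_lintegral h2).mpr (h3.trans_lt hfin'), ?_⟩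
  rw [intervalIntegral.integral_of_le hab, intervalIntegral.integral_of_le hab,
    integral_norm_sq_eq_toReal h2, integral_norm_sq_eq_toReal hm.1]
  refine (ENNReal.toReal_mono hfin'.ne h3).trans (le_of_eq ?_)
  rw [ENNReal.toReal_mul, ENNReal.toReal_ofReal hκ0, ENNReal.toReal_add
    (ENNReal.pow_lt_top enorm_lt_top).ne (ENNReal.mul_lt_top ENNReal.ofReal_lt_top hfin).ne,
    ENNReal.toReal_mul, ENNReal.toReal_ofReal (sub_nonneg.mpr hab), ENNReal.toReal_pow,
    toReal_enorm]

lemma continuousOn_family_apply (hB : IsAdmissibleFamily T B) (hM : ∀ t ∈ Icc 0 T, ‖B t‖ ≤ M)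
    {y : ℝ → E} (hy : ContinuousOn y (Icc 0 T)) : ContinuousOn (fun t => B t (y t)) (Icc 0 T) := by
  intro s hs
  rw [ContinuousWithinAt, tendsto_iff_norm_sub_tendsto_zero]
  have h1 : Tendsto (fun t => M * ‖y t - y s‖ + ‖B t (y s) - B s (y s)‖) (𝓝[Icc 0 T] s)
      (𝓝 (M * 0 + 0)) :=
    ((tendsto_iff_norm_sub_tendsto_zero.mp (hy s hs)).const_mul M).add
      (tendsto_iff_norm_sub_tendsto_zero.mp (hB.continuous (y s) s hs))
  rw [mul_zero, add_zero] at h1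
  refine squeeze_zero' (Eventually.of_forall fun t => norm_nonneg _) ?_ h1
  filter_upwards [self_mem_nhdsWithin] with t ht
  calc ‖B t (y t) - B s (y s)‖ = ‖B t (y t - y s) + (B t (y s) - B s (y s))‖ := by
        rw [map_sub]; congr 1; abel
    _ ≤ ‖B t (y t - y s)‖ + ‖B t (y s) - B s (y s)‖ := norm_add_le _ _
    _ ≤ _ := by
        gcongr
        exact ((B t).le_opNorm _).trans (mul_le_mul_of_nonneg_right (hM t ht) (norm_nonneg _))

lemma memLp_Ioo_of_continuousOn {T : ℝ} {f : ℝ → E} (hf : ContinuousOn f (Icc 0 T)) :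
    MemLp f 2 (volume.restrict (Ioo 0 T)) := by
  obtain ⟨C, hC⟩ := isCompact_Icc.exists_bound_of_continuousOn hf
  refine MemLp.of_bound ((hf.mono Ioo_subset_Icc_self).aestronglyMeasurable measurableSet_Ioo) C ?_
  exact (ae_restrict_mem measurableSet_Ioo).mono fun t ht => hC t (Ioo_subset_Icc_self ht)

lemma memLp_family_apply (hB : IsAdmissibleFamily T B) (hM : ∀ t ∈ Icc 0 T, ‖B t‖ ≤ M)
    {y : ℝ → E} (hy : ContinuousOn y (Icc 0 T)) :
    MemLp (fun t => B t (y t)) 2 (volume.restrict (Ioo 0 T)) :=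
  memLp_Ioo_of_continuousOn (continuousOn_family_apply hB hM hy)

lemma memLp_group_apply {U : ℝ → E →L[ℂ] E} (hU : IsUnitaryGroupOf H U) {f : ℝ → E}
    {μ : Measure ℝ} (hf : MemLp f 2 μ) : MemLp (fun t => U t (f t)) 2 μ := by
  have hm : AEStronglyMeasurable (fun t => U t (f t)) μ :=
    hU.continuous_uncurry.comp_aestronglyMeasurable (aestronglyMeasurable_id.prodMk hf.1)
  exact hf.mono hm (Eventually.of_forall fun t => by rw [hU.norm_map])

lemma continuous_neg_primitive {U : ℝ → E →L[ℂ] E} (hU : IsUnitaryGroupOf H U) (x : E)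
    (h : L2 T E) : Continuous fun t => U (-t) (primitive x h t) :=
  hU.continuous_neg_uncurry.comp (continuous_id.prodMk (continuous_primitive x h))

lemma ae_mem_domain_primitive [TopologicalSpace.SeparableSpace E]
    (hP : SmoothPerturbation H A (expI H) ε c) (hT : 0 < T) (x : E) (h : L2 T E) :
    ∀ᵐ t ∂(volume.restrict (Ioo 0 T)), expI H (-t) (primitive x h t) ∈ A.domain := by
  obtain ⟨κ, -, hκ⟩ := exists_smoothing_H1 hP T hT.le
  have := (hκ T 0 T hT.le (by simp) x h).1
  rwa [← restrict_Ioo_eq_restrict_Ioc] at this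

lemma memLp_applyExt_primitive [TopologicalSpace.SeparableSpace E]
    (hP : SmoothPerturbation H A (expI H) ε c) (hT : 0 < T) (x : E) (h : L2 T E) :
    MemLp (fun t => applyExt A (expI H (-t) (primitive x h t))) 2 (volume.restrict (Ioo 0 T)) := by
  obtain ⟨κ, -, hκ⟩ := exists_smoothing_H1 hP T hT.le
  have := (hκ T 0 T hT.le (by simp) x h).2.1
  rwa [← restrict_Ioo_eq_restrict_Ioc] at this

lemma memLp_skewedPotential [TopologicalSpace.SeparableSpace E]
    (hP : SmoothPerturbation H A (expI H) ε c) (hT : 0 < T) (hB : IsAdmissibleFamily T B)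
    (hM : ∀ t ∈ Icc 0 T, ‖B t‖ ≤ M) (x : E) (h : L2 T E) :
    MemLp (skewedPotential H A B (primitive x h)) 2 (volume.restrict (Ioo 0 T)) :=
  memLp_group_apply hP.group ((memLp_applyExt_primitive hP hT x h).add
    (memLp_family_apply hB hM (continuous_neg_primitive hP.group x h).continuousOn))

/-- `e^{itH₀} (A + B(t)) e^{-itH₀}` is symmetric. -/
lemma im_inner_skewedPotential (hP : SmoothPerturbation H A (expI H) ε c)
    (hB : IsAdmissibleFamily T B) {v : ℝ → E} {t : ℝ} (ht : t ∈ Icc 0 T)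
    (hv : expI H (-t) (v t) ∈ A.domain) :
    (inner ℂ (v t) (skewedPotential H A B v t) : ℂ).im = 0 := by
  rw [skewedPotential, hP.group.inner_map_right]
  set y := expI H (-t) (v t)
  have h1 : inner ℂ (applyExt A y) y = inner ℂ y (applyExt A y) :=
    inner_applyExt_left hP.symm hv hv
  have h2 : inner ℂ (B t y) y = inner ℂ y (B t y) :=
    (ContinuousLinearMap.isSelfAdjoint_iff_isSymmetric.mp (hB.selfAdjoint t ht)) y y
  refine Complex.conj_eq_iff_im.mp ?_
  rw [inner_conj_symm, inner_add_left, inner_add_right, h1, h2]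

lemma norm_skewedPotential_le (hP : SmoothPerturbation H A (expI H) ε c)
    (hM : ∀ t ∈ Icc 0 T, ‖B t‖ ≤ M) {v : ℝ → E} {t : ℝ} (ht : t ∈ Icc 0 T) :
    ‖skewedPotential H A B v t‖ ≤ ‖applyExt A (expI H (-t) (v t))‖ + M * ‖v t‖ := by
  rw [skewedPotential, hP.group.norm_map]
  refine (norm_add_le _ _).trans (add_le_add_right ?_ _)
  refine ((B t).le_opNorm _).trans ?_
  rw [hP.group.norm_map]
  exact mul_le_mul_of_nonneg_right (hM t ht) (norm_nonneg _)

/-- The real part of the inner product as a bounded real bilinear form. -/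
noncomputable def reInner (E : Type*) [NormedAddCommGroup E] [InnerProductSpace ℂ E] :
    E →L[ℝ] E →L[ℝ] ℝ :=
  (ContinuousLinearMap.compL ℝ E ℂ ℝ Complex.reCLM) ∘L
    (isBoundedBilinearMap_inner (𝕜 := ℂ) (E := E)).toContinuousLinearMap

lemma reInner_apply (x y : E) : reInner E x y = (inner ℂ x y : ℂ).re := rfl

/-- The energy estimate: the symmetric part of the equation does not contribute to the growth of
the norm. -/
lemma norm_primitive_le_of_equation [TopologicalSpace.SeparableSpace E]
    (hP : SmoothPerturbation H A (expI H) ε c) (hT : 0 < T) (hB : IsAdmissibleFamily T B)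
    (σ : ℝ) (x : E) (h : L2 T E) {r : ℝ → E} (hr : IntegrableOn r (Ioo 0 T))
    (heq : ∀ᵐ t ∂(volume.restrict (Ioo 0 T)), Complex.I • h t =
      (σ : ℂ) • skewedPotential H A B (primitive x h) t + r t) {t : ℝ} (ht : t ∈ Icc 0 T) :
    ‖primitive x h t‖ ≤ ‖x‖ + 2 * ∫ s in Ioo 0 T, ‖r s‖ := by
  set w := primitive x h with hw
  have hwc : Continuous w := continuous_primitive x h
  -- At a point `t₀` where `‖w‖` is maximal, one factor `‖w(t₀)‖` can be cancelled.
  obtain ⟨t₀, ht₀, hmax⟩ := isCompact_Icc.exists_isMaxOn ⟨0, ⟨le_rfl, hT.le⟩⟩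
    (hwc.norm.continuousOn (s := Icc 0 T))
  have hm : ∀ s ∈ Icc 0 T, ‖w s‖ ≤ ‖w t₀‖ := fun s hs => hmax hs
  set m := ‖w t₀‖ with hmdef
  have hx : ‖x‖ ≤ m := by
    have := hm 0 ⟨le_rfl, hT.le⟩
    rwa [hw, primitive_zero] at this
  set g : ℝ → E := (Ioo 0 T).indicator h with hg
  have hgi : Integrable g := integrable_indicator_L2 h
  have hae : ∀ᵐ s, s ∈ Ioo 0 T → |(inner ℂ (w s) (g s) : ℂ).re| ≤ m * ‖r s‖ := by
    rw [← ae_restrict_iff' measurableSet_Ioo]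
    filter_upwards [heq, ae_mem_domain_primitive hP hT x h, ae_restrict_mem measurableSet_Ioo]
      with s hs hd hsm
    have him := im_inner_skewedPotential hP hB (Ioo_subset_Icc_self hsm) hd
    rw [← hw] at him
    have e1 : g s = -Complex.I • ((σ : ℂ) • skewedPotential H A B w s + r s) := by
      rw [hg, indicator_of_mem hsm, ← hs, smul_smul, neg_mul, Complex.I_mul_I, neg_neg, one_smul]
    have e2 : (inner ℂ (w s) (g s) : ℂ).re = (inner ℂ (w s) (r s) : ℂ).im := by
      rw [e1, inner_smul_right, inner_add_right, inner_smul_right]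
      simp [him]
    rw [e2]
    refine (Complex.abs_im_le_norm _).trans ((norm_inner_le_norm _ _).trans ?_)
    gcongr
    exact hm s (Ioo_subset_Icc_self hsm)
  have hrI : IntervalIntegrable (fun s => m * ‖r s‖) volume 0 T := by
    rw [intervalIntegrable_iff_integrableOn_Ioo_of_le hT.le]
    exact hr.norm.const_mul m
  have hrI' : IntervalIntegrable (fun s => m * ‖r s‖) volume 0 t₀ :=
    hrI.mono_set (by rw [uIcc_of_le ht₀.1, uIcc_of_le hT.le]; exact Icc_subset_Icc_right ht₀.2)
  have hae' : ∀ᵐ s, s ∈ Ioc 0 t₀ → |(inner ℂ (w s) (g s) : ℂ).re| ≤ m * ‖r s‖ := by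
    have hne : ∀ᵐ s : ℝ, s ≠ T := by simp [ae_iff]
    filter_upwards [hae, hne] with s hs hsT hs'
    exact hs ⟨hs'.1, lt_of_le_of_ne (hs'.2.trans ht₀.2) hsT⟩
  have hle : ∫ s in (0 : ℝ)..t₀, m * ‖r s‖ ≤ m * ∫ s in Ioo 0 T, ‖r s‖ := by
    rw [← integral_const_mul, ← integral_Ioc_eq_integral_Ioo, ← intervalIntegral.integral_of_le
      hT.le]
    exact intervalIntegral.integral_mono_interval le_rfl ht₀.1 ht₀.2
      (Eventually.of_forall fun s => by positivity) hrI
  have key := bilin_primitive (reInner E) ht₀.1 hgi.integrableOn hgi.integrableOn x x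
  change reInner E (w t₀) (w t₀) = reInner E x x +
    ((∫ s in (0 : ℝ)..t₀, reInner E (g s) (w s)) + ∫ s in (0 : ℝ)..t₀, reInner E (w s) (g s)) at key
  have hsymm : ∀ s, reInner E (g s) (w s) = reInner E (w s) (g s) := fun s => by
    rw [reInner_apply, reInner_apply, ← inner_conj_symm, Complex.conj_re]
  have hself : ∀ y : E, reInner E y y = ‖y‖ ^ 2 := fun y => inner_self_eq_norm_sq (𝕜 := ℂ) y
  simp_rw [hsymm, hself] at key
  have hb : ‖∫ s in (0 : ℝ)..t₀, reInner E (w s) (g s)‖ ≤ ∫ s in (0 : ℝ)..t₀, m * ‖r s‖ :=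
    intervalIntegral.norm_integral_le_of_norm_le ht₀.1 hae' hrI'
  have hb2 := (le_abs_self _).trans (hb.trans hle)
  set R := ∫ s in Ioo 0 T, ‖r s‖ with hR
  have hR0 : 0 ≤ R := integral_nonneg fun s => norm_nonneg _
  have hfin : m * m ≤ m * (‖x‖ + 2 * R) := by
    have h1 : ‖x‖ ^ 2 ≤ m * ‖x‖ := by rw [sq]; gcongr
    have h2 : m * m = m ^ 2 := (sq m).symm
    rw [h2, hmdef, key]
    rw [← hmdef]
    linarith
  refine (hm t ht).trans ?_
  rcases (norm_nonneg (w t₀)).eq_or_lt with h0 | h0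
  · rw [hmdef, ← h0]; positivity
  · exact le_of_mul_le_mul_left hfin h0

end Potential

/-! ### A priori estimates -/

section Apriori

variable {E : Type*} [NormedAddCommGroup E] [InnerProductSpace ℂ E] [CompleteSpace E]
  [TopologicalSpace.SeparableSpace E]
  {H A : E →ₗ.[ℂ] E} {ε c : ℝ}

/-- The smoothing estimate on `(0, T)`, summed over `N` slices of length `T / N ≤ 1`: with the
initial values of the slices bounded by `m`, the constant does not depend on `T`. -/
lemma exists_smoothing_slices (hP : SmoothPerturbation H A (expI H) ε c) :
    ∃ κ : ℝ, 0 ≤ κ ∧ ∀ T : ℝ, 0 < T → ∀ N : ℕ, 0 < N → T / N ≤ 1 → ∀ (x : E) (h : L2 T E) (m : ℝ),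
      (∀ t ∈ Icc 0 T, ‖primitive x h t‖ ≤ m) →
      ∫ t in Ioo 0 T, ‖applyExt A (expI H (-t) (primitive x h t))‖ ^ 2 ≤
        κ * (N * m ^ 2 + T / N * ‖h‖ ^ 2) := by
  obtain ⟨κ, hκ0, hκ⟩ := exists_smoothing_H1 hP 1 zero_le_one
  refine ⟨κ, hκ0, fun T hT N hN hτ x h m hm => ?_⟩
  have hN' : (0 : ℝ) < N := by exact_mod_cast hN
  set τ : ℝ := T / N with hτdef
  have hτ0 : 0 < τ := div_pos hT hN'
  have hNτ : N * τ = T := by rw [hτdef]; field_simp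
  set f : ℝ → ℝ := fun t => ‖applyExt A (expI H (-t) (primitive x h t))‖ ^ 2 with hf
  set g : ℝ → ℝ := fun t => ‖(Ioo 0 T).indicator h t‖ ^ 2 with hg
  let p : ℕ → ℝ := fun k => k * τ
  have hp1 : ∀ k, p (k + 1) = p k + τ := fun k => by simp only [p]; push_cast; ring
  have hsl : ∀ k, p k ≤ p (k + 1) ∧ p (k + 1) ≤ p k + 1 := fun k => by
    rw [hp1]; constructor <;> linarith
  have hfi : ∀ k, IntervalIntegrable f volume (p k) (p (k + 1)) := fun k => by
    rw [intervalIntegrable_iff_integrableOn_Ioc_of_le (hsl k).1]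
    exact (hκ T _ _ (hsl k).1 (hsl k).2 x h).2.1.integrable_norm_pow (by norm_num)
  have hgi : ∀ k, IntervalIntegrable g volume (p k) (p (k + 1)) := fun k =>
    (integrable_norm_sq_indicator h).intervalIntegrable
  have hsum1 := intervalIntegral.sum_integral_adjacent_intervals (n := N) (fun k _ => hfi k)
  have hsum2 := intervalIntegral.sum_integral_adjacent_intervals (n := N) (fun k _ => hgi k)
  have hp0 : p 0 = 0 := by simp [p]
  have hpN : p N = T := hNτ
  rw [hp0, hpN] at hsum1 hsum2
  rw [← integral_Ioc_eq_integral_Ioo, ← intervalIntegral.integral_of_le hT.le,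
    norm_sq_L2_eq_intervalIntegral hT.le]
  change ∫ t in (0 : ℝ)..T, f t ≤ κ * (N * m ^ 2 + τ * ∫ t in (0 : ℝ)..T, g t)
  rw [← hsum1, ← hsum2]
  calc ∑ k ∈ Finset.range N, ∫ t in p k..p (k + 1), f t
      ≤ ∑ k ∈ Finset.range N, κ * (m ^ 2 + τ * ∫ t in p k..p (k + 1), g t) := by
        refine Finset.sum_le_sum fun k hk => ?_
        refine (hκ T _ _ (hsl k).1 (hsl k).2 x h).2.2.trans ?_
        have hk' : (k : ℝ) ≤ N := by exact_mod_cast (Finset.mem_range.mp hk).le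
        have hpk : p k ∈ Icc 0 T := ⟨by positivity, by
          rw [← hNτ]; exact mul_le_mul_of_nonneg_right hk' hτ0.le⟩
        have e : p (k + 1) - p k = τ := by rw [hp1]; ring
        rw [e]
        gcongr
        exact hm _ hpk
    _ = _ := by
        rw [← Finset.mul_sum, Finset.sum_add_distrib, ← Finset.mul_sum, Finset.sum_const,
          Finset.card_range, nsmul_eq_mul]

lemma exists_slices {T τ : ℝ} (hT : 0 < T) (hτ : 0 < τ) :
    ∃ N : ℕ, 0 < N ∧ T / N ≤ τ ∧ (N : ℝ) ≤ T / τ + 1 := by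
  have h1 : 0 < ⌈T / τ⌉₊ := Nat.ceil_pos.mpr (div_pos hT hτ)
  have h2 : (0 : ℝ) < ⌈T / τ⌉₊ := by exact_mod_cast h1
  refine ⟨⌈T / τ⌉₊, h1, ?_, (Nat.ceil_lt_add_one (div_pos hT hτ).le).le⟩
  rw [div_le_iff₀ h2, mul_comm, ← div_le_iff₀ hτ]
  exact Nat.le_ceil _

lemma sq_setIntegral_norm_le {T : ℝ} (hT : 0 < T) {r : ℝ → E}
    (hr : MemLp r 2 (volume.restrict (Ioo 0 T))) :
    (∫ t in Ioo 0 T, ‖r t‖) ^ 2 ≤ T * ∫ t in Ioo 0 T, ‖r t‖ ^ 2 := by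
  have h1 := sq_lintegral_le hr.1.enorm
  rw [Measure.restrict_apply_univ, Real.volume_Ioo, sub_zero] at h1
  have hfin : ∫⁻ t in Ioo 0 T, ‖r t‖ₑ ^ 2 < ⊤ := (memLp_two_iff_lintegral hr.1).mp hr
  have h2 := ENNReal.toReal_mono (ENNReal.mul_lt_top ENNReal.ofReal_lt_top hfin).ne h1
  rw [ENNReal.toReal_pow, ENNReal.toReal_mul, ENNReal.toReal_ofReal hT.le,
    ← integral_norm_eq_lintegral_enorm hr.1, ← integral_norm_sq_eq_toReal hr.1] at h2
  exact h2

lemma integral_norm_indicator_sq_le {T : ℝ} (hT : 0 < T) (h : L2 T E) :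
    (∫ s, ‖(Ioo 0 T).indicator h s‖) ^ 2 ≤ T * ‖h‖ ^ 2 := by
  rw [norm_sq_L2]
  refine le_of_eq_of_le ?_ (sq_setIntegral_norm_le hT (Lp.memLp h))
  congr 1
  simp_rw [norm_indicator_eq_indicator_norm]
  exact integral_indicator measurableSet_Ioo

/-- The potential in the rotating frame is bounded from `H¹` to `L²`, with a constant that grows
linearly in `T`. -/
theorem exists_potential_bound (hP : SmoothPerturbation H A (expI H) ε c) (M : ℝ) :
    ∃ C : ℝ, 0 < C ∧ ∀ T : ℝ, 0 < T → ∀ B : ℝ → E →L[ℂ] E, IsAdmissibleFamily T B →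
      (∀ t ∈ Icc 0 T, ‖B t‖ ≤ M) → ∀ (x : E) (h : L2 T E),
      T * ∫ t in Ioo 0 T, ‖skewedPotential H A B (primitive x h) t‖ ^ 2 ≤
        C * (1 + T) ^ 2 * (‖x‖ ^ 2 + T * ‖h‖ ^ 2) := by
  obtain ⟨κ, hκ0, hκ⟩ := exists_smoothing_slices hP
  refine ⟨4 * κ + 2 * κ + 4 * M ^ 2 + 1, by positivity, fun T hT B hB hM x h => ?_⟩
  obtain ⟨N, hN, hN1, hN2⟩ := exists_slices hT one_pos
  rw [div_one] at hN2
  set J := ∫ s, ‖(Ioo 0 T).indicator h s‖ with hJ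
  set X := ‖h‖ ^ 2 with hX
  set D := ‖x‖ ^ 2 + T * X with hD
  have hX0 : 0 ≤ X := sq_nonneg _
  have hD0 : 0 ≤ D := by positivity
  have hm : ∀ t ∈ Icc 0 T, ‖primitive x h t‖ ≤ ‖x‖ + J := fun t _ => norm_primitive_le x h t
  have hm2 : (‖x‖ + J) ^ 2 ≤ 2 * D := by
    have := integral_norm_indicator_sq_le hT h
    have h2 := add_sq_le (a := ‖x‖) (b := J)
    rw [hD]; linarith
  have hs := hκ T hT N hN hN1 x h _ hm
  set m := ‖x‖ + J with hmdef
  have hM2 : 0 ≤ M := (norm_nonneg _).trans (hM 0 ⟨le_rfl, hT.le⟩)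
  have ha := memLp_applyExt_primitive hP hT x h
  have hai : Integrable (fun t => ‖applyExt A (expI H (-t) (primitive x h t))‖ ^ 2)
      (volume.restrict (Ioo 0 T)) := ha.integrable_norm_pow (by norm_num)
  set a2 := ∫ t in Ioo 0 T, ‖applyExt A (expI H (-t) (primitive x h t))‖ ^ 2 with ha2
  have h1 : ∫ t in Ioo 0 T, ‖skewedPotential H A B (primitive x h) t‖ ^ 2 ≤
      2 * a2 + 2 * (M * m) ^ 2 * T := by
    calc _ ≤ ∫ t in Ioo 0 T, (2 * ‖applyExt A (expI H (-t) (primitive x h t))‖ ^ 2 +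
          2 * (M * m) ^ 2) := by
          refine integral_mono_ae ((memLp_skewedPotential hP hT hB hM x h).integrable_norm_pow
            (by norm_num)) ((hai.const_mul 2).add (integrable_const _)) ?_
          filter_upwards [ae_restrict_mem measurableSet_Ioo] with t ht
          have ht' := Ioo_subset_Icc_self ht
          have h2 := norm_skewedPotential_le hP hM (v := primitive x h) ht'
          have h3 : M * ‖primitive x h t‖ ≤ M * m := mul_le_mul_of_nonneg_left (hm t ht') hM2
          have h4 := add_sq_le (a := ‖applyExt A (expI H (-t) (primitive x h t))‖) (b := M * m)
          calc _ ≤ (‖applyExt A (expI H (-t) (primitive x h t))‖ + M * m) ^ 2 :=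
                pow_le_pow_left₀ (norm_nonneg _) (h2.trans (by linarith)) 2
            _ ≤ _ := by linarith
      _ = _ := by
          rw [integral_add (hai.const_mul 2) (integrable_const _), integral_const_mul,
            integral_const]
          simp [hT.le]; ring
  have h2 : a2 ≤ κ * ((T + 1) * (2 * D) + X) := by
    refine hs.trans (mul_le_mul_of_nonneg_left (add_le_add ?_ ?_) hκ0)
    · exact mul_le_mul hN2 hm2 (sq_nonneg _) (by positivity)
    · exact mul_le_of_le_one_left hX0 hN1
  have h3 : (M * m) ^ 2 ≤ M ^ 2 * (2 * D) := by rw [mul_pow]; gcongr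
  have hTX : T * X ≤ D := by rw [hD]; linarith [sq_nonneg ‖x‖]
  calc _ ≤ T * (2 * (κ * ((T + 1) * (2 * D) + X)) + 2 * (M ^ 2 * (2 * D)) * T) := by
        refine mul_le_mul_of_nonneg_left ?_ hT.le
        linarith [mul_le_mul_of_nonneg_right h3 hT.le]
    _ ≤ _ := by
        have hq1 : D ≤ (1 + T) ^ 2 * D := le_mul_of_one_le_left hD0 (by nlinarith)
        have hq2 : T * (T + 1) * D ≤ (1 + T) ^ 2 * D :=
          mul_le_mul_of_nonneg_right (by nlinarith) hD0
        have hq3 : T ^ 2 * D ≤ (1 + T) ^ 2 * D := mul_le_mul_of_nonneg_right (by nlinarith) hD0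
        linarith [mul_le_mul_of_nonneg_left hq2 hκ0,
          mul_le_mul_of_nonneg_left (hTX.trans hq1) hκ0,
          mul_le_mul_of_nonneg_left hq3 (sq_nonneg M), hD0.trans hq1]

/-- The equation bounds `h` by the two parts of the potential and the right-hand side. -/
lemma norm_sq_le_of_equation (hP : SmoothPerturbation H A (expI H) ε c) {T M : ℝ} (hT : 0 < T)
    {B : ℝ → E →L[ℂ] E} (hM : ∀ t ∈ Icc 0 T, ‖B t‖ ≤ M) {σ : ℝ} (hσ : σ ∈ Icc (0 : ℝ) 1)
    {w : ℝ → E} {h : L2 T E} {r : ℝ → E} (hr : MemLp r 2 (volume.restrict (Ioo 0 T)))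
    (heq : ∀ᵐ t ∂(volume.restrict (Ioo 0 T)), Complex.I • h t =
        (σ : ℂ) • skewedPotential H A B w t + r t) {m : ℝ} (hm : ∀ t ∈ Icc 0 T, ‖w t‖ ≤ m)
    (ha : MemLp (fun t => applyExt A (expI H (-t) (w t))) 2 (volume.restrict (Ioo 0 T))) :
    ‖h‖ ^ 2 ≤ 3 * (∫ t in Ioo 0 T, ‖applyExt A (expI H (-t) (w t))‖ ^ 2) +
      3 * (∫ t in Ioo 0 T, ‖r t‖ ^ 2) + 3 * (M * m) ^ 2 * T := by
  have hM2 : 0 ≤ M := (norm_nonneg _).trans (hM 0 ⟨le_rfl, hT.le⟩)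
  have hai : Integrable (fun t => ‖applyExt A (expI H (-t) (w t))‖ ^ 2)
      (volume.restrict (Ioo 0 T)) := ha.integrable_norm_pow (by norm_num)
  have hri : Integrable (fun t => ‖r t‖ ^ 2) (volume.restrict (Ioo 0 T)) :=
    hr.integrable_norm_pow (by norm_num)
  have hsum : Integrable (fun t => 3 * ‖applyExt A (expI H (-t) (w t))‖ ^ 2 + 3 * ‖r t‖ ^ 2)
      (volume.restrict (Ioo 0 T)) := (hai.const_mul 3).add (hri.const_mul 3)
  rw [norm_sq_L2]
  calc _ ≤ ∫ t in Ioo 0 T, (3 * ‖applyExt A (expI H (-t) (w t))‖ ^ 2 +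
      3 * ‖r t‖ ^ 2 + 3 * (M * m) ^ 2) := by
        refine integral_mono_ae ((Lp.memLp h).integrable_norm_pow (by norm_num))
          (hsum.add (integrable_const _)) ?_
        filter_upwards [heq, ae_restrict_mem measurableSet_Ioo] with t he ht
        have ht' := Ioo_subset_Icc_self ht
        have h2 := norm_skewedPotential_le hP hM (v := w) ht'
        have h3 : M * ‖w t‖ ≤ M * m := mul_le_mul_of_nonneg_left (hm t ht') hM2
        have h4 : ‖h t‖ ≤ ‖applyExt A (expI H (-t) (w t))‖ + M * m + ‖r t‖ := by
          calc ‖h t‖ = ‖Complex.I • h t‖ := by rw [norm_smul, Complex.norm_I, one_mul]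
            _ ≤ ‖(σ : ℂ) • skewedPotential H A B w t‖ + ‖r t‖ := by
                rw [he]; exact norm_add_le _ _
            _ ≤ _ := by
                refine add_le_add_left ?_ _
                rw [norm_smul, Complex.norm_real, Real.norm_eq_abs, abs_of_nonneg hσ.1]
                exact (mul_le_of_le_one_left (norm_nonneg _) hσ.2).trans (h2.trans (by linarith))
        refine (pow_le_pow_left₀ (norm_nonneg _) h4 2).trans ?_
        generalize ‖applyExt A (expI H (-t) (w t))‖ = p
        nlinarith [sq_nonneg (p - M * m), sq_nonneg (p - ‖r t‖), sq_nonneg (M * m - ‖r t‖)]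
    _ = _ := by
        rw [integral_add hsum (integrable_const _),
          integral_add (hai.const_mul 3) (hri.const_mul 3), integral_const_mul,
          integral_const_mul, integral_const]
        simp [hT.le]; ring

/-- The a priori estimate, uniform in the coupling constant `σ ∈ [0, 1]`: a solution of
`i h = σ V w + r`, `w(t) = x + ∫₀ᵗ h`, is bounded in `H¹` by the data `x` and `r`, with a constant
that grows linearly in `T`. The energy estimate bounds `w` uniformly, and on slices so short that
the smoothing estimate gains a small factor, the potential is absorbed. -/
theorem exists_apriori_bound (hP : SmoothPerturbation H A (expI H) ε c) (M : ℝ) :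
    ∃ C : ℝ, 0 < C ∧ ∀ T : ℝ, 0 < T → ∀ B : ℝ → E →L[ℂ] E, IsAdmissibleFamily T B →
      (∀ t ∈ Icc 0 T, ‖B t‖ ≤ M) → ∀ σ ∈ Icc (0 : ℝ) 1, ∀ (x : E) (h : L2 T E) (r : ℝ → E),
      MemLp r 2 (volume.restrict (Ioo 0 T)) →
      (∀ᵐ t ∂(volume.restrict (Ioo 0 T)), Complex.I • h t =
        (σ : ℂ) • skewedPotential H A B (primitive x h) t + r t) →
      T * ‖h‖ ^ 2 ≤ C * (1 + T) ^ 2 * (‖x‖ ^ 2 + T * ∫ t in Ioo 0 T, ‖r t‖ ^ 2) := by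
  obtain ⟨κ, hκ0, hκ⟩ := exists_smoothing_slices hP
  -- On slices of this length the smoothing estimate returns at most half of `‖h‖²`.
  set τ : ℝ := 1 / (6 * κ + 1) with hτ
  have hτ0 : 0 < τ := by positivity
  have hτ1 : τ ≤ 1 := by
    rw [hτ, div_le_one (by positivity)]; linarith
  have hτκ : 6 * κ * τ ≤ 1 := by
    rw [hτ, mul_one_div, div_le_one (by positivity)]; linarith
  refine ⟨48 * (κ / τ + κ + M ^ 2) + 6, by positivity, fun T hT B hB hM σ hσ x h r hr heq => ?_⟩
  obtain ⟨N, hN, hN1, hN2⟩ := exists_slices hT hτ0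
  set R := ∫ t in Ioo 0 T, ‖r t‖ ^ 2 with hR
  have hR0 : 0 ≤ R := integral_nonneg fun _ => sq_nonneg _
  set J := ∫ s in Ioo 0 T, ‖r s‖ with hJ
  set D := ‖x‖ ^ 2 + T * R with hD
  have hD0 : 0 ≤ D := by positivity
  have hm : ∀ t ∈ Icc 0 T, ‖primitive x h t‖ ≤ ‖x‖ + 2 * J := fun t ht =>
    norm_primitive_le_of_equation hP hT hB σ x h (hr.integrable one_le_two) heq ht
  have hm2 : (‖x‖ + 2 * J) ^ 2 ≤ 8 * D := by
    have := sq_setIntegral_norm_le hT hr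
    have h2 := add_sq_le (a := ‖x‖) (b := 2 * J)
    rw [mul_pow] at h2
    rw [hD]; nlinarith [sq_nonneg ‖x‖]
  have hs := hκ T hT N hN (hN1.trans hτ1) x h _ hm
  set m := ‖x‖ + 2 * J with hmdef
  have hM2 : 0 ≤ M := (norm_nonneg _).trans (hM 0 ⟨le_rfl, hT.le⟩)
  have ha := memLp_applyExt_primitive hP hT x h
  have hai : Integrable (fun t => ‖applyExt A (expI H (-t) (primitive x h t))‖ ^ 2)
      (volume.restrict (Ioo 0 T)) := ha.integrable_norm_pow (by norm_num)
  have hri : Integrable (fun t => ‖r t‖ ^ 2) (volume.restrict (Ioo 0 T)) :=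
    hr.integrable_norm_pow (by norm_num)
  set a2 := ∫ t in Ioo 0 T, ‖applyExt A (expI H (-t) (primitive x h t))‖ ^ 2 with ha2
  set X := ‖h‖ ^ 2 with hX
  have hX0 : 0 ≤ X := sq_nonneg _
  have h1 : X ≤ 3 * a2 + 3 * R + 3 * (M * m) ^ 2 * T :=
    norm_sq_le_of_equation hP hT hM hσ hr heq hm ha
  have h2 : a2 ≤ κ * ((T / τ + 1) * (8 * D) + τ * X) := by
    refine hs.trans (mul_le_mul_of_nonneg_left (add_le_add ?_ ?_) hκ0)
    · exact mul_le_mul hN2 hm2 (sq_nonneg _) (by positivity)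
    · exact mul_le_mul_of_nonneg_right hN1 hX0
  have h3 : (M * m) ^ 2 ≤ M ^ 2 * (8 * D) := by rw [mul_pow]; gcongr
  have h4 : 6 * κ * τ * X ≤ X := mul_le_of_le_one_left hX0 hτκ
  have h5 : X ≤ 6 * κ * ((T / τ + 1) * (8 * D)) + 6 * R + 6 * (M ^ 2 * (8 * D)) * T := by
    linarith [mul_le_mul_of_nonneg_right h3 hT.le]
  have hTR : T * R ≤ D := by rw [hD]; linarith [sq_nonneg ‖x‖]
  have hκτ : 0 ≤ κ / τ := by positivity
  have e : κ * (T / τ) = κ / τ * T := by ring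
  calc T * X ≤ T * (6 * κ * ((T / τ + 1) * (8 * D)) + 6 * R + 6 * (M ^ 2 * (8 * D)) * T) :=
        mul_le_mul_of_nonneg_left h5 hT.le
    _ = 48 * (T * D) * (κ * (T / τ)) + 48 * κ * (T * D) + 6 * (T * R) +
          48 * M ^ 2 * (T ^ 2 * D) := by ring
    _ ≤ _ := by
        have hq1 : D ≤ (1 + T) ^ 2 * D := le_mul_of_one_le_left hD0 (by nlinarith)
        have hq2 : T * D ≤ (1 + T) ^ 2 * D := mul_le_mul_of_nonneg_right (by nlinarith) hD0
        have hq3 : T ^ 2 * D ≤ (1 + T) ^ 2 * D := mul_le_mul_of_nonneg_right (by nlinarith) hD0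
        rw [e]
        linarith [mul_le_mul_of_nonneg_left hq2 hκ0, hTR.trans hq1,
          mul_le_mul_of_nonneg_left hq3 (sq_nonneg M), mul_le_mul_of_nonneg_left hq3 hκτ]

end Apriori

/-! ### Existence of solutions in the rotating frame -/

section Continuity

variable {F : Type*} [NormedAddCommGroup F] [NormedSpace ℂ F] [CompleteSpace F]

/-- The method of continuity: if `1 + σ Φ` is bounded below uniformly in `σ ∈ [0, 1]`, then
`1 + Φ` is invertible, since invertibility propagates over steps of a fixed length. -/
lemma isUnit_one_add_of_bounded_below (Φ : F →L[ℂ] F) {C : ℝ} (hC : 0 ≤ C)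
    (hb : ∀ σ ∈ Icc (0 : ℝ) 1, ∀ x, ‖x‖ ≤ C * ‖x + (σ : ℂ) • Φ x‖) : IsUnit (1 + Φ) := by
  obtain ⟨n, hn⟩ := exists_nat_gt (C * ‖Φ‖)
  have hn0 : (0 : ℝ) < n := lt_of_le_of_lt (by positivity) hn
  have key : ∀ k : ℕ, k ≤ n → IsUnit (1 + ((k / n : ℝ) : ℂ) • Φ) := by
    intro k
    induction k with
    | zero => intro _; simp
    | succ k ih =>
      intro hk
      obtain ⟨u, hu⟩ := ih (by omega)
      set σ : ℝ := k / n with hσ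
      have hσ1 : σ ∈ Icc (0 : ℝ) 1 :=
        ⟨by positivity, (div_le_one hn0).mpr (by exact_mod_cast (by omega : k ≤ n))⟩
      have huinv : ‖(↑u⁻¹ : F →L[ℂ] F)‖ ≤ C := by
        refine ContinuousLinearMap.opNorm_le_bound _ hC fun y => ?_
        have h1 := hb σ hσ1 ((↑u⁻¹ : F →L[ℂ] F) y)
        have h2 : (↑u⁻¹ : F →L[ℂ] F) y + (σ : ℂ) • Φ ((↑u⁻¹ : F →L[ℂ] F) y) = y := by
          have h3 := congrArg (fun S : F →L[ℂ] F => S y) u.mul_inv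
          rw [hu] at h3
          exact h3
        rwa [h2] at h1
      set S : F →L[ℂ] F := -((((1 / n : ℝ) : ℂ)) • ((↑u⁻¹ : F →L[ℂ] F) * Φ)) with hS
      have hSn : ‖S‖ < 1 := by
        rw [hS, norm_neg, norm_smul, Complex.norm_real, Real.norm_eq_abs,
          abs_of_pos (by positivity),
          one_div_mul_eq_div, div_lt_one hn0]
        exact ((norm_mul_le _ _).trans (by gcongr)).trans_lt hn
      have e : 1 + (((k + 1 : ℕ) / n : ℝ) : ℂ) • Φ = u * (1 - S) := by
        rw [hS, sub_neg_eq_add, mul_add, mul_one, mul_smul_comm, ← mul_assoc, u.mul_inv, one_mul,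
          hu, add_assoc, ← add_smul, hσ]
        congr 2
        push_cast
        ring
      rw [e]
      exact u.isUnit.mul (isUnit_one_sub_of_norm_lt_one hSn)
  have := key n le_rfl
  rwa [div_self hn0.ne', Complex.ofReal_one, one_smul] at this

end Continuity

section Existence

variable {E : Type*} [NormedAddCommGroup E] [InnerProductSpace ℂ E] [CompleteSpace E]
  [TopologicalSpace.SeparableSpace E]
  {H A : E →ₗ.[ℂ] E} {ε c T M : ℝ} {B : ℝ → E →L[ℂ] E}

lemma primitive_add (x y : E) (h k : L2 T E) (t : ℝ) :
    primitive (x + y) (h + k) t = primitive x h t + primitive y k t := by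
  have e : ∫ s in (0 : ℝ)..t, (Ioo 0 T).indicator (h + k : L2 T E) s =
      (∫ s in (0 : ℝ)..t, (Ioo 0 T).indicator h s) +
        ∫ s in (0 : ℝ)..t, (Ioo 0 T).indicator k s := by
    rw [← intervalIntegral.integral_add (integrable_indicator_L2 h).intervalIntegrable
      (integrable_indicator_L2 k).intervalIntegrable]
    refine intervalIntegral.integral_congr_ae ?_
    filter_upwards [(ae_restrict_iff' measurableSet_Ioo).mp (Lp.coeFn_add h k)] with s hs _
    by_cases hsm : s ∈ Ioo 0 T
    · simp only [indicator_of_mem hsm]; exact hs hsm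
    · simp only [indicator_of_notMem hsm, add_zero]
  rw [primitive, primitive, primitive, e]
  abel

lemma primitive_smul (a : ℂ) (x : E) (h : L2 T E) (t : ℝ) :
    primitive (a • x) (a • h) t = a • primitive x h t := by
  have e : ∫ s in (0 : ℝ)..t, (Ioo 0 T).indicator (a • h : L2 T E) s =
      a • ∫ s in (0 : ℝ)..t, (Ioo 0 T).indicator h s := by
    rw [← intervalIntegral.integral_smul]
    refine intervalIntegral.integral_congr_ae ?_
    filter_upwards [(ae_restrict_iff' measurableSet_Ioo).mp (Lp.coeFn_smul a h)] with s hs _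
    by_cases hsm : s ∈ Ioo 0 T
    · simp only [indicator_of_mem hsm]; exact hs hsm
    · simp only [indicator_of_notMem hsm, smul_zero]
  rw [primitive, primitive, e, smul_add]

lemma primitive_right_zero (x : E) : primitive x (0 : L2 T E) = fun _ => x := by
  ext t
  have h := primitive_smul (0 : ℂ) (0 : E) (0 : L2 T E) t
  simp only [smul_zero, zero_smul] at h
  rw [primitive, zero_add] at h
  rw [primitive, h, add_zero]

/-- The linear map `(x, h) ↦ e^{itH₀} (A + B(t)) e^{-itH₀} (x + ∫₀ᵗ h)` with values in
`L²(I, E)`. -/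
noncomputable def potentialₗ (hP : SmoothPerturbation H A (expI H) ε c) (hT : 0 < T)
    (hB : IsAdmissibleFamily T B) (hM : ∀ t ∈ Icc 0 T, ‖B t‖ ≤ M) : E × L2 T E →ₗ[ℂ] L2 T E where
  toFun p := (memLp_skewedPotential hP hT hB hM p.1 p.2).toLp
  map_add' p q := by
    rw [← MemLp.toLp_add]
    refine MemLp.toLp_congr _ _ ?_
    filter_upwards [ae_mem_domain_primitive hP hT p.1 p.2, ae_mem_domain_primitive hP hT q.1 q.2]
      with t h1 h2
    simp only [Pi.add_apply, skewedPotential, Prod.fst_add, Prod.snd_add, primitive_add, map_add,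
      applyExt_add h1 h2]
    abel
  map_smul' a p := by
    rw [RingHom.id_apply, ← MemLp.toLp_const_smul]
    refine MemLp.toLp_congr _ _ ?_
    filter_upwards [ae_mem_domain_primitive hP hT p.1 p.2] with t h1
    simp only [Pi.smul_apply, skewedPotential, Prod.smul_fst, Prod.smul_snd, primitive_smul,
      map_smul, applyExt_smul a h1, map_add, smul_add]

lemma potentialₗ_ae_eq (hP : SmoothPerturbation H A (expI H) ε c) (hT : 0 < T)
    (hB : IsAdmissibleFamily T B) (hM : ∀ t ∈ Icc 0 T, ‖B t‖ ≤ M) (p : E × L2 T E) :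
    potentialₗ hP hT hB hM p =ᵐ[volume.restrict (Ioo (0 : ℝ) T)]
      skewedPotential H A B (primitive p.1 p.2) :=
  MemLp.coeFn_toLp (memLp_skewedPotential hP hT hB hM p.1 p.2)

lemma norm_sq_potentialₗ (hP : SmoothPerturbation H A (expI H) ε c) (hT : 0 < T)
    (hB : IsAdmissibleFamily T B) (hM : ∀ t ∈ Icc 0 T, ‖B t‖ ≤ M) (p : E × L2 T E) :
    ‖potentialₗ hP hT hB hM p‖ ^ 2 =
      ∫ t in Ioo 0 T, ‖skewedPotential H A B (primitive p.1 p.2) t‖ ^ 2 := by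
  rw [norm_sq_L2]
  refine integral_congr_ae ?_
  filter_upwards [potentialₗ_ae_eq hP hT hB hM p] with t ht
  rw [ht]

/-- The equation `i h = V (x + ∫₀ᵗ h) + g` is solvable for all `x` and `g`. -/
theorem exists_solution (hP : SmoothPerturbation H A (expI H) ε c) (hT : 0 < T)
    (hB : IsAdmissibleFamily T B) (hM : ∀ t ∈ Icc 0 T, ‖B t‖ ≤ M) (x : E) (g : L2 T E) :
    ∃ h : L2 T E, Complex.I • h = potentialₗ hP hT hB hM (x, h) + g := by
  set V := potentialₗ hP hT hB hM with hV
  obtain ⟨C₁, hC₁, hb₁⟩ := exists_potential_bound hP M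
  obtain ⟨C₂, hC₂, hb₂⟩ := exists_apriori_bound hP M
  have hbd : ∀ h : L2 T E, ‖V (0, h)‖ ≤ Real.sqrt (C₁ * (1 + T) ^ 2) * ‖h‖ := fun h => by
    have h1 := hb₁ T hT B hB hM 0 h
    rw [norm_zero, ← norm_sq_potentialₗ hP hT hB hM (0, h)] at h1
    refine le_of_sq_le_sq ?_ (by positivity)
    rw [mul_pow, Real.sq_sqrt (by positivity)]
    refine le_of_mul_le_mul_left (h1.trans (le_of_eq ?_)) hT
    ring
  let Φ : L2 T E →L[ℂ] L2 T E :=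
    LinearMap.mkContinuous (Complex.I • (V ∘ₗ LinearMap.inr ℂ E (L2 T E)))
      (Real.sqrt (C₁ * (1 + T) ^ 2)) fun h => by
        rw [LinearMap.smul_apply, norm_smul, Complex.norm_I, one_mul]; exact hbd h
  have hΦ : ∀ h, Φ h = Complex.I • V (0, h) := fun _ => rfl
  have hunit : IsUnit (1 + Φ) := by
    refine isUnit_one_add_of_bounded_below Φ (C := Real.sqrt (C₂ * (1 + T) ^ 2))
      (Real.sqrt_nonneg _) fun σ hσ h => ?_
    set s := h + (σ : ℂ) • Φ h with hs
    have h1 := hb₂ T hT B hB hM σ hσ 0 h (fun t => Complex.I • s t) ((Lp.memLp s).const_smul _) ?_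
    · simp only [norm_zero, norm_smul, Complex.norm_I, one_mul] at h1
      rw [← norm_sq_L2] at h1
      refine le_of_sq_le_sq ?_ (by positivity)
      rw [mul_pow, Real.sq_sqrt (by positivity)]
      refine le_of_mul_le_mul_left (h1.trans (le_of_eq ?_)) hT
      ring
    · have e : Complex.I • s = Complex.I • h - (σ : ℂ) • V (0, h) := by
        rw [hs, hΦ, smul_add, smul_comm Complex.I (σ : ℂ), smul_smul Complex.I, Complex.I_mul_I,
          neg_one_smul,
          smul_neg, sub_eq_add_neg]
      have e2 : Complex.I • h = (σ : ℂ) • V (0, h) + Complex.I • s := by rw [e]; abel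
      have e3 := Lp.coeFn_smul Complex.I h
      rw [e2] at e3
      filter_upwards [e3, Lp.coeFn_add ((σ : ℂ) • V (0, h)) (Complex.I • s),
        Lp.coeFn_smul (σ : ℂ) (V (0, h)), Lp.coeFn_smul Complex.I s,
        potentialₗ_ae_eq hP hT hB hM (0, h)] with t t1 t2 t3 t4 t5
      rw [Pi.smul_apply] at t1 t3 t4
      rw [← t1, t2, Pi.add_apply, t3, t4, t5]
  -- Multiplied by `-i` and split by linearity, the equation is `(1 + Φ) h = -i (V (x, 0) + g)`.
  obtain ⟨u, hu⟩ := hunit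
  refine ⟨(↑u⁻¹ : L2 T E →L[ℂ] L2 T E) (-Complex.I • (V (x, 0) + g)), ?_⟩
  set h := (↑u⁻¹ : L2 T E →L[ℂ] L2 T E) (-Complex.I • (V (x, 0) + g)) with hh
  have h3 := congrArg (fun S : L2 T E →L[ℂ] L2 T E => S (-Complex.I • (V (x, 0) + g))) u.mul_inv
  rw [hu] at h3
  have h4 : h + Complex.I • V (0, h) = -Complex.I • (V (x, 0) + g) := h3
  have h5 : V (x, h) = V (x, 0) + V (0, h) := by
    rw [← map_add, Prod.mk_add_mk, add_zero, zero_add]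
  have h6 := congrArg (fun y => Complex.I • y) h4
  simp only [smul_add, smul_smul, mul_neg, Complex.I_mul_I, neg_neg, one_smul] at h6
  rw [h5, add_right_comm, ← h6]
  module

end Existence

/-! ### Solutions in the rotating frame are weak solutions -/

section Weak

variable {E : Type*} [NormedAddCommGroup E] [InnerProductSpace ℂ E]

lemma integrable_inner_of_memLp {α : Type*} [MeasurableSpace α] {μ : Measure α} {f g : α → E}
    (hf : MemLp f 2 μ) (hg : MemLp g 2 μ) : Integrable (fun t => (inner ℂ (f t) (g t) : ℂ)) μ := by
  refine (hf.norm.integrable_mul hg.norm).mono (hf.1.inner hg.1) (Eventually.of_forall fun t => ?_)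
  simp only [Pi.mul_apply, norm_mul, norm_norm]
  exact norm_inner_le_norm _ _

/-- The inner product as a bounded real bilinear form with complex values. -/
noncomputable def innerBilin (E : Type*) [NormedAddCommGroup E] [InnerProductSpace ℂ E] :
    E →L[ℝ] E →L[ℝ] ℂ :=
  (isBoundedBilinearMap_inner (𝕜 := ℂ) (E := E)).toContinuousLinearMap

lemma innerBilin_apply (x y : E) : innerBilin E x y = inner ℂ x y := rfl

variable {H A : E →ₗ.[ℂ] E} {ε c : ℝ}

lemma applyExt_sub {x y : E} (hx : x ∈ A.domain) (hy : y ∈ A.domain) :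
    applyExt A (x - y) = applyExt A x - applyExt A y :=
  applyExt_of_graph (A.graph.sub_mem (mem_graph_applyExt hx) (mem_graph_applyExt hy))

/-- A continuous curve in the graph of `H` is mapped by `A` to a continuous curve. -/
lemma RelBound.continuous_applyExt (hA : RelBound H A ε c) {x y : ℝ → E} (hx : Continuous x)
    (hy : Continuous y) (h : ∀ t, (x t, y t) ∈ H.graph) :
    Continuous fun t => applyExt A (x t) := by
  rw [continuous_iff_continuousAt]
  intro s
  rw [ContinuousAt, tendsto_iff_norm_sub_tendsto_zero]
  have hc : Continuous fun t => c * ‖(y t - y s) - (((0 : ℝ) : ℂ) + ε * Complex.I) • (x t - x s)‖ :=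
    by fun_prop
  have h0 := hc.tendsto s
  simp only [sub_self, smul_zero, norm_zero, mul_zero] at h0
  refine squeeze_zero (fun t => norm_nonneg _) (fun t => ?_) h0
  rw [← applyExt_sub (hA.mem (h t)) (hA.mem (h s))]
  exact hA.bound 0 (H.graph.sub_mem (h t) (h s))

/-- Since `A` is bounded relative to `H` with a bound less than one, the graph norm of `H + A`
controls that of `H`. -/
lemma RelBound.continuous_of_continuous_add (hA : RelBound H A ε c) {x y : ℝ → E}
    (hx : Continuous x) (h : ∀ t, (x t, y t) ∈ H.graph)
    (hy : Continuous fun t => y t + applyExt A (x t)) : Continuous y := by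
  rw [continuous_iff_continuousAt]
  intro s
  rw [ContinuousAt, tendsto_iff_norm_sub_tendsto_zero]
  set z : ℂ := ((0 : ℝ) : ℂ) + ε * Complex.I with hz
  have hc : Continuous fun t => (1 - c)⁻¹ *
      (‖(y t + applyExt A (x t)) - (y s + applyExt A (x s))‖ + c * (‖z‖ * ‖x t - x s‖)) := by
    fun_prop
  have h0 := hc.tendsto s
  simp only [sub_self, norm_zero, mul_zero, add_zero] at h0
  refine squeeze_zero (fun t => norm_nonneg _) (fun t => ?_) h0
  have h1 := hA.bound 0 (H.graph.sub_mem (h t) (h s))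
  rw [applyExt_sub (hA.mem (h t)) (hA.mem (h s))] at h1
  have h2 : ‖y t - y s - z • (x t - x s)‖ ≤ ‖y t - y s‖ + ‖z‖ * ‖x t - x s‖ := by
    rw [← norm_smul]; exact norm_sub_le _ _
  have h3 := mul_le_mul_of_nonneg_left h2 hA.c_nonneg
  have h4 : ‖y t - y s‖ ≤ ‖(y t + applyExt A (x t)) - (y s + applyExt A (x s))‖ +
      ‖applyExt A (x t) - applyExt A (x s)‖ := by
    refine le_trans (le_of_eq ?_) (norm_sub_le _ _)
    congr 1; abel
  rw [le_inv_mul_iff₀ (sub_pos.mpr hA.c_lt_one)]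
  change ‖applyExt A (x t) - applyExt A (x s)‖ ≤ c * ‖y t - y s - z • (x t - x s)‖ at h1
  linarith

variable [CompleteSpace E]

/-- The product rule for `t ↦ e^{itH} φ(t)`. -/
lemma IsUnitaryGroupOf.hasDerivAt_comp {U : ℝ → E →L[ℂ] E} (hU : IsUnitaryGroupOf H U)
    {φ : ℝ → E} {φ' y : E} {t : ℝ} (hφ : HasDerivAt φ φ' t) (h : (φ t, y) ∈ H.graph) :
    HasDerivAt (fun s => U s (φ s)) (U t (φ' + Complex.I • y)) t := by
  have h1 := hasDerivAt_iff_tendsto_slope.mp hφ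
  have h2 := hasDerivAt_iff_tendsto_slope.mp (hU.hasDerivAt h t)
  have h3 : Tendsto (fun s => U s (slope φ t s)) (𝓝[≠] t) (𝓝 (U t φ')) :=
    (hU.continuous_uncurry.tendsto (t, φ')).comp
      ((tendsto_nhdsWithin_of_tendsto_nhds tendsto_id).prodMk_nhds h1)
  rw [hasDerivAt_iff_tendsto_slope, _root_.map_add]
  refine (h3.add h2).congr fun s => ?_
  simp only [slope, vsub_eq_sub]
  rw [(U s).map_smul_of_tower, map_sub, ← smul_add]
  congr 1
  abel

end Weak

section Weak

variable {E : Type*} [NormedAddCommGroup E] [InnerProductSpace ℂ E] [CompleteSpace E]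
  [TopologicalSpace.SeparableSpace E]
  {H A : E →ₗ.[ℂ] E} {ε c T M : ℝ} {B : ℝ → E →L[ℂ] E}

/-- If `w(t) = u₀ + ∫₀ᵗ h` solves the equation in the rotating frame, then `e^{-itH₀} w(t)` is a
weak solution. -/
theorem isWeakSolution_of_equation (hP : SmoothPerturbation H A (expI H) ε c) (hT : 0 < T)
    (hB : IsAdmissibleFamily T B) (u₀ : E) {f h u : L2 T E}
    (heq : ∀ᵐ t ∂(volume.restrict (Ioo 0 T)), Complex.I • h t =
      skewedPotential H A B (primitive u₀ h) t + expI H t (f t))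
    (hu : u =ᵐ[volume.restrict (Ioo (0 : ℝ) T)] fun t => expI H (-t) (primitive u₀ h t)) :
    IsWeakSolution (H + A) B u₀ f u := by
  have hU := hP.group
  set w := primitive u₀ h with hw
  refine ⟨fun φ hφ1 hHφ hφc hφs => ?_, _, (continuous_neg_primitive hU u₀ h).continuousOn, hu, ?_⟩
  swap
  · simp only [neg_zero, primitive_zero, hU.map_zero]; rfl
  set x : ℝ → E := fun t => (φ t : E) with hx
  set y : ℝ → E := fun t => applyExt H (x t) with hy
  have hxH : ∀ t, x t ∈ H.domain := fun t => (φ t).2.1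
  have hxA : ∀ t, x t ∈ A.domain := fun t => (φ t).2.2
  have hgr : ∀ t, (x t, y t) ∈ H.graph := fun t => mem_graph_applyExt (hxH t)
  have hsum : ∀ t, (H + A) (φ t) = y t + applyExt A (x t) := fun t => by
    rw [hy]; simp only
    rw [applyExt_of_mem (hxH t), applyExt_of_mem (hxA t)]; rfl
  have hyc : Continuous y := by
    refine hP.rel.continuous_of_continuous_add hφ1.continuous hgr ?_
    simpa only [hsum] using hHφ
  have hx' : Continuous (deriv x) := hφ1.continuous_deriv le_rfl
  have hxd : ∀ t, HasDerivAt x (deriv x t) t := fun t =>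
    (hφ1.differentiable one_ne_zero t).hasDerivAt
  set χ : ℝ → E := fun t => expI H t (x t) with hχ
  set χ' : ℝ → E := fun t => expI H t (deriv x t + Complex.I • y t) with hχ'
  have hχd : ∀ t, HasDerivAt χ (χ' t) t := fun t => hU.hasDerivAt_comp (hxd t) (hgr t)
  have hχ'c : Continuous χ' :=
    hU.continuous_uncurry.comp (continuous_id.prodMk (hx'.add (continuous_const.smul hyc)))
  have hχc : Continuous χ := hU.continuous_uncurry.comp (continuous_id.prodMk hφ1.continuous)
  have hχint : ∀ t, χ t = χ 0 + ∫ s in (0 : ℝ)..t, χ' s := fun t => by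
    rw [intervalIntegral.integral_eq_sub_of_hasDerivAt (fun s _ => hχd s)
      (hχ'c.intervalIntegrable _ _)]
    abel
  have hx0 : ∀ t, t ∉ Ioo 0 T → x t = 0 := fun t ht =>
    image_eq_zero_of_notMem_tsupport fun h => ht (hφs h)
  have hχT : χ T = 0 := by simp only [hχ, hx0 T (by simp), map_zero]
  have hχ0 : χ 0 = 0 := by simp only [hχ, hx0 0 (by simp), map_zero]
  set g : ℝ → E := (Ioo 0 T).indicator h with hg
  have hgi : Integrable g := integrable_indicator_L2 h
  have hwc : Continuous w := continuous_primitive u₀ h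
  have key := bilin_primitive (innerBilin E) hT.le hgi.integrableOn
    (hχ'c.integrableOn_Ioc (μ := volume)) u₀ (χ 0)
  simp_rw [← hχint] at key
  change innerBilin E (w T) (χ T) = innerBilin E u₀ (χ 0) +
    ((∫ s in (0 : ℝ)..T, innerBilin E (g s) (χ s)) +
      ∫ s in (0 : ℝ)..T, innerBilin E (w s) (χ' s)) at key
  rw [hχT, hχ0, map_zero, map_zero, zero_add, intervalIntegral.integral_of_le hT.le,
    intervalIntegral.integral_of_le hT.le, integral_Ioc_eq_integral_Ioo,
    integral_Ioc_eq_integral_Ioo] at key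
  simp only [innerBilin_apply] at key
  have hχL : ∀ {p : ℝ → E}, Continuous p → MemLp p 2 (volume.restrict (Ioo 0 T)) := fun hp =>
    memLp_Ioo_of_continuousOn hp.continuousOn
  have hi1 : Integrable (fun s => (inner ℂ (g s) (χ s) : ℂ)) (volume.restrict (Ioo 0 T)) :=
    integrable_inner_of_memLp (memLp_indicator_L2 h _ Measure.restrict_le_self) (hχL hχc)
  have hi2 : Integrable (fun s => (inner ℂ (w s) (χ' s) : ℂ)) (volume.restrict (Ioo 0 T)) :=
    integrable_inner_of_memLp (memLp_primitive u₀ h) (hχL hχ'c)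
  have hi3 : Integrable (fun s => (inner ℂ (f s) (x s) : ℂ)) (volume.restrict (Ioo 0 T)) :=
    integrable_inner_of_memLp (Lp.memLp f) (hχL hφ1.continuous)
  have hi12 : Integrable (fun s => (inner ℂ (g s) (χ s) : ℂ) + inner ℂ (w s) (χ' s))
    (volume.restrict (Ioo 0 T)) := hi1.add hi2
  have hpt : ∀ᵐ t ∂(volume.restrict (Ioo 0 T)),
      inner ℂ (u t) (Complex.I • deriv x t - (H + A) (φ t) - B t (x t)) =
        Complex.I * ((inner ℂ (g t) (χ t) : ℂ) + inner ℂ (w t) (χ' t)) + inner ℂ (f t) (x t) := by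
    filter_upwards [heq, hu, ae_mem_domain_primitive hP hT u₀ h, ae_restrict_mem measurableSet_Ioo]
      with t he hut hdom ht
    set a := expI H (-t) (w t) with ha
    have hBs : inner ℂ (B t a) (x t) = inner ℂ a (B t (x t)) :=
      (ContinuousLinearMap.isSelfAdjoint_iff_isSymmetric.mp
        (hB.selfAdjoint t (Ioo_subset_Icc_self ht))) _ _
    have hAs : inner ℂ (applyExt A a) (x t) = inner ℂ a (applyExt A (x t)) :=
      inner_applyExt_left hP.symm hdom (hxA t)
    have e1 : inner ℂ (Complex.I • h t) (χ t) =
        inner ℂ a (applyExt A (x t)) + inner ℂ a (B t (x t)) + inner ℂ (f t) (x t) := by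
      rw [he, skewedPotential, ← map_add, hχ, hU.inner_map, inner_add_left, inner_add_left, hBs,
        hAs]
    have e2 : inner ℂ (w t) (χ' t) = inner ℂ a (deriv x t + Complex.I • y t) := by
      rw [hχ', hU.inner_map_right]
    have e3 : inner ℂ (Complex.I • h t) (χ t) = -Complex.I * inner ℂ (g t) (χ t) := by
      rw [hg, indicator_of_mem ht, inner_smul_left, Complex.conj_I]
    have e4 : Complex.I * inner ℂ (g t) (χ t) = -(inner ℂ a (applyExt A (x t)) +
        inner ℂ a (B t (x t)) + inner ℂ (f t) (x t)) := by
      rw [← e1, e3, neg_mul, neg_neg]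
    rw [hut, hsum, mul_add, e4, e2]
    simp only [inner_sub_right, inner_add_right, inner_smul_right]
    linear_combination -(inner ℂ a (y t) : ℂ) * Complex.I_mul_I
  rw [integral_congr_ae hpt, integral_add (hi12.const_mul _) hi3, integral_const_mul,
    integral_add hi1 hi2, ← key, mul_zero, zero_add]

end Weak

/-! ### Uniqueness of weak solutions -/

section Gronwall

variable {E : Type*} [NormedAddCommGroup E]

lemma eq_zero_of_sq_norm_le_integral {v : ℝ → E} {T K : ℝ} (hT : 0 ≤ T)
    (hv : ContinuousOn v (Icc 0 T))
    (h : ∀ t ∈ Icc 0 T, ‖v t‖ ^ 2 ≤ K * ∫ s in (0 : ℝ)..t, ‖v s‖ ^ 2) :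
    ∀ t ∈ Icc 0 T, v t = 0 := by
  set f : ℝ → ℝ := fun t => ‖v (projIcc 0 T hT t)‖ ^ 2 with hf
  have hfc : Continuous f := (hv.comp_continuous (continuous_subtype_val.comp continuous_projIcc)
    fun t => (projIcc 0 T hT t).2).norm.pow 2
  have hfv : ∀ t ∈ Icc 0 T, f t = ‖v t‖ ^ 2 := fun t ht => by
    simp only [hf, projIcc_of_mem hT ht]
  have hd : ∀ t, HasDerivAt (fun t => ∫ s in (0 : ℝ)..t, f s) (f t) t := fun t =>
    hfc.integral_hasStrictDerivAt 0 t |>.hasDerivAt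
  have he : ∀ t ∈ Icc 0 T, ∫ s in (0 : ℝ)..t, f s = ∫ s in (0 : ℝ)..t, ‖v s‖ ^ 2 := fun t ht => by
    refine intervalIntegral.integral_congr fun s hs => hfv s ?_
    rw [uIcc_of_le ht.1] at hs
    exact ⟨hs.1, hs.2.trans ht.2⟩
  have h0 := eq_zero_of_abs_deriv_le_mul_abs_self_of_eq_zero_right (K := K) (a := 0) (b := T)
    (f := fun t => ∫ s in (0 : ℝ)..t, f s) (f' := f)
    (fun t _ => (hd t).continuousAt.continuousWithinAt)
    (fun t _ => (hd t).hasDerivWithinAt) intervalIntegral.integral_same fun t ht => ?_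
  · intro t ht
    have h1 := h t ht
    rw [← he t ht, h0 t ht, mul_zero] at h1
    exact norm_eq_zero.mp (pow_eq_zero_iff two_ne_zero |>.mp (le_antisymm h1 (sq_nonneg _)))
  · have ht' := Ico_subset_Icc_self ht
    have hnn : 0 ≤ ∫ s in (0 : ℝ)..t, ‖v s‖ ^ 2 :=
      intervalIntegral.integral_nonneg ht.1 fun _ _ => sq_nonneg _
    rw [hfv t ht', he t ht', Real.norm_of_nonneg (sq_nonneg _), Real.norm_of_nonneg hnn]
    exact h t ht'

end Gronwall

section Uniqueness

variable {E : Type*} [NormedAddCommGroup E] [InnerProductSpace ℂ E] [CompleteSpace E]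
  {H A : E →ₗ.[ℂ] E} {ε c T M : ℝ} {B : ℝ → E →L[ℂ] E}

lemma IsWeakSolution.sub (hB : IsAdmissibleFamily T B) (hM : ∀ t ∈ Icc 0 T, ‖B t‖ ≤ M)
    {L : E →ₗ.[ℂ] E} {x y : E} {f g u v : L2 T E} (hu : IsWeakSolution L B x f u)
    (hv : IsWeakSolution L B y g v) : IsWeakSolution L B (x - y) (f - g) (u - v) := by
  refine ⟨fun φ h1 h2 h3 h4 => ?_, ?_⟩
  · have e1 := hu.1 φ h1 h2 h3 h4
    have e2 := hv.1 φ h1 h2 h3 h4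
    have hφ : MemLp (fun t => (φ t : E)) 2 (volume.restrict (Ioo 0 T)) :=
      memLp_Ioo_of_continuousOn h1.continuous.continuousOn
    have hφ' : MemLp (fun t => Complex.I • deriv (fun s => (φ s : E)) t - L (φ t) -
        B t (φ t : E)) 2 (volume.restrict (Ioo 0 T)) :=
      memLp_Ioo_of_continuousOn
        ((((h1.continuous_deriv le_rfl).const_smul _).sub h2).continuousOn.sub
        (continuousOn_family_apply hB hM h1.continuous.continuousOn))
    have key : ∀ (p q : L2 T E) (χ : ℝ → E), MemLp χ 2 (volume.restrict (Ioo 0 T)) →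
        ∫ t in Ioo 0 T, (inner ℂ ((p - q : L2 T E) t) (χ t) : ℂ) =
          (∫ t in Ioo 0 T, inner ℂ (p t) (χ t)) - ∫ t in Ioo 0 T, inner ℂ (q t) (χ t) := by
      intro p q χ hχ
      rw [← integral_sub (integrable_inner_of_memLp (Lp.memLp p) hχ)
        (integrable_inner_of_memLp (Lp.memLp q) hχ)]
      refine integral_congr_ae ?_
      filter_upwards [Lp.coeFn_sub p q] with t ht
      rw [ht, Pi.sub_apply, inner_sub_left]
    rw [key _ _ _ hφ, key _ _ _ hφ', e1, e2]
  · obtain ⟨p, hp, hup, rfl⟩ := hu.2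
    obtain ⟨q, hq, hvq, rfl⟩ := hv.2
    exact ⟨p - q, hp.sub hq, (Lp.coeFn_sub _ _).trans (hup.sub hvq), rfl⟩

lemma continuousOn_skewedPotential_const (hP : SmoothPerturbation H A (expI H) ε c)
    (hB : IsAdmissibleFamily T B) (hM : ∀ t ∈ Icc 0 T, ‖B t‖ ≤ M) {ψ η : E}
    (hψ : (ψ, η) ∈ H.graph) :
    ContinuousOn (skewedPotential H A B fun _ => ψ) (Icc 0 T) := by
  have hU := hP.group
  have h1 : Continuous fun t => applyExt A (expI H (-t) ψ) :=
    hP.rel.continuous_applyExt (hU.continuous_neg ψ) (hU.continuous_neg η)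
      fun t => hU.map_graph (-t) hψ
  have h2 := continuousOn_family_apply hB hM (hU.continuous_neg ψ).continuousOn
  exact hU.continuous_uncurry.comp_continuousOn (continuousOn_id.prodMk (h1.continuousOn.add h2))

/-- Testing the weak equation with `θ(t) e^{-itH₀} ψ` yields an equation for the scalar function
`⟪v(t), ψ⟫`, where `v(t) = e^{itH₀} d(t)`. -/
lemma isWeakDeriv_inner (hP : SmoothPerturbation H A (expI H) ε c)
    {d : L2 T E} (hd : IsWeakSolution (H + A) B 0 0 d) {ψ η : E} (hψ : (ψ, η) ∈ H.graph)
    {v : ℝ → E} (hdv : ∀ᵐ t ∂(volume.restrict (Ioo 0 T)), expI H t (d t) = v t)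
    {p q : L2 T ℂ} (hp : p =ᵐ[volume.restrict (Ioo (0 : ℝ) T)] fun t => inner ℂ (v t) ψ)
    (hq : q =ᵐ[volume.restrict (Ioo (0 : ℝ) T)] fun t =>
      inner ℂ (v t) (skewedPotential H A B (fun _ => ψ) t)) :
    IsWeakDeriv p (Complex.I • q) := by
  intro θ hθ hθc hθs
  have hU := hP.group
  have hgr : ∀ t, (expI H (-t) ψ, expI H (-t) η) ∈ H.graph := fun t => hU.map_graph (-t) hψ
  have hdom : ∀ t, expI H (-t) ψ ∈ (H + A).domain := fun t =>
    ⟨mem_domain_of_graph (hgr t), hP.rel.mem (hgr t)⟩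
  let φ : ℝ → (H + A).domain := fun t =>
    (θ t : ℂ) • (⟨expI H (-t) ψ, hdom t⟩ : (H + A).domain)
  have hφ : (fun t => (φ t : E)) = fun t => θ t • expI H (-t) ψ := by
    ext t; exact Complex.coe_smul _ _
  have hLφ : ∀ t, (H + A) (φ t) = θ t • (expI H (-t) η + applyExt A (expI H (-t) ψ)) := fun t => by
    have e : (H + A) ⟨expI H (-t) ψ, hdom t⟩ = expI H (-t) η + applyExt A (expI H (-t) ψ) := by
      rw [applyExt_of_mem (hdom t).2]
      change H ⟨expI H (-t) ψ, (hdom t).1⟩ + A ⟨expI H (-t) ψ, (hdom t).2⟩ = _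
      congr 1
      rw [← applyExt_of_mem (hdom t).1]
      exact applyExt_of_graph (hgr t)
    rw [LinearPMap.map_smul, e]
    exact Complex.coe_smul _ _
  have hθd : ∀ t, HasDerivAt θ (deriv θ t) t := fun t =>
    (hθ.differentiable (by simp) t).hasDerivAt
  have hder : ∀ t, HasDerivAt (fun t => θ t • expI H (-t) ψ)
      (θ t • -(expI H (-t) (Complex.I • η)) + deriv θ t • expI H (-t) ψ) t := fun t =>
    (hθd t).smul (hU.hasDerivAt_neg hψ t)
  have hdc : deriv (fun t => (φ t : E)) =
      fun t => θ t • -(expI H (-t) (Complex.I • η)) + deriv θ t • expI H (-t) ψ := by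
    rw [hφ]; ext t; exact (hder t).deriv
  have hθ' : Continuous (deriv θ) := continuous_test hθ
  have hAc : Continuous fun t => applyExt A (expI H (-t) ψ) :=
    hP.rel.continuous_applyExt (hU.continuous_neg ψ) (hU.continuous_neg η) hgr
  have key := hd.1 φ ?_ ?_ ?_ ?_
  · have hz : ∫ t in Ioo 0 T, (inner ℂ ((0 : L2 T E) t) (φ t : E) : ℂ) = 0 := by
      rw [integral_congr_ae (g := fun _ => (0 : ℂ)), integral_zero]
      filter_upwards [Lp.coeFn_zero E 2 (volume.restrict (Ioo (0 : ℝ) T))] with t ht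
      rw [ht, Pi.zero_apply, inner_zero_left]
    rw [hz] at key
    have hpt : ∀ᵐ t ∂(volume.restrict (Ioo 0 T)),
        (inner ℂ (d t) (Complex.I • deriv (fun s => (φ s : E)) t - (H + A) (φ t) -
          B t (φ t : E)) : ℂ) =
            Complex.I * (deriv θ t • p t + θ t • (Complex.I • q : L2 T ℂ) t) := by
      filter_upwards [hdv, hp, hq, Lp.coeFn_smul Complex.I q] with t h1 h2 h3 h4
      have hφt : (φ t : E) = θ t • expI H (-t) ψ := congrFun hφ t
      rw [h4, Pi.smul_apply, h2, h3, ← h1, hU.inner_map_left, skewedPotential, hU.inner_map, hdc,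
        hLφ, hφt]
      simp only [map_smul, inner_sub_right, inner_add_right, inner_smul_right,
        (B t).map_smul_of_tower, inner_neg_right, smul_eq_mul, Complex.real_smul, smul_neg,
        smul_add, inner_smul_right_eq_smul]
      linear_combination (-(θ t : ℂ) * (inner ℂ (d t) (expI H (-t) η) +
        inner ℂ (d t) (applyExt A (expI H (-t) ψ)) + inner ℂ (d t) (B t (expI H (-t) ψ)))) *
          Complex.I_mul_I
    have hi1 := integrable_test (deriv θ) hθ' hθc.deriv p
    have hi2 := integrable_test θ hθ.continuous hθc (Complex.I • q)
    rw [integral_congr_ae hpt, integral_const_mul, integral_add hi1 hi2] at key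
    exact eq_neg_of_add_eq_zero_left ((mul_eq_zero.mp key).resolve_left Complex.I_ne_zero)
  · rw [contDiff_one_iff_deriv, hdc, hφ]
    refine ⟨fun t => (hder t).differentiableAt, ?_⟩
    exact (hθ.continuous.smul (hU.continuous_neg _).neg).add (hθ'.smul (hU.continuous_neg _))
  · simp only [hLφ]
    exact hθ.continuous.smul ((hU.continuous_neg _).add hAc)
  · rw [hφ]; exact hθc.smul_right
  · rw [hφ]; exact (tsupport_smul_subset_left _ _).trans hθs

/-- The integrated form of the scalar equation for `⟪v(t), ψ⟫`. -/
lemma norm_inner_le_integral (hP : SmoothPerturbation H A (expI H) ε c) (hT : 0 < T)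
    (hB : IsAdmissibleFamily T B) (hM : ∀ t ∈ Icc 0 T, ‖B t‖ ≤ M)
    {d : L2 T E} (hd : IsWeakSolution (H + A) B 0 0 d) {ψ η : E} (hψ : (ψ, η) ∈ H.graph)
    {v : ℝ → E} (hvc : ContinuousOn v (Icc 0 T)) (hv0 : v 0 = 0)
    (hdv : ∀ᵐ t ∂(volume.restrict (Ioo 0 T)), expI H t (d t) = v t) {t : ℝ} (ht : t ∈ Icc 0 T) :
    ‖(inner ℂ (v t) ψ : ℂ)‖ ≤
      ∫ s in (0 : ℝ)..t, ‖v s‖ * ‖skewedPotential H A B (fun _ => ψ) s‖ := by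
  have hpc : ContinuousOn (fun t => (inner ℂ (v t) ψ : ℂ)) (Icc 0 T) :=
    hvc.inner continuousOn_const
  have hVc := continuousOn_skewedPotential_const hP hB hM hψ
  have hqc : ContinuousOn (fun t => (inner ℂ (v t) (skewedPotential H A B (fun _ => ψ) t) : ℂ))
    (Icc 0 T) := hvc.inner hVc
  set p : L2 T ℂ := (memLp_Ioo_of_continuousOn hpc).toLp with hp
  set q : L2 T ℂ := (memLp_Ioo_of_continuousOn hqc).toLp with hq
  have hpe : p =ᵐ[volume.restrict (Ioo (0 : ℝ) T)] fun t => inner ℂ (v t) ψ := MemLp.coeFn_toLp _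
  have hqe : q =ᵐ[volume.restrict (Ioo (0 : ℝ) T)] fun t =>
    inner ℂ (v t) (skewedPotential H A B (fun _ => ψ) t) := MemLp.coeFn_toLp _
  obtain ⟨x, hx⟩ := (isWeakDeriv_inner hP hd hψ hdv hpe hqe).exists_ae_eq_primitive hT
  have hx0 : x = 0 := (hasInitialValue_of_ae_eq_primitive hx).unique hT
    ⟨_, hpc, hpe, by rw [hv0, inner_zero_left]⟩
  have heq : EqOn (fun t => (inner ℂ (v t) ψ : ℂ)) (primitive x (Complex.I • q)) (Icc 0 T) := by
    refine Measure.eqOn_Icc_of_ae_eq volume hT.ne ?_ hpc (continuous_primitive _ _).continuousOn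
    rw [← restrict_Ioo_eq_restrict_Icc]
    exact hpe.symm.trans hx
  have hi : IntervalIntegrable (fun s => ‖v s‖ * ‖skewedPotential H A B (fun _ => ψ) s‖)
      volume 0 t := by
    refine ContinuousOn.intervalIntegrable ?_
    rw [uIcc_of_le ht.1]
    exact (hvc.norm.mul hVc.norm).mono (Icc_subset_Icc_right ht.2)
  have h1 : (inner ℂ (v t) ψ : ℂ) = primitive x (Complex.I • q) t := heq ht
  rw [h1, primitive, hx0, zero_add]
  refine intervalIntegral.norm_integral_le_of_norm_le ht.1 ?_ hi
  filter_upwards [(ae_restrict_iff' measurableSet_Ioo).mp hqe,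
    (ae_restrict_iff' measurableSet_Ioo).mp (Lp.coeFn_smul Complex.I q)] with s h2 h3 hs
  by_cases hsm : s ∈ Ioo 0 T
  · rw [indicator_of_mem hsm, h3 hsm, Pi.smul_apply, h2 hsm, norm_smul, Complex.norm_I, one_mul]
    exact norm_inner_le_norm _ _
  · rw [indicator_of_notMem hsm, norm_zero]
    positivity

variable [TopologicalSpace.SeparableSpace E]

/-- A weak solution with zero data vanishes: the smoothing estimate bounds `⟪v(t), ψ⟫` by the
`L²` norm of `v` on `(0, t)`, and Gronwall's lemma applies. -/
theorem eq_zero_of_isWeakSolution (hP : SmoothPerturbation H A (expI H) ε c) (hT : 0 < T)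
    (hB : IsAdmissibleFamily T B) (hM : ∀ t ∈ Icc 0 T, ‖B t‖ ≤ M)
    {d : L2 T E} (hd : IsWeakSolution (H + A) B 0 0 d) : d = 0 := by
  have hU := hP.group
  obtain ⟨d', hd'c, hdd', hd'0⟩ := hd.2
  set v : ℝ → E := fun t => expI H t (d' t) with hv
  have hvc : ContinuousOn v (Icc 0 T) :=
    hU.continuous_uncurry.comp_continuousOn (continuousOn_id.prodMk hd'c)
  have hv0 : v 0 = 0 := by simp only [hv, hd'0, map_zero]
  have hdv : ∀ᵐ t ∂(volume.restrict (Ioo 0 T)), expI H t (d t) = v t := by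
    filter_upwards [hdd'] with t ht
    rw [ht]
  obtain ⟨C, hC, hb⟩ := exists_potential_bound hP M
  -- `K` bounds the square of the norm of the map `ψ ↦ V ψ` from `E` to `L²(I, E)`.
  set K : ℝ := C * (1 + T) ^ 2 / T with hK
  have hK0 : 0 < K := by positivity
  have hVψ : ∀ ψ η : E, (ψ, η) ∈ H.graph → ∀ t ∈ Icc 0 T,
      ∫ s in (0 : ℝ)..t, ‖skewedPotential H A B (fun _ => ψ) s‖ ^ 2 ≤ K * ‖ψ‖ ^ 2 := by
    intro ψ η hψ t ht
    have h1 := hb T hT B hB hM ψ 0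
    rw [primitive_right_zero, norm_zero, zero_pow two_ne_zero, mul_zero, add_zero] at h1
    have h3 : ∫ s in Ioo 0 T, ‖skewedPotential H A B (fun _ => ψ) s‖ ^ 2 ≤ K * ‖ψ‖ ^ 2 := by
      rw [hK, div_mul_eq_mul_div, le_div_iff₀ hT, mul_comm]
      exact h1
    refine le_trans ?_ h3
    rw [← integral_Ioc_eq_integral_Ioo, ← intervalIntegral.integral_of_le hT.le]
    refine intervalIntegral.integral_mono_interval le_rfl ht.1 ht.2
      (Eventually.of_forall fun s => sq_nonneg _) (ContinuousOn.intervalIntegrable ?_)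
    rw [uIcc_of_le hT.le]
    exact (continuousOn_skewedPotential_const hP hB hM hψ).norm.pow 2
  have hkey : ∀ t ∈ Icc 0 T, ∀ ψ η : E, (ψ, η) ∈ H.graph →
      ‖(inner ℂ (v t) ψ : ℂ)‖ ≤ K / 2 * (∫ s in (0 : ℝ)..t, ‖v s‖ ^ 2) + ‖ψ‖ ^ 2 / 2 := by
    intro t ht ψ η hψ
    have hVc := continuousOn_skewedPotential_const hP hB hM hψ
    have hsub : uIcc 0 t ⊆ Icc 0 T := by rw [uIcc_of_le ht.1]; exact Icc_subset_Icc_right ht.2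
    have hi1 : IntervalIntegrable (fun s => K / 2 * ‖v s‖ ^ 2) volume 0 t :=
      ((continuousOn_const.mul (hvc.norm.pow 2)).mono hsub).intervalIntegrable
    have hi2 : IntervalIntegrable
        (fun s => 1 / (2 * K) * ‖skewedPotential H A B (fun _ => ψ) s‖ ^ 2) volume 0 t :=
      ((continuousOn_const.mul (hVc.norm.pow 2)).mono hsub).intervalIntegrable
    calc _ ≤ ∫ s in (0 : ℝ)..t, ‖v s‖ * ‖skewedPotential H A B (fun _ => ψ) s‖ :=
          norm_inner_le_integral hP hT hB hM hd hψ hvc hv0 hdv ht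
      _ ≤ ∫ s in (0 : ℝ)..t, (K / 2 * ‖v s‖ ^ 2 +
            1 / (2 * K) * ‖skewedPotential H A B (fun _ => ψ) s‖ ^ 2) := by
          refine intervalIntegral.integral_mono_on ht.1
            ((hvc.norm.mul hVc.norm).mono hsub).intervalIntegrable (hi1.add hi2) fun s _ => ?_
          -- Young's inequality; the weight leaves `‖ψ‖² / 2`, which is absorbed for `ψ = v(t)`.
          have h1 : 0 ≤ 1 / (2 * K) *
              (K * ‖v s‖ - ‖skewedPotential H A B (fun _ => ψ) s‖) ^ 2 := by positivity
          have h2 : 1 / (2 * K) * (K * ‖v s‖ - ‖skewedPotential H A B (fun _ => ψ) s‖) ^ 2 =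
              K / 2 * ‖v s‖ ^ 2 + 1 / (2 * K) * ‖skewedPotential H A B (fun _ => ψ) s‖ ^ 2 -
                ‖v s‖ * ‖skewedPotential H A B (fun _ => ψ) s‖ := by
            field_simp; ring
          linarith
      _ ≤ _ := by
          rw [intervalIntegral.integral_add hi1 hi2, intervalIntegral.integral_const_mul,
            intervalIntegral.integral_const_mul]
          refine add_le_add_right ((mul_le_mul_of_nonneg_left (hVψ ψ η hψ t ht)
            (by positivity)).trans (le_of_eq ?_)) _
          field_simp
  have hfin : ∀ t ∈ Icc 0 T, ‖v t‖ ^ 2 ≤ K * ∫ s in (0 : ℝ)..t, ‖v s‖ ^ 2 := by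
    intro t ht
    -- The bound extends from the domain of `H` to `ψ = v(t)` by density.
    have hcl : ∀ ψ : E,
        ‖(inner ℂ (v t) ψ : ℂ)‖ ≤ K / 2 * (∫ s in (0 : ℝ)..t, ‖v s‖ ^ 2) + ‖ψ‖ ^ 2 / 2 := by
      intro ψ
      have hcl : IsClosed {ψ : E | ‖(inner ℂ (v t) ψ : ℂ)‖ ≤
          K / 2 * (∫ s in (0 : ℝ)..t, ‖v s‖ ^ 2) + ‖ψ‖ ^ 2 / 2} :=
        isClosed_le (by fun_prop) (by fun_prop)
      have hmem : ψ ∈ closure (H.domain : Set E) := by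
        rw [Metric.mem_closure_iff]
        intro δ hδ
        obtain ⟨x', y', hx', hδ'⟩ := exists_graph_near hP.selfAdjoint ψ hδ
        exact ⟨x', mem_domain_of_graph hx', by rwa [dist_eq_norm]⟩
      exact closure_minimal (fun ψ hψ => hkey t ht ψ _ (mem_graph_applyExt hψ)) hcl hmem
    have h1 := hcl (v t)
    rw [inner_self_eq_norm_sq_to_K, norm_pow, RCLike.norm_ofReal, abs_norm] at h1
    linarith
  have hz := eq_zero_of_sq_norm_le_integral hT.le hvc hfin
  refine Lp.ext ?_
  filter_upwards [hdv, Lp.coeFn_zero E 2 (volume.restrict (Ioo (0 : ℝ) T)),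
    ae_restrict_mem measurableSet_Ioo] with t h1 h2 ht
  rw [h2, Pi.zero_apply, ← norm_eq_zero, ← hU.norm_map t, h1, hz t (Ioo_subset_Icc_self ht),
    norm_zero]

theorem IsWeakSolution.unique (hP : SmoothPerturbation H A (expI H) ε c) (hT : 0 < T)
    (hB : IsAdmissibleFamily T B) (hM : ∀ t ∈ Icc 0 T, ‖B t‖ ≤ M) {x : E} {f u v : L2 T E}
    (hu : IsWeakSolution (H + A) B x f u) (hv : IsWeakSolution (H + A) B x f v) : u = v := by
  have h := hu.sub hB hM hv
  rw [sub_self, sub_self] at h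
  exact sub_eq_zero.mp (eq_zero_of_isWeakSolution hP hT hB hM h)

end Uniqueness

/-! ### The least-squares functional -/

section Quadratic

variable {V X Y : Type*} [AddCommGroup V] [Module ℂ V] [NormedAddCommGroup X]
  [InnerProductSpace ℂ X] [NormedAddCommGroup Y] [InnerProductSpace ℂ Y]

lemma isQuadraticFunctional_norm_sq (p : V →ₗ[ℂ] X) (q : V →ₗ[ℂ] Y) (x : X) (y : Y) (T : ℝ) :
    IsQuadraticFunctional fun v => ‖p v - x‖ ^ 2 + T * ‖q v - y‖ ^ 2 := by
  refine ⟨LinearMap.mk₂'ₛₗ (starRingEnd ℂ) (RingHom.id ℂ)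
      (fun v w => inner ℂ (p v) (p w) + (T : ℂ) * inner ℂ (q v) (q w)) ?_ ?_ ?_ ?_,
    (innerₛₗ ℂ x) ∘ₗ p + (T : ℂ) • ((innerₛₗ ℂ y) ∘ₗ q), ‖x‖ ^ 2 + T * ‖y‖ ^ 2, ?_, ?_⟩
  · intro v v' w; simp only [map_add, inner_add_left]; ring
  · intro a v w
    simp only [map_smul, inner_smul_left, smul_eq_mul]; ring
  · intro v w w'; simp only [map_add, inner_add_right]; ring
  · intro a v w
    simp only [map_smul, inner_smul_right, smul_eq_mul, RingHom.id_apply]; ring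
  · intro v w
    simp only [LinearMap.mk₂'ₛₗ_apply, map_add, map_mul, inner_conj_symm, Complex.conj_ofReal]
  · intro v
    have h1 := norm_sub_sq (𝕜 := ℂ) x (p v)
    have h2 := norm_sub_sq (𝕜 := ℂ) y (q v)
    have h3 : (inner ℂ (p v) (p v) : ℂ).re = ‖p v‖ ^ 2 := inner_self_eq_norm_sq (𝕜 := ℂ) _
    have h4 : (inner ℂ (q v) (q v) : ℂ).re = ‖q v‖ ^ 2 := inner_self_eq_norm_sq (𝕜 := ℂ) _
    beta_reduce
    rw [norm_sub_rev (p v), norm_sub_rev (q v), h1, h2]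
    simp only [LinearMap.mk₂'ₛₗ_apply, LinearMap.add_apply, LinearMap.smul_apply,
      LinearMap.comp_apply, innerₛₗ_apply_apply, Complex.add_re, smul_eq_mul,
      Complex.re_ofReal_mul, h3, h4, RCLike.re_eq_complex_re]
    ring

end Quadratic

section Functional

variable {E : Type*} [NormedAddCommGroup E] [InnerProductSpace ℂ E] [CompleteSpace E]
  [TopologicalSpace.SeparableSpace E]
  {H A : E →ₗ.[ℂ] E} {ε c T M : ℝ} {B : ℝ → E →L[ℂ] E}

lemma AssumptionA.exists_smoothPerturbation (hA : AssumptionA H A) :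
    ∃ ε c : ℝ, SmoothPerturbation H A (expI H) ε c := by
  obtain ⟨ε, c, h⟩ := hA.exists_relBound
  exact ⟨ε, c, hA.selfAdjoint, hA.closed, hA.symmetric, h, isUnitaryGroupOf_expI hA.selfAdjoint⟩

lemma skewedPotential_ae_eq_of_ae_eq {v w : ℝ → E}
    (h : v =ᵐ[volume.restrict (Ioo (0 : ℝ) T)] w) :
    skewedPotential H A B v =ᵐ[volume.restrict (Ioo (0 : ℝ) T)] skewedPotential H A B w := by
  filter_upwards [h] with t ht
  rw [skewedPotential, skewedPotential, ht]

/-- The operator `i ∂ₜ - e^{itH₀} (A + B(t)) e^{-itH₀}` from `H¹(I, E)` to `L²(I, E)`. -/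
noncomputable def evolutionₗ (hP : SmoothPerturbation H A (expI H) ε c) (hT : 0 < T)
    (hB : IsAdmissibleFamily T B) (hM : ∀ t ∈ Icc 0 T, ‖B t‖ ≤ M) : H1 T E →ₗ[ℂ] L2 T E :=
  Complex.I • weakDerivₗ - potentialₗ hP hT hB hM ∘ₗ (initialValueₗ hT).prod weakDerivₗ

lemma evolutionₗ_apply (hP : SmoothPerturbation H A (expI H) ε c) (hT : 0 < T)
    (hB : IsAdmissibleFamily T B) (hM : ∀ t ∈ Icc 0 T, ‖B t‖ ≤ M) (v : H1 T E) :
    evolutionₗ hP hT hB hM v = Complex.I • weakDeriv v -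
      potentialₗ hP hT hB hM (initialValue (v : L2 T E), weakDeriv v) := rfl

lemma functionalF_eq (hP : SmoothPerturbation H A (expI H) ε c) (hT : 0 < T)
    (hB : IsAdmissibleFamily T B) (hM : ∀ t ∈ Icc 0 T, ‖B t‖ ≤ M) (u₀ : E) {f g : L2 T E}
    (hg : g =ᵐ[volume.restrict (Ioo (0 : ℝ) T)] fun t => expI H t (f t)) (v : H1 T E) :
    functionalF H A B u₀ f v =
      ‖initialValueₗ hT v - u₀‖ ^ 2 + T * ‖evolutionₗ hP hT hB hM v - g‖ ^ 2 := by
  rw [functionalF, norm_sq_L2]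
  congr 2
  refine integral_congr_ae ?_
  filter_upwards [hg, Lp.coeFn_sub (evolutionₗ hP hT hB hM v) g,
    Lp.coeFn_sub (Complex.I • weakDeriv v)
      (potentialₗ hP hT hB hM (initialValue (v : L2 T E), weakDeriv v)),
    Lp.coeFn_smul Complex.I (weakDeriv v),
    potentialₗ_ae_eq hP hT hB hM (initialValue (v : L2 T E), weakDeriv v),
    skewedPotential_ae_eq_of_ae_eq (H := H) (A := A) (B := B) (H1.ae_eq_primitive hT v)]
    with t h1 h2 h3 h4 h5 h6
  rw [h2, Pi.sub_apply, evolutionₗ_apply, h3, Pi.sub_apply, h4, Pi.smul_apply, h5, h1, residual,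
    h6]

/-- Every function in `H¹(I, E)` is almost everywhere equal to a primitive, for which the terms of
the functional are under control by the smoothing estimate. -/
theorem functionalWellDefined (hP : SmoothPerturbation H A (expI H) ε c) (hT : 0 < T)
    (hB : IsAdmissibleFamily T B) (hM : ∀ t ∈ Icc 0 T, ‖B t‖ ≤ M) (f : L2 T E) :
    FunctionalWellDefined H A B f := by
  intro v
  have hv := H1.ae_eq_primitive hT v
  refine ⟨⟨_, H1.hasInitialValue hT v, fun x hx => hx.unique hT (H1.hasInitialValue hT v)⟩,
    ⟨_, isWeakDeriv_weakDeriv v, fun g hg => hg.unique (isWeakDeriv_weakDeriv v)⟩, ?_,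
    (memLp_congr_ae (skewedPotential_ae_eq_of_ae_eq hv)).mpr
      (memLp_skewedPotential hP hT hB hM _ _),
    memLp_group_apply hP.group (Lp.memLp f)⟩
  filter_upwards [hv, ae_mem_domain_primitive hP hT (initialValue (v : L2 T E)) (weakDeriv v)]
    with t h1 h2
  rwa [h1]

/-- The evolution operator, together with the initial value, is bounded from above and from below
with respect to the norm of `H¹(I, E)`. -/
theorem exists_evolution_bounds (hP : SmoothPerturbation H A (expI H) ε c) (M : ℝ) :
    ∃ C : ℝ, 0 < C ∧ ∀ (T : ℝ) (hT : 0 < T) (B : ℝ → E →L[ℂ] E) (hB : IsAdmissibleFamily T B)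
      (hM : ∀ t ∈ Icc 0 T, ‖B t‖ ≤ M) (v : H1 T E),
      h1Norm v ^ 2 ≤ C * (1 + T) ^ 2 *
        (‖initialValueₗ hT v‖ ^ 2 + T * ‖evolutionₗ hP hT hB hM v‖ ^ 2) ∧
      ‖initialValueₗ hT v‖ ^ 2 + T * ‖evolutionₗ hP hT hB hM v‖ ^ 2 ≤
        C * (1 + T) ^ 2 * h1Norm v ^ 2 := by
  obtain ⟨C₁, hC₁, hb₁⟩ := exists_potential_bound hP M
  obtain ⟨C₂, hC₂, hb₂⟩ := exists_apriori_bound hP M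
  refine ⟨3 + 2 * C₁ + C₂, by positivity, fun T hT B hB hM v => ?_⟩
  set D := evolutionₗ hP hT hB hM v with hD
  set x := initialValue (v : L2 T E) with hx
  set h := weakDeriv v with hh
  set V := potentialₗ hP hT hB hM (x, h) with hV
  have hDV : D = Complex.I • h - V := evolutionₗ_apply hP hT hB hM v
  have hN : h1Norm v ^ 2 = ‖x‖ ^ 2 + T * ‖h‖ ^ 2 := Real.sq_sqrt (by positivity)
  have hιx : initialValueₗ hT v = x := rfl
  have h1T : (1 : ℝ) ≤ (1 + T) ^ 2 := one_le_pow₀ (by linarith)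
  rw [hN, hιx]
  constructor
  · have h1 := hb₂ T hT B hB hM 1 ⟨zero_le_one, le_rfl⟩ x h D (Lp.memLp D) ?_
    · rw [← norm_sq_L2] at h1
      have h2 : ‖x‖ ^ 2 + T * ‖D‖ ^ 2 ≤ (1 + T) ^ 2 * (‖x‖ ^ 2 + T * ‖D‖ ^ 2) :=
        le_mul_of_one_le_left (by positivity) h1T
      have h3 : 0 ≤ (1 + T) ^ 2 * (‖x‖ ^ 2 + T * ‖D‖ ^ 2) := by positivity
      have h5 := sq_nonneg ‖x‖
      have h6 : 0 ≤ T * ‖D‖ ^ 2 := by positivity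
      have h4 : 0 ≤ C₁ * ((1 + T) ^ 2 * (‖x‖ ^ 2 + T * ‖D‖ ^ 2)) := by positivity
      linarith
    · have e3 := Lp.coeFn_smul Complex.I h
      have e : Complex.I • h = V + D := by rw [hDV]; abel
      rw [e] at e3
      filter_upwards [e3, Lp.coeFn_add V D, potentialₗ_ae_eq hP hT hB hM (x, h)] with t t1 t2 t3
      rw [Pi.smul_apply] at t1
      rw [← t1, t2, Pi.add_apply, t3, Complex.ofReal_one, one_smul]
  · have h1 := hb₁ T hT B hB hM x h
    rw [← norm_sq_potentialₗ hP hT hB hM (x, h)] at h1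
    have h2 : ‖D‖ ≤ ‖h‖ + ‖V‖ := by
      rw [hDV]
      refine (norm_sub_le _ _).trans (le_of_eq ?_)
      rw [norm_smul, Complex.norm_I, one_mul]
    have h3 : ‖D‖ ^ 2 ≤ 2 * (‖h‖ ^ 2 + ‖V‖ ^ 2) :=
      (pow_le_pow_left₀ (norm_nonneg _) h2 2).trans add_sq_le
    have h4 := mul_le_mul_of_nonneg_left h3 hT.le
    have h5 : ‖x‖ ^ 2 + T * ‖h‖ ^ 2 ≤ (1 + T) ^ 2 * (‖x‖ ^ 2 + T * ‖h‖ ^ 2) :=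
      le_mul_of_one_le_left (by positivity) h1T
    have h6 : 0 ≤ C₂ * ((1 + T) ^ 2 * (‖x‖ ^ 2 + T * ‖h‖ ^ 2)) := by positivity
    have h7 : 0 ≤ T * ‖h‖ ^ 2 := by positivity
    have h8 := sq_nonneg ‖x‖
    change T * ‖V‖ ^ 2 ≤ _ at h1
    linarith

lemma eq_zero_of_h1Norm_eq_zero (hT : 0 < T) {v : H1 T E} (h : h1Norm v = 0) : v = 0 := by
  rw [h1Norm, Real.sqrt_eq_zero (by positivity)] at h
  have h1 : 0 ≤ T * ‖weakDeriv v‖ ^ 2 := by positivity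
  have h2 := sq_nonneg ‖initialValue (v : L2 T E)‖
  have h3 : ‖initialValueₗ hT v‖ ^ 2 = 0 := by change ‖initialValue (v : L2 T E)‖ ^ 2 = 0; linarith
  have h4 : T * ‖weakDerivₗ v‖ ^ 2 = 0 := by change T * ‖weakDeriv v‖ ^ 2 = 0; linarith
  refine H1.ext_of hT (?_ : initialValueₗ hT v = initialValueₗ hT 0)
    (?_ : weakDerivₗ v = weakDerivₗ 0)
  · rw [map_zero]; simpa using h3
  · rw [map_zero]; simpa [hT.ne'] using h4

end Functional

end SpaceTimeSchrodinger

theorem mainTheorem2 {E : Type*} [NormedAddCommGroup E] [InnerProductSpace ℂ E] [CompleteSpace E]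
    [TopologicalSpace.SeparableSpace E] (H₀ A : E →ₗ.[ℂ] E) (hA : AssumptionA H₀ A) (M : ℝ) :
    ∃ α C : ℝ, 0 < α ∧ 0 < C ∧
      ∀ (T : ℝ), 0 < T →
      ∀ B : ℝ → E →L[ℂ] E, IsAdmissibleFamily T B → (∀ t ∈ Icc 0 T, ‖B t‖ ≤ M) →
      ∀ (u₀ : E) (f : L2 T E),
        FunctionalWellDefined H₀ A B f ∧
        IsQuadraticFunctional (functionalF H₀ A B u₀ f) ∧
        ∃ u : L2 T E,
          IsWeakSolution (H₀ + A) B u₀ f u ∧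
          (∀ u' : L2 T E, IsWeakSolution (H₀ + A) B u₀ f u' → u' = u) ∧
          ∃ v' : H1 T E,
            ((v' : L2 T E) =ᵐ[volume.restrict (Ioo (0 : ℝ) T)] fun t => expI H₀ t (u t)) ∧
            (∀ v : H1 T E,
              α / (1 + T) ^ gammaExp T B * h1Norm (v - v') ≤
                Real.sqrt (functionalF H₀ A B u₀ f v) ∧
              Real.sqrt (functionalF H₀ A B u₀ f v) ≤ C * (1 + T) * h1Norm (v - v')) ∧
            (∀ v : H1 T E, functionalF H₀ A B u₀ f v' ≤ functionalF H₀ A B u₀ f v) ∧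
            (∀ w : H1 T E,
              (∀ v : H1 T E, functionalF H₀ A B u₀ f w ≤ functionalF H₀ A B u₀ f v) →
              w = v') := by
  obtain ⟨ε, c, hP⟩ := hA.exists_smoothPerturbation
  have hU := hP.group
  obtain ⟨C, hC, hb⟩ := exists_evolution_bounds hP M
  refine ⟨1 / Real.sqrt C, Real.sqrt C, by positivity, by positivity,
    fun T hT B hB hM u₀ f => ⟨functionalWellDefined hP hT hB hM f, ?_⟩⟩
  set g : L2 T E := (memLp_group_apply hU (Lp.memLp f)).toLp with hg
  have hge : g =ᵐ[volume.restrict (Ioo (0 : ℝ) T)] fun t => expI H₀ t (f t) :=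
    MemLp.coeFn_toLp (memLp_group_apply hU (Lp.memLp f))
  have hF := functionalF_eq hP hT hB hM u₀ hge
  refine ⟨?_, ?_⟩
  · rw [funext hF]
    exact isQuadraticFunctional_norm_sq _ _ _ _ _
  obtain ⟨h, hh⟩ := exists_solution hP hT hB hM u₀ g
  have huL : MemLp (fun t => expI H₀ (-t) (primitive u₀ h t)) 2 (volume.restrict (Ioo 0 T)) :=
    memLp_Ioo_of_continuousOn (continuous_neg_primitive hU u₀ h).continuousOn
  set u : L2 T E := huL.toLp with hu
  have hue : u =ᵐ[volume.restrict (Ioo (0 : ℝ) T)]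
    fun t => expI H₀ (-t) (primitive u₀ h t) := MemLp.coeFn_toLp huL
  have hsol : IsWeakSolution (H₀ + A) B u₀ f u := by
    refine isWeakSolution_of_equation hP hT hB u₀ ?_ hue
    have e := Lp.coeFn_smul Complex.I h
    rw [hh] at e
    filter_upwards [e, Lp.coeFn_add (potentialₗ hP hT hB hM (u₀, h)) g, hge,
      potentialₗ_ae_eq hP hT hB hM (u₀, h)] with t t1 t2 t3 t4
    rw [Pi.smul_apply] at t1
    rw [← t1, t2, Pi.add_apply, t3, t4]
  set v' : H1 T E := primitiveH1 hT u₀ h with hv'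
  have hι : initialValueₗ hT v' = u₀ := initialValue_primitiveH1 hT u₀ h
  have hD : evolutionₗ hP hT hB hM v' = g := by
    rw [evolutionₗ_apply, hv', initialValue_primitiveH1, weakDeriv_primitiveH1, hh,
      add_sub_cancel_left]
  -- The functional is the squared norm of the image of `v - v'`.
  have hF' : ∀ v : H1 T E, functionalF H₀ A B u₀ f v =
      ‖initialValueₗ hT (v - v')‖ ^ 2 + T * ‖evolutionₗ hP hT hB hM (v - v')‖ ^ 2 := fun v => by
    rw [hF, map_sub, map_sub, hι, hD]
  have hF0 : ∀ v : H1 T E, 0 ≤ functionalF H₀ A B u₀ f v := fun v => by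
    rw [hF']; positivity
  have hFv' : functionalF H₀ A B u₀ f v' = 0 := by
    rw [hF', sub_self, map_zero, map_zero]; simp
  have hlow : ∀ v : H1 T E,
      h1Norm (v - v') ≤ Real.sqrt C * (1 + T) * Real.sqrt (functionalF H₀ A B u₀ f v) := fun v => by
    refine le_of_sq_le_sq ?_ (by positivity)
    rw [mul_pow, mul_pow, Real.sq_sqrt hC.le, Real.sq_sqrt (hF0 v), hF']
    exact (hb T hT B hB hM (v - v')).1
  refine ⟨u, hsol, fun u' hu' => hu'.unique hP hT hB hM hsol, v', ?_, fun v => ⟨?_, ?_⟩,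
    fun v => hFv' ▸ hF0 v, fun w hw => ?_⟩
  · filter_upwards [hue, primitiveH1_ae_eq hT u₀ h] with t h1 h2
    rw [h1, h2, hU.apply_neg]
  · -- `γ ≥ 1`, so the bound with the exponent `1` suffices.
    have h1T : 1 + T ≤ (1 + T) ^ gammaExp T B := by
      refine le_self_pow₀ (by linarith) ?_
      unfold gammaExp
      split_ifs <;> norm_num
    have h1 := (hlow v).trans (mul_le_mul_of_nonneg_right
      (mul_le_mul_of_nonneg_left h1T (Real.sqrt_nonneg C)) (Real.sqrt_nonneg _))
    rw [div_div, div_mul_eq_mul_div, one_mul, div_le_iff₀ (by positivity)]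
    linarith
  · refine Real.sqrt_le_iff.mpr ⟨?_, ?_⟩
    · have : 0 ≤ h1Norm (v - v') := Real.sqrt_nonneg _
      positivity
    · rw [mul_pow, mul_pow, Real.sq_sqrt hC.le, hF']
      exact (hb T hT B hB hM (v - v')).2
  · have h1 := hlow w
    have h2 : functionalF H₀ A B u₀ f w = 0 := le_antisymm (hFv' ▸ hw v') (hF0 w)
    rw [h2, Real.sqrt_zero, mul_zero] at h1
    exact sub_eq_zero.mp (eq_zero_of_h1Norm_eq_zero hT (le_antisymm h1 (Real.sqrt_nonneg _)))
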